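/- For $n=2,3,4$ let $X_n$ be the affine space of genus one models $\phi$ of degree $n$, with associated curve $C_\phi$: * $n=2$: $y^2+p(x,z)y=q(x,z)$ in $\mathbb P(1,1,2)$ (weights $1,1,2$ for $x,z,y$), with $p=\alpha_0x^2+\alpha_1xz+\alpha_2z^2$ and $q=ax^4+bx^3z+cx^2z^2+dxz^3+ez^4$; * $n=3$: a ternary cubic $ax^3+by^3+cz^3+a_2x^2y+a_3x^2z+b_1xy^2+b_3y^2z+c_1xz^2+c_2yz^2+mxyz=0$ in $\mathbb P^2$; * $n=4$: two quadratic forms $q_1=q_2=0$ in $\mathbb P^3$. A discriminant on $X_n$ is an irreducible polynomial $\Delta_{X_n}\in\mathbb Z[X_n]$ such that, for every Noetherian commutative ring $R$ and every model $\phi$ over $R$, $\Delta_{X_n}(\phi)\in R^*$ if and only if $C_\phi$ is non-singular over $R$, i.e. no geometric fibre of $C_\phi$ has a singular point (in the sense of the Jacobian criterion: for $n=2,3$ a point where all partial derivatives of the equation vanish; for $n=4$ a point where the gradients of $q_1,q_2$ are linearly dependent). Let $K$ be a field of characteristic different from $2$ and $3$, and let $W$ be the space of Weierstrass forms $y^2=4x^3-g_2x-g_3$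 over $K$, with $c_4=2^6\cdot 3\,g_2$, $c_6=2^9\cdot 3^3 g_3$ and $\Delta_W=(c_4^3-c_6^2)/1728=2^{12}(g_2^3-27g_3^2)$. For a binary quartic $ax^4+bx^3z+cx^2z^2+dxz^3+ez^4$ put $$i=\frac{12ae-3bd+c^2}{12},\qquad j=\frac{72ace-27ad^2-27b^2e+9bcd-2c^3}{432}.$$ Let $\varphi_n:X_n\to W$ be the following map: * $\varphi_2(p,q)$ is $y^2=4x^3-ix-j$ with $i,j$ taken for the quartic $q+\tfrac14p^2$; * $\varphi_3(\phi)$ is $y^2=4x^3+108Sx-27T$, where $S,T$ are the Aronhold invariants of the cubic $\phi$, normalized so that for the cubic $ax^3+by^3+cz^3+3a_2x^2y+\dots+3c_2yz^2+6mxyz$ the polynomial $S$ contains the term $abcm$ and $T$ the term $a^2b^2c^2$, each with coefficient $1$; * $\varphi_4(q_1,q_2)$ is $y^2=4x^3-ix-j$ with $i,j$ taken for the quartic $\det(xA+zB)$, where $A,B$ are the symmetric matrices of $q_1,q_2$. Put $\varphi_n^*(\Delta_W)(\phi)=\Delta_W(\varphi_n(\phi))$. **Proposition.** For $n=2,3,4$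 a discriminant $\Delta_{X_n}$ exists, and for every discriminant $\Delta_{X_n}$ there is a sign $\varepsilon\in\{1,-1\}$ such that, for every field $K$ of characteristic different from $2$ and $3$, there is exactly one constant $c\in K$ with $$\Delta_{X_n}=c\,\varphi_n^*(\Delta_W)\quad\text{in }K[X_n],$$ namely $c=\varepsilon\,2^a$, where $a=0$ if $n=2$, $a=-12$ if $n=3$, and $a=12$ if $n=4$. -/

import Mathlib

open MvPolynomial

universe u v

noncomputable section

namespace GenusOne

/-! ### Models of genus one curves and their singular points

A model of degree 2, 3 or 4 over a ring `R` is its vector of coefficients, a function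
`Fin 8 → R`, `Fin 10 → R` or `Fin 2 × Fin 10 → R` respectively.  -/

/-- Index set of the coefficients of models of degree 2,
`y² + (α₀x² + α₁xz + α₂z²) y = ax⁴ + bx³z + cx²z² + dxz³ + ez⁴`,
in the order `α₀, α₁, α₂, a, b, c, d, e`. -/
abbrev Idx2 : Type := Fin 8

/-- Index set of the coefficients of ternary cubics
`ax³ + by³ + cz³ + a₂x²y + a₃x²z + b₁xy² + b₃y²z + c₁xz² + c₂yz² + mxyz`,
in the order `a, b, c, a₂, a₃, b₁, b₃, c₁, c₂, m`. -/
abbrev Idx3 : Type := Fin 10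

/-- Index set of the coefficients of pairs of quaternary quadrics. The first index selects the quadric, the
second one its coefficient, in the order
`x₀², x₀x₁, x₀x₂, x₀x₃, x₁², x₁x₂, x₁x₃, x₂², x₂x₃, x₃²`. -/
abbrev Idx4 : Type := Fin 2 × Fin 10

/-- `y² + p(x,z) y - q(x,z)`, with the variables `x = X 0`, `z = X 1`, `y = X 2`. -/
def eqn2 {R : Type*} [CommRing R] (φ : Idx2 → R) : MvPolynomial (Fin 3) R :=
  X 2 ^ 2 + (C (φ 0) * X 0 ^ 2 + C (φ 1) * X 0 * X 1 + C (φ 2) * X 1 ^ 2) * X 2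
    - (C (φ 3) * X 0 ^ 4 + C (φ 4) * X 0 ^ 3 * X 1 + C (φ 5) * X 0 ^ 2 * X 1 ^ 2
      + C (φ 6) * X 0 * X 1 ^ 3 + C (φ 7) * X 1 ^ 4)

/-- The ternary cubic with coefficients `φ`, in the variables `x = X 0`, `y = X 1`, `z = X 2`. -/
def eqn3 {R : Type*} [CommRing R] (φ : Idx3 → R) : MvPolynomial (Fin 3) R :=
  C (φ 0) * X 0 ^ 3 + C (φ 1) * X 1 ^ 3 + C (φ 2) * X 2 ^ 3
    + C (φ 3) * X 0 ^ 2 * X 1 + C (φ 4) * X 0 ^ 2 * X 2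
    + C (φ 5) * X 0 * X 1 ^ 2 + C (φ 6) * X 1 ^ 2 * X 2
    + C (φ 7) * X 0 * X 2 ^ 2 + C (φ 8) * X 1 * X 2 ^ 2
    + C (φ 9) * X 0 * X 1 * X 2

/-- The quaternary quadratic form with coefficients `q`. -/
def quadric {R : Type*} [CommRing R] (q : Fin 10 → R) : MvPolynomial (Fin 4) R :=
  C (q 0) * X 0 ^ 2 + C (q 1) * X 0 * X 1 + C (q 2) * X 0 * X 2 + C (q 3) * X 0 * X 3
    + C (q 4) * X 1 ^ 2 + C (q 5) * X 1 * X 2 + C (q 6) * X 1 * X 3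
    + C (q 7) * X 2 ^ 2 + C (q 8) * X 2 * X 3 + C (q 9) * X 3 ^ 2

/-- The two quadrics of a model of degree 4. -/
def eqn4 {R : Type*} [CommRing R] (φ : Idx4 → R) (r : Fin 2) : MvPolynomial (Fin 4) R :=
  quadric fun m => φ (r, m)

/-- The curve `y² + p(x,z) y = q(x,z)` in the weighted projective plane `ℙ(1,1,2)` has a singular
`k`-point. (No point of the curve has `x = z = 0`.) -/
def Sing2 (k : Type u) [Field k] (φ : Idx2 → k) : Prop :=
  ∃ P : Fin 3 → k, (P 0 ≠ 0 ∨ P 1 ≠ 0) ∧ eval P (eqn2 φ) = 0 ∧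
    ∀ i, eval P (pderiv i (eqn2 φ)) = 0

/-- The plane curve defined by a ternary cubic has a singular `k`-point. -/
def Sing3 (k : Type u) [Field k] (φ : Idx3 → k) : Prop :=
  ∃ P : Fin 3 → k, P ≠ 0 ∧ eval P (eqn3 φ) = 0 ∧ ∀ i, eval P (pderiv i (eqn3 φ)) = 0

/-- The intersection of two quadrics in `ℙ³` has a `k`-point at which it is not smooth of dimension
one: the gradients of the two quadrics are linearly dependent there. -/
def Sing4 (k : Type u) [Field k] (φ : Idx4 → k) : Prop :=
  ∃ P : Fin 4 → k, P ≠ 0 ∧ (∀ r, eval P (eqn4 φ r) = 0) ∧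
    ¬ LinearIndependent k fun (r : Fin 2) (i : Fin 4) => eval P (pderiv i (eqn4 φ r))

/-! ### The discriminant -/

/-- The curve defined over `R` by the model `φ` is non-singular over `R`: none of its geometric
fibres has a singular point. -/
def Nonsingular {σ : Type} (Sing : ∀ (k : Type u) [Field k], (σ → k) → Prop)
    (R : Type u) [CommRing R] (φ : σ → R) : Prop :=
  ∀ (k : Type u) [Field k] [IsAlgClosed k] (f : R →+* k), ¬ Sing k fun s => f (φ s)

/-- `D` is the discriminant of a coefficient space (which is unique up to sign): the irreducible
polynomial with integer coefficients such that, over every Noetherian ring, a model defines a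
non-singular curve if and only if the value of `D` at the model is a unit. -/
structure IsDiscriminant {σ : Type} (Sing : ∀ (k : Type u) [Field k], (σ → k) → Prop)
    (D : MvPolynomial σ ℤ) : Prop where
  irreducible : Irreducible D
  isUnit_iff : ∀ (R : Type u) [CommRing R] [IsNoetherianRing R] (φ : σ → R),
    IsUnit (aeval φ D) ↔ Nonsingular Sing R φ

/-! ### Weierstrass forms `y² = 4x³ - g₂x - g₃` -/

/-- The invariant `c₄ = 2⁶·3·g₂` on the space `W` of Weierstrass forms `y² = 4x³ - g₂x - g₃`, whose
coordinates are `g₂ = X 0` and `g₃ = X 1`. -/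
def c4W (K : Type*) [Field K] : MvPolynomial (Fin 2) K := 2 ^ 6 * 3 * X 0

/-- The invariant `c₆ = 2⁹·3³·g₃` on `W`. -/
def c6W (K : Type*) [Field K] : MvPolynomial (Fin 2) K := 2 ^ 9 * 3 ^ 3 * X 1

/-- The discriminant `Δ_W = (c₄³ - c₆²) / 1728` on `W`. -/
def discW (K : Type*) [Field K] : MvPolynomial (Fin 2) K :=
  C (1 / 1728) * (c4W K ^ 3 - c6W K ^ 2)

/-- The curve obtained from `y² = 4x³ - g₂x - g₃` by the substitution `(x, y) ↦ (x/4, y/4)`, for the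
universal `g₂`, `g₃`. -/
def curveW (K : Type*) [Field K] : WeierstrassCurve (MvPolynomial (Fin 2) K) :=
  ⟨0, 0, 0, -4 * X 0, -16 * X 1⟩

theorem c4W_eq (K : Type*) [Field K] : c4W K = (curveW K).c₄ := by
  simp [c4W, curveW, WeierstrassCurve.c₄, WeierstrassCurve.b₂, WeierstrassCurve.b₄]
  ring

theorem c6W_eq (K : Type*) [Field K] : c6W K = (curveW K).c₆ := by
  simp [c6W, curveW, WeierstrassCurve.c₆, WeierstrassCurve.b₂, WeierstrassCurve.b₄,
    WeierstrassCurve.b₆]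
  ring

theorem discW_eq (K : Type*) [Field K] (h2 : (2 : K) ≠ 0) (h3 : (3 : K) ≠ 0) :
    discW K = (curveW K).Δ := by
  have h : (1728 : K) ≠ 0 := by
    have : (1728 : K) = 2 ^ 6 * 3 ^ 3 := by norm_num
    rw [this]
    exact mul_ne_zero (pow_ne_zero _ h2) (pow_ne_zero _ h3)
  have e : (1728 : MvPolynomial (Fin 2) K) = C 1728 := (map_ofNat C 1728).symm
  rw [discW, c4W_eq, c6W_eq, ← WeierstrassCurve.c_relation, e, ← mul_assoc, ← C_mul,
    one_div_mul_cancel h, C_1, one_mul]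

/-! ### Classical invariants -/

section Invariants

variable (K : Type*) [Field K] {A : Type*} [CommRing A] [Algebra K A]

/-- The invariant `i = (12ae - 3bd + c²)/12` of a quartic, here dehomogenised at `z = 1`, so that
`a, b, c, d, e` are the coefficients of `x⁴, x³, x², x, 1`. -/
def quarticI (h : Polynomial A) : A :=
  (1 / 12 : K) • (12 * h.coeff 4 * h.coeff 0 - 3 * h.coeff 3 * h.coeff 1 + h.coeff 2 ^ 2)

/-- The invariant `j = (72ace - 27ad² - 27b²e + 9bcd - 2c³)/432` of a quartic. -/
def quarticJ (h : Polynomial A) : A :=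
  (1 / 432 : K) • (72 * h.coeff 4 * h.coeff 2 * h.coeff 0 - 27 * h.coeff 4 * h.coeff 1 ^ 2
    - 27 * h.coeff 3 ^ 2 * h.coeff 0 + 9 * h.coeff 3 * h.coeff 2 * h.coeff 1 - 2 * h.coeff 2 ^ 3)

end Invariants

/-- Aronhold's invariant `S` of the ternary cubic
`ax³ + by³ + cz³ + 3a₂x²y + 3a₃x²z + 3b₁xy² + 3b₃y²z + 3c₁xz² + 3c₂yz² + 6mxyz`. -/
def aronholdS {A : Type*} [CommRing A] (a b c a2 a3 b1 b3 c1 c2 m : A) : A :=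
    a * b * c * m - a * b * c1 * c2 - a * c * b1 * b3 + a * b1 * c2 ^ 2 + a * b3 ^ 2 * c1
    - a * b3 * c2 * m - b * c * a2 * a3 + b * a2 * c1 ^ 2 + b * a3 ^ 2 * c2 - b * a3 * c1 * m
    + c * a2 ^ 2 * b3 - c * a2 * b1 * m + c * a3 * b1 ^ 2 - a2 ^ 2 * c2 ^ 2 + a2 * a3 * b3 * c2
    + a2 * b1 * c1 * c2 - 3 * a2 * b3 * c1 * m + 2 * a2 * c2 * m ^ 2 - a3 ^ 2 * b3 ^ 2
    + a3 * b1 * b3 * c1 - 3 * a3 * b1 * c2 * m + 2 * a3 * b3 * m ^ 2 - b1 ^ 2 * c1 ^ 2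
    + 2 * b1 * c1 * m ^ 2 - m ^ 4

/-- Aronhold's invariant `T` of the same ternary cubic. -/
def aronholdT {A : Type*} [CommRing A] (a b c a2 a3 b1 b3 c1 c2 m : A) : A :=
    a ^ 2 * b ^ 2 * c ^ 2 - 6 * a ^ 2 * b * c * b3 * c2 + 4 * a ^ 2 * b * c2 ^ 3
    + 4 * a ^ 2 * c * b3 ^ 3 - 3 * a ^ 2 * b3 ^ 2 * c2 ^ 2 - 6 * a * b ^ 2 * c * a3 * c1
    + 4 * a * b ^ 2 * c1 ^ 3 - 6 * a * b * c ^ 2 * a2 * b1 + 6 * a * b * c * a2 * b3 * c1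
    + 12 * a * b * c * a2 * c2 * m + 6 * a * b * c * a3 * b1 * c2 + 12 * a * b * c * a3 * b3 * m
    + 12 * a * b * c * b1 * c1 * m - 20 * a * b * c * m ^ 3 - 12 * a * b * a2 * c1 * c2 ^ 2
    + 18 * a * b * a3 * b3 * c1 * c2 - 24 * a * b * a3 * c2 ^ 2 * m
    - 12 * a * b * b1 * c1 ^ 2 * c2 - 24 * a * b * b3 * c1 ^ 2 * m + 36 * a * b * c1 * c2 * m ^ 2
    + 4 * a * c ^ 2 * b1 ^ 3 + 18 * a * c * a2 * b1 * b3 * c2 - 24 * a * c * a2 * b3 ^ 2 * m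
    - 12 * a * c * a3 * b1 * b3 ^ 2 - 12 * a * c * b1 ^ 2 * b3 * c1 - 24 * a * c * b1 ^ 2 * c2 * m
    + 36 * a * c * b1 * b3 * m ^ 2 - 12 * a * a2 * b1 * c2 ^ 3 + 6 * a * a2 * b3 ^ 2 * c1 * c2
    + 12 * a * a2 * b3 * c2 ^ 2 * m + 6 * a * a3 * b1 * b3 * c2 ^ 2 - 12 * a * a3 * b3 ^ 3 * c1
    + 12 * a * a3 * b3 ^ 2 * c2 * m + 24 * a * b1 ^ 2 * c1 * c2 ^ 2
    + 24 * a * b1 * b3 ^ 2 * c1 ^ 2 - 60 * a * b1 * b3 * c1 * c2 * m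
    + 12 * a * b1 * c2 ^ 2 * m ^ 2 + 12 * a * b3 ^ 2 * c1 * m ^ 2 - 12 * a * b3 * c2 * m ^ 3
    + 4 * b ^ 2 * c * a3 ^ 3 - 3 * b ^ 2 * a3 ^ 2 * c1 ^ 2 + 4 * b * c ^ 2 * a2 ^ 3
    - 12 * b * c * a2 ^ 2 * a3 * c2 - 24 * b * c * a2 ^ 2 * c1 * m - 12 * b * c * a2 * a3 ^ 2 * b3
    + 18 * b * c * a2 * a3 * b1 * c1 + 36 * b * c * a2 * a3 * m ^ 2 - 24 * b * c * a3 ^ 2 * b1 * m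
    + 24 * b * a2 ^ 2 * c1 ^ 2 * c2 + 24 * b * a2 * a3 ^ 2 * c2 ^ 2
    + 6 * b * a2 * a3 * b3 * c1 ^ 2 - 60 * b * a2 * a3 * c1 * c2 * m - 12 * b * a2 * b1 * c1 ^ 3
    + 12 * b * a2 * c1 ^ 2 * m ^ 2 - 12 * b * a3 ^ 3 * b3 * c2 + 6 * b * a3 ^ 2 * b1 * c1 * c2
    + 12 * b * a3 ^ 2 * b3 * c1 * m + 12 * b * a3 ^ 2 * c2 * m ^ 2 + 12 * b * a3 * b1 * c1 ^ 2 * m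
    - 12 * b * a3 * c1 * m ^ 3 - 3 * c ^ 2 * a2 ^ 2 * b1 ^ 2 - 12 * c * a2 ^ 3 * b3 * c2
    + 24 * c * a2 ^ 2 * a3 * b3 ^ 2 + 6 * c * a2 ^ 2 * b1 * b3 * c1
    + 12 * c * a2 ^ 2 * b1 * c2 * m + 12 * c * a2 ^ 2 * b3 * m ^ 2 + 6 * c * a2 * a3 * b1 ^ 2 * c2
    - 60 * c * a2 * a3 * b1 * b3 * m + 12 * c * a2 * b1 ^ 2 * c1 * m - 12 * c * a2 * b1 * m ^ 3
    + 24 * c * a3 ^ 2 * b1 ^ 2 * b3 - 12 * c * a3 * b1 ^ 3 * c1 + 12 * c * a3 * b1 ^ 2 * m ^ 2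
    + 8 * a2 ^ 3 * c2 ^ 3 - 12 * a2 ^ 2 * a3 * b3 * c2 ^ 2 - 12 * a2 ^ 2 * b1 * c1 * c2 ^ 2
    - 27 * a2 ^ 2 * b3 ^ 2 * c1 ^ 2 + 36 * a2 ^ 2 * b3 * c1 * c2 * m
    - 24 * a2 ^ 2 * c2 ^ 2 * m ^ 2 - 12 * a2 * a3 ^ 2 * b3 ^ 2 * c2
    - 6 * a2 * a3 * b1 * b3 * c1 * c2 + 36 * a2 * a3 * b1 * c2 ^ 2 * m
    + 36 * a2 * a3 * b3 ^ 2 * c1 * m - 12 * a2 * a3 * b3 * c2 * m ^ 2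
    - 12 * a2 * b1 ^ 2 * c1 ^ 2 * c2 + 36 * a2 * b1 * b3 * c1 ^ 2 * m
    - 12 * a2 * b1 * c1 * c2 * m ^ 2 - 36 * a2 * b3 * c1 * m ^ 3 + 24 * a2 * c2 * m ^ 4
    + 8 * a3 ^ 3 * b3 ^ 3 - 27 * a3 ^ 2 * b1 ^ 2 * c2 ^ 2 - 12 * a3 ^ 2 * b1 * b3 ^ 2 * c1
    + 36 * a3 ^ 2 * b1 * b3 * c2 * m - 24 * a3 ^ 2 * b3 ^ 2 * m ^ 2
    - 12 * a3 * b1 ^ 2 * b3 * c1 ^ 2 + 36 * a3 * b1 ^ 2 * c1 * c2 * m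
    - 12 * a3 * b1 * b3 * c1 * m ^ 2 - 36 * a3 * b1 * c2 * m ^ 3 + 24 * a3 * b3 * m ^ 4
    + 8 * b1 ^ 3 * c1 ^ 3 - 24 * b1 ^ 2 * c1 ^ 2 * m ^ 2 + 24 * b1 * c1 * m ^ 4 - 8 * m ^ 6

/-! ### The maps `φₙ` to Weierstrass forms, over a field of characteristic different from 2 and 3

Each one is given by the polynomials `g₂`, `g₃` in the coefficients of the model. -/

section Maps

variable (K : Type*) [Field K]

/-- The quartic `q + p²/4` which completing the square gives for the generic model of
degree 2. -/
def genericQuartic2 : Polynomial (MvPolynomial Idx2 K) :=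
  let x : Polynomial (MvPolynomial Idx2 K) := Polynomial.X
  let c : Idx2 → Polynomial (MvPolynomial Idx2 K) := fun s => Polynomial.C (X s)
  let p := c 0 * x ^ 2 + c 1 * x + c 2
  let q := c 3 * x ^ 4 + c 4 * x ^ 3 + c 5 * x ^ 2 + c 6 * x + c 7
  q + (1 / 4 : K) • p ^ 2

/-- `φ₂ : y² = 4x³ - i x - j`. -/
def toW2 : Fin 2 → MvPolynomial Idx2 K :=
  ![quarticI K (genericQuartic2 K), quarticJ K (genericQuartic2 K)]

/-- `S` of the generic ternary cubic. -/
def genericS : MvPolynomial Idx3 K :=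
  let t : Idx3 → MvPolynomial Idx3 K := fun s => (1 / 3 : K) • X s
  aronholdS (X 0) (X 1) (X 2) (t 3) (t 4) (t 5) (t 6) (t 7) (t 8) ((1 / 6 : K) • X 9)

/-- `T` of the generic ternary cubic. -/
def genericT : MvPolynomial Idx3 K :=
  let t : Idx3 → MvPolynomial Idx3 K := fun s => (1 / 3 : K) • X s
  aronholdT (X 0) (X 1) (X 2) (t 3) (t 4) (t 5) (t 6) (t 7) (t 8) ((1 / 6 : K) • X 9)

/-- `φ₃ : y² = 4x³ + 108 S x - 27 T`. -/
def toW3 : Fin 2 → MvPolynomial Idx3 K :=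
  ![-108 * genericS K, 27 * genericT K]

/-- The symmetric matrix of the generic quadratic form with index `r`. -/
def genericMatrix (r : Fin 2) : Matrix (Fin 4) (Fin 4) (MvPolynomial Idx4 K) :=
  let d : Fin 10 → MvPolynomial Idx4 K := fun m => X (r, m)
  let h : Fin 10 → MvPolynomial Idx4 K := fun m => (1 / 2 : K) • X (r, m)
  !![d 0, h 1, h 2, h 3;
     h 1, d 4, h 5, h 6;
     h 2, h 5, d 7, h 8;
     h 3, h 6, h 8, d 9]

/-- The quartic `det (x A + z B)` at `z = 1`, where `A` and `B` are the symmetric matrices of the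
two quadrics of the generic model of degree 4. -/
def genericQuartic4 : Polynomial (MvPolynomial Idx4 K) :=
  ((Polynomial.X : Polynomial (MvPolynomial Idx4 K)) • (genericMatrix K 0).map Polynomial.C
    + (genericMatrix K 1).map Polynomial.C).det

/-- `φ₄ : y² = 4x³ - i x - j` for the quartic `det (x A + z B)`. -/
def toW4 : Fin 2 → MvPolynomial Idx4 K :=
  ![quarticI K (genericQuartic4 K), quarticJ K (genericQuartic4 K)]

/-- The pull-back `φ*(Δ_W)` of `Δ_W` under a polynomial map `φ` to `W`. -/
def pullbackDiscW {σ : Type} (φ : Fin 2 → MvPolynomial σ K) : MvPolynomial σ K :=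
  bind₁ φ (discW K)

end Maps

end GenusOne

end

namespace GenusOne

/-! ### Discriminants and geometric points -/

/-! In each degree a discriminant is the discriminant Δ of an integral Weierstrass equation attached
to the model: `jac2` in degree 2, `jac3` in degree 3, and in degree 4 `jac2` of the double cover
`rulings4`, for which p² + 4q is the determinant of the polar form of xq₁ + zq₂. These formulas have
no denominators, so they define polynomials over ℤ.

A ring element is a unit exactly when it vanishes at no geometric point, so the unit criterion says
that over algebraically closed fields Δ = 0 is the locus of singular models. If a model is singular,
shears and exchanges of coordinates, which preserve Δ, carry the singular point to a fixed
coordinate point, where Δ = 0 is visible. Conversely, if Δ = 0, the Weierstrass curve has a singular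
point (`exists_singular_point_of_Δ_eq_zero`), which is carried back to the model: degree 2 reduces
to Weierstrass form by moving a branch point to infinity (`exists_singAt2`), degree 3 reduces to
degree 2 by projection from a point of the cubic (`exists_singAt3`), degree 4 reduces to degree 2 by
linear algebra on the singular quadric of the pencil (`exists_singAt4`).

The first reduction also shows that all singular models are specialisations of one model over a
polynomial ring, so their locus is irreducible and Δ is, up to sign, a power of an irreducible
polynomial. The power is the first one, since Δ has a simple zero at T = 0 on the family y² + xy =
x³ + T, embedded in each of the three degrees. This is `isDiscriminant_of_generic`.

For the constant, any two discriminants have the same geometric zeros and are irreducible, hence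
agree up to a unit of ℤ[X], that is, a sign. Over K the pulled back c₄ and c₆ are λ⁴ and λ⁶ times
those of the Jacobian, with λ = 1, 2, 1/2 in degrees 2, 3, 4, so φₙ*(Δ_W) = λ¹² Δ
(`pullbackDiscW_eq`). -/

/-- A non-unit lies in a maximal ideal, hence dies in the algebraic closure of the residue field. -/
theorem isUnit_of_forall_geometric_point {R : Type u} [CommRing R] {r : R}
    (h : ∀ (k : Type u) [Field k] [IsAlgClosed k] (f : R →+* k), f r ≠ 0) : IsUnit r := by
  by_contra hr
  obtain ⟨m, hm, hrm⟩ := exists_max_ideal_of_mem_nonunits (mem_nonunits_iff.mpr hr)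
  let := Ideal.Quotient.field m
  refine h (AlgebraicClosure (R ⧸ m))
    ((algebraMap (R ⧸ m) (AlgebraicClosure (R ⧸ m))).comp (Ideal.Quotient.mk m)) ?_
  simp [Ideal.Quotient.eq_zero_iff_mem.mpr hrm]

theorem map_aeval_int {σ : Type*} {R S : Type*} [CommRing R] [CommRing S] [Algebra ℤ R]
    [Algebra ℤ S] (f : R →+* S) (φ : σ → R) (D : MvPolynomial σ ℤ) :
    f (aeval φ D) = aeval (fun s => f (φ s)) D := by
  induction D using MvPolynomial.induction_on with
  | C a => simp
  | add p q hp hq => simp [hp, hq]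
  | mul_X p i hp => simp [hp]

/-- An integral polynomial which vanishes at no geometric point with `G ≠ 0` divides a power of
`G`. -/
theorem dvd_pow_of_geometric_points {σ : Type} (D G : MvPolynomial σ ℤ)
    (h : ∀ (k : Type u) [Field k] [IsAlgClosed k] (φ : σ → k), aeval φ D = 0 → aeval φ G = 0) :
    ∃ N, D ∣ G ^ N := by
  -- Dividing a power of G means becoming a unit after inverting G. The geometric points of the
  -- localization are those with G ≠ 0, where D does not vanish by hypothesis.
  rw [← IsLocalization.Away.algebraMap_isUnit_iff (S := Localization.Away G)]
  -- The localization lives in `Type`, while the geometric points take values in `Type u`.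
  let e : Localization.Away G ≃+* ULift.{u} (Localization.Away G) := ULift.ringEquiv.symm
  rw [← MulEquiv.isUnit_map e]
  refine isUnit_of_forall_geometric_point fun k _ _ f hf => ?_
  let g : MvPolynomial σ ℤ →+* k :=
    (f.comp (e : Localization.Away G →+* _)).comp (algebraMap _ (Localization.Away G))
  have hg : ∀ P, g P = aeval (fun s => g (X s)) P := by
    intro P
    rw [← map_aeval_int, aeval_X_left_apply]
  have h1 : g D = 0 := hf
  have h2 : g G = 0 := by
    rw [hg] at h1 ⊢
    exact h k _ h1
  have h3 : IsUnit (g G) := by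
    have := IsLocalization.Away.algebraMap_isUnit (S := Localization.Away G) G
    exact (this.map (e : Localization.Away G →+* _)).map f
  exact h3.ne_zero h2

/-- Over a field the unit criterion fixes the zeros, so D divides a power of D'; irreducibility of
both then leaves only a unit between them. -/
theorem IsDiscriminant.associated {σ : Type} [Finite σ]
    {Sing : ∀ (k : Type u) [Field k], (σ → k) → Prop} {D D' : MvPolynomial σ ℤ}
    (hD : IsDiscriminant.{u} Sing D) (hD' : IsDiscriminant.{u} Sing D') : Associated D D' := by
  obtain ⟨N, hN⟩ := dvd_pow_of_geometric_points.{u} D D' fun k _ _ φ h => by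
    by_contra h'
    have := (hD'.isUnit_iff k φ).mp (isUnit_iff_ne_zero.mpr h')
    exact ((hD.isUnit_iff k φ).mpr this).ne_zero h
  exact hD.irreducible.associated_of_dvd hD'.irreducible (hD.irreducible.prime.dvd_of_dvd_pow hN)

theorem exists_irreducible_dvd_of_map_eq_zero {R A : Type*} [CommRing R] [IsDomain R]
    [UniqueFactorizationMonoid R] [CommRing A] [IsDomain A] (f : R →+* A) {D : R} (hD : D ≠ 0)
    (h : f D = 0) : ∃ p, Irreducible p ∧ p ∣ D ∧ f p = 0 := by
  have h1 : f (UniqueFactorizationMonoid.factors D).prod = 0 := by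
    obtain ⟨w, hw⟩ := (UniqueFactorizationMonoid.factors_prod hD).symm
    rw [← hw, map_mul, h, zero_mul]
  rw [map_multiset_prod, Multiset.prod_eq_zero_iff, Multiset.mem_map] at h1
  obtain ⟨p, hp, hp0⟩ := h1
  exact ⟨p, UniqueFactorizationMonoid.irreducible_of_factor p hp,
    UniqueFactorizationMonoid.dvd_of_mem_factors hp, hp0⟩

/-- A polynomial whose zero locus is the locus of singular models is the discriminant if the
singular models are the specialisations of a single model `Θ` over a domain, and if the polynomial
has a simple zero along some line. -/
theorem isDiscriminant_of_generic {σ : Type} [Finite σ]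
    {Sing : ∀ (k : Type u) [Field k], (σ → k) → Prop} (D : MvPolynomial σ ℤ)
    {A : Type} [CommRing A] [IsDomain A] (Θ : σ → A) (hΘ : aeval Θ D = 0)
    (hspec : ∀ (k : Type u) [Field k] [IsAlgClosed k] (φ : σ → k), Sing k φ →
      ∃ f : A →+* k, ∀ s, f (Θ s) = φ s)
    (hsing : ∀ (k : Type u) [Field k] [IsAlgClosed k] (φ : σ → k), aeval φ D = 0 → Sing k φ)
    (w : σ → Polynomial ℤ) (v : Polynomial ℤ) (hw : aeval w D = Polynomial.X * v)
    (hv : v.coeff 0 ≠ 0) : IsDiscriminant.{u} Sing D where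
  irreducible := by
    have hD : D ≠ 0 := by
      rintro rfl
      rw [map_zero, eq_comm, mul_eq_zero] at hw
      rcases hw with hw | hw
      · exact Polynomial.X_ne_zero hw
      · simp [hw] at hv
    -- The values lie in a domain, so a single irreducible factor p already vanishes at the generic
    -- singular model, and therefore at all of its specialisations, which are all the zeros of D.
    obtain ⟨p, hp, hpD, hp0⟩ :=
      exists_irreducible_dvd_of_map_eq_zero (aeval Θ : MvPolynomial σ ℤ →ₐ[ℤ] A).toRingHom hD hΘ
    obtain ⟨N, hN⟩ := dvd_pow_of_geometric_points.{u} D p fun k _ _ φ h => by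
      obtain ⟨f, hf⟩ := hspec k φ (hsing k φ h)
      obtain rfl : (fun s => f (Θ s)) = φ := funext hf
      rw [← map_aeval_int]
      exact (congrArg f hp0).trans (map_zero f)
    obtain ⟨i, -, hi⟩ := (dvd_prime_pow hp.prime N).mp hN
    obtain ⟨c, hc⟩ := hi.symm
    have hcX : (aeval w p) ^ i * aeval w (c : MvPolynomial σ ℤ) = Polynomial.X * v := by
      rw [← hw, ← hc, map_mul, map_pow]
    have hcu : IsUnit (aeval w (c : MvPolynomial σ ℤ)) := c.isUnit.map _
    have hX : Polynomial.X ∣ aeval w p := by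
      have : Polynomial.X ∣ (aeval w p) ^ i := hcu.dvd_mul_right.mp (hcX ▸ dvd_mul_right _ _)
      exact Polynomial.prime_X.dvd_of_dvd_pow this
    -- D is associated to pⁱ. On the line, p is divisible by T, whereas D has only a simple zero at
    -- T = 0; this excludes i ≥ 2, and i = 0 would make D a unit on the line.
    have hi1 : i < 2 := by
      by_contra! h2
      have h3 : (Polynomial.X : Polynomial ℤ) * Polynomial.X ∣ Polynomial.X * v := by
        rw [← hcX, ← sq]
        exact ((pow_dvd_pow _ h2).trans (pow_dvd_pow_of_dvd hX i)).trans (dvd_mul_right _ _)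
      have h4 := (mul_dvd_mul_iff_left Polynomial.X_ne_zero).mp h3
      exact hv (Polynomial.X_dvd_iff.mp h4)
    have hi0 : i ≠ 0 := by
      rintro rfl
      rw [pow_zero, one_mul] at hcX
      rw [hcX] at hcu
      exact Polynomial.not_isUnit_X (isUnit_of_mul_isUnit_left hcu)
    obtain rfl : i = 1 := by omega
    rw [pow_one] at hc
    rw [← hc]
    exact (irreducible_mul_units c).mpr hp
  isUnit_iff R _ _ φ := by
    have hcrit : ∀ (k : Type u) [Field k] [IsAlgClosed k] (ψ : σ → k), Sing k ψ →
        aeval ψ D = 0 := by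
      intro k _ _ ψ h
      obtain ⟨f, hf⟩ := hspec k ψ h
      obtain rfl : (fun s => f (Θ s)) = ψ := funext hf
      rw [← map_aeval_int, hΘ, map_zero]
    constructor
    · intro h k _ _ f hs
      have := (h.map f).ne_zero
      rw [map_aeval_int] at this
      exact this (hcrit k _ hs)
    · intro h
      refine isUnit_of_forall_geometric_point fun k _ _ f h0 => ?_
      rw [map_aeval_int] at h0
      exact h k f (hsing k _ h0)

/-- The comparison of all discriminants with a polynomial `T` over fields, given the comparison for
one of them. -/
theorem discriminant_comparison {σ : Type} [Finite σ]
    {Sing : ∀ (k : Type u) [Field k], (σ → k) → Prop} {D : MvPolynomial σ ℤ}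
    (hD : IsDiscriminant.{u} Sing D) (T : ∀ (K : Type v) [Field K], MvPolynomial σ K) (a : ℤ)
    (hT : ∀ (K : Type v) [Field K], (2 : K) ≠ 0 → (3 : K) ≠ 0 →
      map (Int.castRingHom K) D = C (2 ^ a) * T K)
    (w : σ → Polynomial ℤ) (v : Polynomial ℤ) (hw : aeval w D = Polynomial.X * v)
    (hv : v.coeff 0 = -1) :
    (∃ D : MvPolynomial σ ℤ, IsDiscriminant.{u} Sing D) ∧
      ∀ D : MvPolynomial σ ℤ, IsDiscriminant.{u} Sing D → ∃ ε : ℤ, (ε = 1 ∨ ε = -1) ∧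
        ∀ (K : Type v) [Field K], (2 : K) ≠ 0 → (3 : K) ≠ 0 → ∀ c : K,
          (map (Int.castRingHom K) D = C c * T K) ↔ c = (ε : K) * 2 ^ a := by
  refine ⟨⟨D, hD⟩, fun D' hD' => ?_⟩
  obtain ⟨e, he⟩ := hD.associated hD'
  -- The units of ℤ[X] are the constants ±1. The sign is fixed here, before any field K is chosen.
  obtain ⟨ε, hε, hεe⟩ := isUnit_iff_eq_C_of_isReduced.mp e.isUnit
  refine ⟨ε, Int.isUnit_iff.mp hε, fun K _ h2 h3 c => ?_⟩
  have hmap : map (Int.castRingHom K) D' = C ((ε : K) * 2 ^ a) * T K := by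
    rw [← he, hεe, map_mul, hT K h2 h3, map_C, C_mul]
    simp only [eq_intCast]
    ring
  -- On the line w the coefficient of T in D is -1, which is nonzero in every field. Hence `T K` is
  -- nonzero too, and this gives the uniqueness of c.
  have hne : map (Int.castRingHom K) D ≠ 0 := by
    intro h0
    have h1 : (aeval (fun s => (w s).map (Int.castRingHom K)) D : Polynomial K) =
        Polynomial.X * v.map (Int.castRingHom K) := by
      have := congrArg (Polynomial.mapRingHom (Int.castRingHom K)) hw
      rw [map_aeval_int, map_mul] at this
      simpa using this
    have h4 : (aeval (fun s => (w s).map (Int.castRingHom K)) D : Polynomial K) = 0 := by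
      have := congrArg (aeval (R := K) fun s => (w s).map (Int.castRingHom K)) h0
      rw [map_zero, aeval_def, eval₂_map] at this
      rw [aeval_def]
      convert this using 2
      exact RingHom.ext_int _ _
    rw [h4] at h1
    have h5 := congrArg (fun P => Polynomial.coeff P 1) h1
    simp [hv] at h5
  have hT0 : T K ≠ 0 := by
    intro h
    rw [hT K h2 h3, h, mul_zero] at hne
    exact hne rfl
  rw [hmap]
  constructor
  · intro h
    exact (C_injective _ _ (mul_right_cancel₀ hT0 h)).symm
  · rintro rfl
    rfl

/-! ### Singular points of Weierstrass curves -/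

section Weierstrass

theorem weierstrass_Δ_eq_of_variableChange {R : Type*} [CommRing R] {W W' : WeierstrassCurve R}
    (r s t : R) (h : W' = (⟨1, r, s, t⟩ : WeierstrassCurve.VariableChange R) • W) :
    W'.Δ = W.Δ := by
  rw [h, WeierstrassCurve.variableChange_Δ]
  simp

theorem exists_sq_eq {k : Type*} [Field k] [IsAlgClosed k] (a : k) : ∃ x, x ^ 2 = a :=
  IsAlgClosed.exists_pow_nat_eq a two_pos

theorem exists_quadratic_root {k : Type*} [Field k] [IsAlgClosed k] {a : k} (ha : a ≠ 0)
    (b c : k) : ∃ x, a * x ^ 2 + b * x + c = 0 := by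
  obtain ⟨x, hx⟩ := IsAlgClosed.exists_root
    (Polynomial.C a * Polynomial.X ^ 2 + Polynomial.C b * Polynomial.X + Polynomial.C c)
    (by rw [Polynomial.degree_quadratic ha]; decide)
  exact ⟨x, by simpa [Polynomial.IsRoot.def] using hx⟩

theorem exists_cubic_root {k : Type*} [Field k] [IsAlgClosed k] {a : k} (ha : a ≠ 0)
    (b c d : k) : ∃ x, a * x ^ 3 + b * x ^ 2 + c * x + d = 0 := by
  obtain ⟨x, hx⟩ := IsAlgClosed.exists_root
    (Polynomial.C a * Polynomial.X ^ 3 + Polynomial.C b * Polynomial.X ^ 2 +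
      Polynomial.C c * Polynomial.X + Polynomial.C d)
    (by rw [Polynomial.degree_cubic ha]; decide)
  exact ⟨x, by simpa [Polynomial.IsRoot.def] using hx⟩

theorem exists_quartic_root {k : Type*} [Field k] [IsAlgClosed k] {a : k} (ha : a ≠ 0)
    (b c d e : k) : ∃ x, a * x ^ 4 + b * x ^ 3 + c * x ^ 2 + d * x + e = 0 := by
  have hdeg : (Polynomial.C a * Polynomial.X ^ 4 + (Polynomial.C b * Polynomial.X ^ 3 +
      Polynomial.C c * Polynomial.X ^ 2 + Polynomial.C d * Polynomial.X +
      Polynomial.C e)).degree = 4 := by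
    rw [Polynomial.degree_add_eq_left_of_degree_lt, Polynomial.degree_C_mul_X_pow 4 ha]
    · rfl
    · rw [Polynomial.degree_C_mul_X_pow 4 ha]
      exact Polynomial.degree_cubic_lt
  obtain ⟨x, hx⟩ := IsAlgClosed.exists_root _ (hdeg.trans_ne (by decide))
  exact ⟨x, by simpa [Polynomial.IsRoot.def, add_assoc] using hx⟩

/-- Completing the square turns the curve into η² = 4x³ + b₂x² + 2b₄x + b₆ with η = 2y + a₁x + a₃. A
double root of the cubic gives a singular point with η = 0. -/
theorem weierstrass_double_root {k : Type*} [Field k] (h2 : (2 : k) ≠ 0) (a1 a2 a3 a4 a6 x : k)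
    (h0 : 4 * x ^ 3 + (a1 ^ 2 + 4 * a2) * x ^ 2 + 2 * (2 * a4 + a1 * a3) * x
      + (a3 ^ 2 + 4 * a6) = 0)
    (h1 : 6 * x ^ 2 + (a1 ^ 2 + 4 * a2) * x + (2 * a4 + a1 * a3) = 0) :
    ∃ y : k, y ^ 2 + a1 * x * y + a3 * y = x ^ 3 + a2 * x ^ 2 + a4 * x + a6 ∧
      a1 * y = 3 * x ^ 2 + 2 * a2 * x + a4 ∧ 2 * y + a1 * x + a3 = 0 := by
  refine ⟨-(a1 * x + a3) / 2, ?_, ?_, ?_⟩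
  · field_simp
    linear_combination -h0
  · field_simp
    linear_combination -h1
  · field_simp
    ring

/-- Dividing the cubic by its root r leaves 4x² + (b₂ + 4r)x + 2b₄ + (b₂ + 4r)r. Up to a constant
factor, the discriminant of the cubic is that of this quadratic times the square of the derivative
at r. -/
theorem weierstrass_Δ_eq_zero_root {k : Type*} [Field k] (b2 b4 b6 b8 r: k)
    (h8 : 4 * b8 = b2 * b6 - b4 ^ 2)
    (hW : -b2 ^ 2 * b8 - 8 * b4 ^ 3 - 27 * b6 ^ 2 + 9 * b2 * b4 * b6 = 0)
    (hr : 4 * r ^ 3 + b2 * r ^ 2 + 2 * b4 * r + b6 = 0) :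
    ((b2 + 4 * r) ^ 2 - 16 * (2 * b4 + (b2 + 4 * r) * r)) * (6 * r ^ 2 + b2 * r + b4) ^ 2 = 0 := by
  obtain rfl : b6 = -(4 * r ^ 3 + b2 * r ^ 2 + 2 * b4 * r) := by linear_combination hr
  linear_combination 4 * hW + b2 ^ 2 * h8

/-- A Weierstrass curve with vanishing discriminant has a singular affine point. -/
theorem exists_singular_point_of_Δ_eq_zero {k : Type*} [Field k] [IsAlgClosed k]
    (W : WeierstrassCurve k) (hW : W.Δ = 0) :
    ∃ x y : k, y ^ 2 + W.a₁ * x * y + W.a₃ * y = x ^ 3 + W.a₂ * x ^ 2 + W.a₄ * x + W.a₆ ∧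
      W.a₁ * y = 3 * x ^ 2 + 2 * W.a₂ * x + W.a₄ ∧ 2 * y + W.a₁ * x + W.a₃ = 0 := by
  obtain ⟨a1, a2, a3, a4, a6⟩ := W
  simp only [WeierstrassCurve.Δ, WeierstrassCurve.b₂, WeierstrassCurve.b₄, WeierstrassCurve.b₆,
    WeierstrassCurve.b₈] at hW ⊢
  by_cases h2 : (2 : k) = 0
  · by_cases h1 : a1 = 0
    · subst h1
      -- In characteristic 2 with a₁ = 0 one has Δ = a₃⁴. The partial derivative in x then only
      -- requires x² = -a₄, and y is found by a square root.
      have h3 : a3 = 0 := by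
        have : a3 ^ 4 = 0 := by
          grind
        exact pow_eq_zero_iff (by norm_num) |>.mp this
      obtain ⟨x, hx⟩ := exists_sq_eq (-a4)
      obtain ⟨y, hy⟩ := exists_sq_eq (x ^ 3 + a2 * x ^ 2 + a4 * x + a6)
      refine ⟨x, y, ?_, ?_, ?_⟩ <;> grind
    -- In characteristic 2 the derivative in y determines x = -a₃/a₁ and the derivative in x
    -- determines y; the equation of the curve then follows from Δ = 0.
    · refine ⟨-a3 / a1, (3 * (-a3 / a1) ^ 2 + 2 * a2 * (-a3 / a1) + a4) / a1, ?_, ?_, ?_⟩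
      · field_simp
        grind
      · field_simp
      · field_simp
        grind
  · obtain ⟨r, hr⟩ := exists_cubic_root (a := (4 : k))
      (by rw [show (4 : k) = 2 * 2 by norm_num]; exact mul_ne_zero h2 h2)
      (a1 ^ 2 + 4 * a2) (2 * (2 * a4 + a1 * a3)) (a3 ^ 2 + 4 * a6)
    have key := weierstrass_Δ_eq_zero_root _ _ _ _ r (by ring) hW hr
    rcases mul_eq_zero.mp key with h | h
    · have h8 : (8 : k) ≠ 0 := by
        rw [show (8 : k) = 2 ^ 3 by norm_num]
        exact pow_ne_zero _ h2
      -- The double root of the quadratic factor. In the other case r itself is a double root.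
      obtain ⟨x, hx⟩ : ∃ x : k, 8 * x = -(a1 ^ 2 + 4 * a2 + 4 * r) := ⟨_, mul_div_cancel₀ _ h8⟩
      refine ⟨x, weierstrass_double_root h2 a1 a2 a3 a4 a6 x ?_ ?_⟩
      · refine (mul_eq_zero.mp (?_ : (16 : k) * _ = 0)).resolve_left ?_
        · linear_combination
            16 * hr + (x - r) * (8 * x + (a1 ^ 2 + 4 * a2 + 4 * r)) * hx - (x - r) * h
        · rw [show (16 : k) = 2 ^ 4 by norm_num]
          exact pow_ne_zero _ h2
      · refine (mul_eq_zero.mp (?_ : (32 : k) * _ = 0)).resolve_left ?_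
        · linear_combination (8 * x + (a1 ^ 2 + 4 * a2 + 4 * r) + 16 * (x - r)) * hx - h
        · rw [show (32 : k) = 2 ^ 5 by norm_num]
          exact pow_ne_zero _ h2
    · exact ⟨r, weierstrass_double_root h2 a1 a2 a3 a4 a6 r hr
        (pow_eq_zero_iff two_ne_zero |>.mp h)⟩

end Weierstrass

/-! ### Models of degree 2 -/

section DegreeTwo

variable {R : Type*} [CommRing R]

/-- The Jacobian of a model of degree 2. -/
def jac2 (φ : Idx2 → R) : WeierstrassCurve R where
  a₁ := φ 1
  a₂ := φ 5 - φ 0 * φ 2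
  a₃ := φ 4 * φ 2 + φ 6 * φ 0
  a₄ := -φ 3 * φ 2 ^ 2 - φ 5 * φ 0 * φ 2 - φ 7 * φ 0 ^ 2 - 4 * φ 3 * φ 7 + φ 4 * φ 6
  a₆ := -φ 3 * φ 5 * φ 2 ^ 2 + φ 3 * φ 6 * φ 1 * φ 2 - φ 3 * φ 7 * φ 1 ^ 2 - φ 4 * φ 6 * φ 0 * φ 2
    + φ 4 * φ 7 * φ 0 * φ 1 - φ 5 * φ 7 * φ 0 ^ 2 - 4 * φ 3 * φ 5 * φ 7 + φ 3 * φ 6 ^ 2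
    + φ 4 ^ 2 * φ 7

theorem jac2_map {S : Type*} [CommRing S] (f : R →+* S) (φ : Idx2 → R) :
    (jac2 φ).map f = jac2 fun s => f (φ s) := by
  simp [jac2, WeierstrassCurve.map, map_ofNat f]

/-- The exchange of `x` and `z`. -/
def swap2 (φ : Idx2 → R) : Idx2 → R := ![φ 2, φ 1, φ 0, φ 7, φ 6, φ 5, φ 4, φ 3]

/-- The substitution `x ↦ x + t z`. -/
def shear2 (t : R) (φ : Idx2 → R) : Idx2 → R :=
  ![φ 0, φ 1 + 2 * t * φ 0, φ 2 + t * φ 1 + t ^ 2 * φ 0,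
    φ 3, φ 4 + 4 * t * φ 3, φ 5 + 3 * t * φ 4 + 6 * t ^ 2 * φ 3,
    φ 6 + 2 * t * φ 5 + 3 * t ^ 2 * φ 4 + 4 * t ^ 3 * φ 3,
    φ 7 + t * φ 6 + t ^ 2 * φ 5 + t ^ 3 * φ 4 + t ^ 4 * φ 3]

/-- The substitution `y ↦ y + r₀ x² + r₁ x z + r₂ z²`. -/
def shift2 (r₀ r₁ r₂ : R) (φ : Idx2 → R) : Idx2 → R :=
  ![φ 0 + 2 * r₀, φ 1 + 2 * r₁, φ 2 + 2 * r₂,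
    φ 3 - r₀ * φ 0 - r₀ ^ 2, φ 4 - r₀ * φ 1 - r₁ * φ 0 - 2 * r₀ * r₁,
    φ 5 - r₀ * φ 2 - r₁ * φ 1 - r₂ * φ 0 - r₁ ^ 2 - 2 * r₀ * r₂,
    φ 6 - r₁ * φ 2 - r₂ * φ 1 - 2 * r₁ * r₂, φ 7 - r₂ * φ 2 - r₂ ^ 2]

/-- The coefficients of `jac2` are symmetric under the exchange of x and z, so even the Weierstrass
equation is unchanged. -/
theorem jac2_swap2_Δ (φ : Idx2 → R) : (jac2 (swap2 φ)).Δ = (jac2 φ).Δ := by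
  congr 1
  ext <;> simp [jac2, swap2] <;> ring

/-- The Jacobian changes by a substitution x ↦ x + r, y ↦ y + sx + t' without scaling, which
preserves Δ. The same holds for `shift2`. -/
theorem jac2_shear2_Δ (t : R) (φ : Idx2 → R) : (jac2 (shear2 t φ)).Δ = (jac2 φ).Δ := by
  refine weierstrass_Δ_eq_of_variableChange (2 * φ 3 * t ^ 2 + φ 4 * t) (φ 0 * t)
    (4 * φ 3 * φ 0 * t ^ 3 + φ 3 * φ 1 * t ^ 2 + 2 * φ 4 * φ 0 * t ^ 2 + 2 * φ 3 * φ 2 * t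
      + φ 5 * φ 0 * t) ?_
  ext <;> simp [jac2, shear2, WeierstrassCurve.variableChange_def] <;> ring

theorem jac2_shift2_Δ (r₀ r₁ r₂ : R) (φ : Idx2 → R) :
    (jac2 (shift2 r₀ r₁ r₂ φ)).Δ = (jac2 φ).Δ := by
  refine weierstrass_Δ_eq_of_variableChange (-φ 0 * r₂ - φ 2 * r₀ - 2 * r₀ * r₂) r₁
    (-φ 0 * φ 2 * r₁ - 2 * φ 0 * r₁ * r₂ - φ 1 * r₀ * r₂ - 2 * φ 2 * r₀ * r₁ - 4 * r₀ * r₁ * r₂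
      + φ 4 * r₂ + φ 6 * r₀) ?_
  ext <;> simp [jac2, shift2, WeierstrassCurve.variableChange_def] <;> ring

theorem swap2_map {S : Type*} [CommRing S] (f : R →+* S) (φ : Idx2 → R) :
    (fun s => f (swap2 φ s)) = swap2 fun s => f (φ s) := by
  funext s
  fin_cases s <;> simp [swap2]

theorem shear2_map {S : Type*} [CommRing S] (f : R →+* S) (t : R) (φ : Idx2 → R) :
    (fun s => f (shear2 t φ s)) = shear2 (f t) fun s => f (φ s) := by
  funext s
  fin_cases s <;> simp [shear2, map_ofNat f]

theorem shift2_map {S : Type*} [CommRing S] (f : R →+* S) (r₀ r₁ r₂ : R) (φ : Idx2 → R) :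
    (fun s => f (shift2 r₀ r₁ r₂ φ s)) = shift2 (f r₀) (f r₁) (f r₂) fun s => f (φ s) := by
  funext s
  fin_cases s <;> simp [shift2, map_ofNat f]

theorem swap2_swap2 {α : Type*} (φ : Idx2 → α) : swap2 (swap2 φ) = φ := by
  funext s
  fin_cases s <;> simp [swap2]

theorem shear2_neg (t : R) (φ : Idx2 → R) : shear2 t (shear2 (-t) φ) = φ := by
  funext s
  fin_cases s <;> simp [shear2] <;> ring

theorem shift2_neg (r₀ r₁ r₂ : R) (φ : Idx2 → R) :
    shift2 r₀ r₁ r₂ (shift2 (-r₀) (-r₁) (-r₂) φ) = φ := by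
  funext s
  fin_cases s <;> simp [shift2] <;> ring

/-- The point `(x : z : y)` lies on the curve and all partial derivatives vanish there. -/
def SingAt2 (φ : Idx2 → R) (x z y : R) : Prop :=
  y ^ 2 + (φ 0 * x ^ 2 + φ 1 * x * z + φ 2 * z ^ 2) * y =
      φ 3 * x ^ 4 + φ 4 * x ^ 3 * z + φ 5 * x ^ 2 * z ^ 2 + φ 6 * x * z ^ 3 + φ 7 * z ^ 4 ∧
    (2 * φ 0 * x + φ 1 * z) * y =
      4 * φ 3 * x ^ 3 + 3 * φ 4 * x ^ 2 * z + 2 * φ 5 * x * z ^ 2 + φ 6 * z ^ 3 ∧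
    (φ 1 * x + 2 * φ 2 * z) * y =
      φ 4 * x ^ 3 + 2 * φ 5 * x ^ 2 * z + 3 * φ 6 * x * z ^ 2 + 4 * φ 7 * z ^ 3 ∧
    2 * y + (φ 0 * x ^ 2 + φ 1 * x * z + φ 2 * z ^ 2) = 0

theorem sing2_iff {k : Type u} [Field k] (φ : Idx2 → k) :
    Sing2 k φ ↔ ∃ x z y, (x ≠ 0 ∨ z ≠ 0) ∧ SingAt2 φ x z y := by
  have key : ∀ P : Fin 3 → k, (eval P (eqn2 φ) = 0 ∧ ∀ i, eval P (pderiv i (eqn2 φ)) = 0) ↔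
      SingAt2 φ (P 0) (P 1) (P 2) := by
    intro P
    have h0 : eval P (eqn2 φ) = 0 ↔
        P 2 ^ 2 + (φ 0 * P 0 ^ 2 + φ 1 * P 0 * P 1 + φ 2 * P 1 ^ 2) * P 2 =
        φ 3 * P 0 ^ 4 + φ 4 * P 0 ^ 3 * P 1 + φ 5 * P 0 ^ 2 * P 1 ^ 2 + φ 6 * P 0 * P 1 ^ 3
          + φ 7 * P 1 ^ 4 := by
      simp [eqn2, sub_eq_zero]
    have h1 : eval P (pderiv 0 (eqn2 φ)) = 0 ↔ (2 * φ 0 * P 0 + φ 1 * P 1) * P 2 =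
      4 * φ 3 * P 0 ^ 3 + 3 * φ 4 * P 0 ^ 2 * P 1 + 2 * φ 5 * P 0 * P 1 ^ 2 + φ 6 * P 1 ^ 3 := by
      rw [← sub_eq_zero (a := _ * P 2)]
      refine Eq.congr_left ?_
      simp [eqn2, pderiv_X]
      ring
    have h2 : eval P (pderiv 1 (eqn2 φ)) = 0 ↔ (φ 1 * P 0 + 2 * φ 2 * P 1) * P 2 =
      φ 4 * P 0 ^ 3 + 2 * φ 5 * P 0 ^ 2 * P 1 + 3 * φ 6 * P 0 * P 1 ^ 2 + 4 * φ 7 * P 1 ^ 3 := by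
      rw [← sub_eq_zero (a := _ * P 2)]
      refine Eq.congr_left ?_
      simp [eqn2, pderiv_X]
      ring
    have h3 : eval P (pderiv 2 (eqn2 φ)) = 0 ↔
        2 * P 2 + (φ 0 * P 0 ^ 2 + φ 1 * P 0 * P 1 + φ 2 * P 1 ^ 2) = 0 := by
      refine Eq.congr_left ?_
      simp [eqn2, pderiv_X]
    simp only [Fin.forall_fin_succ, Fin.forall_fin_zero, SingAt2, h0]
    simp [h1, h2, h3]
  constructor
  · rintro ⟨P, hP, h⟩
    exact ⟨P 0, P 1, P 2, hP, (key P).mp h⟩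
  · rintro ⟨x, z, y, hP, h⟩
    exact ⟨![x, z, y], by simpa using hP, (key _).mpr (by simpa using h)⟩

theorem SingAt2.smul {φ : Idx2 → R} {x z y : R} (h : SingAt2 φ x z y) (c : R) :
    SingAt2 φ (c * x) (c * z) (c ^ 2 * y) := by
  obtain ⟨h0, h1, h2, h3⟩ := h
  refine ⟨?_, ?_, ?_, ?_⟩
  · linear_combination c ^ 4 * h0
  · linear_combination c ^ 3 * h1
  · linear_combination c ^ 3 * h2
  · linear_combination c ^ 2 * h3

theorem singAt2_swap2 {φ : Idx2 → R} {x z y : R} :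
    SingAt2 (swap2 φ) x z y ↔ SingAt2 φ z x y := by
  simp only [SingAt2, swap2]
  simp
  constructor <;> rintro ⟨h0, h1, h2, h3⟩ <;> refine ⟨?_, ?_, ?_, ?_⟩
  · linear_combination h0
  · linear_combination h2
  · linear_combination h1
  · linear_combination h3
  · linear_combination h0
  · linear_combination h2
  · linear_combination h1
  · linear_combination h3

/-- This is the chain rule: the derivative in z of the substituted equation is the old one plus t
times the derivative in x. -/
theorem singAt2_shear2 {φ : Idx2 → R} {t x z y : R} :
    SingAt2 (shear2 t φ) x z y ↔ SingAt2 φ (x + t * z) z y := by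
  simp only [SingAt2, shear2]
  simp
  constructor <;> rintro ⟨h0, h1, h2, h3⟩ <;> refine ⟨?_, ?_, ?_, ?_⟩
  · linear_combination h0
  · linear_combination h1
  · linear_combination h2 - t * h1
  · linear_combination h3
  · linear_combination h0
  · linear_combination h1
  · linear_combination h2 + t * h1
  · linear_combination h3

theorem singAt2_shift2 {φ : Idx2 → R} {r₀ r₁ r₂ x z y : R} :
    SingAt2 (shift2 r₀ r₁ r₂ φ) x z y ↔
      SingAt2 φ x z (y + (r₀ * x ^ 2 + r₁ * x * z + r₂ * z ^ 2)) := by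
  simp only [SingAt2, shift2]
  simp
  constructor <;> rintro ⟨h0, h1, h2, h3⟩ <;> refine ⟨?_, ?_, ?_, ?_⟩
  · linear_combination h0
  · linear_combination h1 - (2 * r₀ * x + r₁ * z) * h3
  · linear_combination h2 - (r₁ * x + 2 * r₂ * z) * h3
  · linear_combination h3
  · linear_combination h0
  · linear_combination h1 + (2 * r₀ * x + r₁ * z) * h3
  · linear_combination h2 + (r₁ * x + 2 * r₂ * z) * h3
  · linear_combination h3

end DegreeTwo


/-! ### The generic singular model and the discriminant in degree 2 -/

section DegreeTwo

variable {R : Type*} [CommRing R]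

/-- The models of degree 2 which are singular at `(0 : 1 : 0)`. -/
def nodal2 (u : Fin 8 → R) : Idx2 → R := ![u 0, u 1, 0, u 2, u 3, u 4, 0, 0]

/-- The generic singular model of degree 2, as a function of its parameters. -/
def singular2 (u : Fin 8 → R) : Idx2 → R :=
  swap2 (shear2 (u 7) (swap2 (shear2 (u 6) (shift2 0 0 (u 5) (nodal2 u)))))

theorem singular2_map {S : Type*} [CommRing S] (f : R →+* S) (u : Fin 8 → R) :
    (fun s => f (singular2 u s)) = singular2 fun i => f (u i) := by
  have h : (fun s => f (nodal2 u s)) = nodal2 fun i => f (u i) := by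
    funext s
    fin_cases s <;> simp [nodal2]
  rw [singular2, singular2, swap2_map, shear2_map, swap2_map, shear2_map, shift2_map, h, map_zero]

/-- All the substitutions preserve Δ, and for `nodal2` the coefficients a₃, a₄, a₆ vanish, so the
Weierstrass curve is singular at the origin. -/
theorem jac2_singular2_Δ (u : Fin 8 → R) : (jac2 (singular2 u)).Δ = 0 := by
  rw [singular2, jac2_swap2_Δ, jac2_shear2_Δ, jac2_swap2_Δ, jac2_shear2_Δ, jac2_shift2_Δ]
  simp [jac2, nodal2, WeierstrassCurve.Δ, WeierstrassCurve.b₂, WeierstrassCurve.b₄,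
    WeierstrassCurve.b₆, WeierstrassCurve.b₈]

/-- Two opposite shears take (0, 1) to (s, 1 + ts), and every nonzero vector is proportional to one
of these. This avoids general invertible matrices, and the shears need no inverted determinant. -/
theorem exists_shears_of_ne_zero {k : Type*} [Field k] {x z : k} (h : x ≠ 0 ∨ z ≠ 0) :
    ∃ s t c : k, s = c * x ∧ 1 + t * s = c * z := by
  by_cases hx : x = 0
  · refine ⟨0, 0, z⁻¹, by simp [hx], ?_⟩
    rw [inv_mul_cancel₀ (h.resolve_left (absurd hx))]
    ring
  · refine ⟨x, (z - 1) / x, 1, by simp, ?_⟩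
    field_simp
    ring

/-- The entries r, s, t are ignored by `nodal2`; they leave room for the parameters of the shift and
the shears in `singular2`. -/
theorem eq_nodal2 {φ : Idx2 → R} (h : SingAt2 φ 0 1 0) (r s t : R) :
    φ = nodal2 ![φ 0, φ 1, φ 3, φ 4, φ 5, r, s, t] := by
  obtain ⟨e0, e1, -, e3⟩ := h
  simp at e0 e1 e3
  funext i
  fin_cases i <;> simp [nodal2, ← e0, ← e1, e3]

theorem exists_eq_singular2 {k : Type*} [Field k] {φ : Idx2 → k} {x z y : k}
    (hxz : x ≠ 0 ∨ z ≠ 0) (h : SingAt2 φ x z y) : ∃ u, φ = singular2 u := by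
  obtain ⟨s, t, c, hs, ht⟩ := exists_shears_of_ne_zero hxz
  obtain ⟨r, hr⟩ : ∃ r, r = c ^ 2 * y := ⟨_, rfl⟩
  -- The model moved so that its singular point becomes (0 : 1 : 0). Undoing the moves with negated
  -- parameters exhibits φ as a value of `singular2`.
  obtain ⟨ψ, hψ⟩ : ∃ ψ, ψ = shift2 0 0 r (shear2 s (swap2 (shear2 t (swap2 φ)))) := ⟨_, rfl⟩
  have hφ : φ = swap2 (shear2 (-t) (swap2 (shear2 (-s) (shift2 0 0 (-r) ψ)))) := by
    have h1 := shift2_neg 0 0 (-r) (shear2 s (swap2 (shear2 t (swap2 φ))))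
    have h2 := shear2_neg (-s) (swap2 (shear2 t (swap2 φ)))
    have h3 := shear2_neg (-t) (swap2 φ)
    rw [neg_neg] at h1 h2 h3
    rw [neg_zero] at h1
    rw [hψ, h1, h2, swap2_swap2, h3, swap2_swap2]
  have hψ0 : SingAt2 ψ 0 1 0 := by
    rw [hψ, singAt2_shift2, singAt2_shear2, singAt2_swap2, singAt2_shear2, singAt2_swap2]
    convert h.smul c using 1
    · rw [← hs]; ring
    · rw [← ht]; ring
    · rw [hr]; ring
  refine ⟨![ψ 0, ψ 1, ψ 3, ψ 4, ψ 5, -r, -s, -t], ?_⟩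
  rw [singular2, ← eq_nodal2 hψ0 (-r) (-s) (-t)]
  exact hφ

/-- The vanishing coefficients put a branch point at z = 0. If also φ₄ = 0 it is singular; otherwise
the affine equation, with x and y scaled by φ₄, is precisely `jac2 φ`. -/
theorem exists_singAt2_of_monic {k : Type*} [Field k] [IsAlgClosed k] {φ : Idx2 → k}
    (hφ : (jac2 φ).Δ = 0) (h0 : φ 0 = 0) (h3 : φ 3 = 0) :
    ∃ x z y, (x ≠ 0 ∨ z ≠ 0) ∧ SingAt2 φ x z y := by
  by_cases h4 : φ 4 = 0
  · exact ⟨1, 0, 0, by simp, by simp [SingAt2, h0, h3, h4]⟩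
  · obtain ⟨x, y, e0, e1, e2⟩ := exists_singular_point_of_Δ_eq_zero _ hφ
    simp only [jac2, h0, h3] at e0 e1 e2
    obtain ⟨x, rfl⟩ : ∃ x', x = φ 4 * x' := ⟨x / φ 4, (mul_div_cancel₀ _ h4).symm⟩
    obtain ⟨y, rfl⟩ : ∃ y', y = φ 4 * y' := ⟨y / φ 4, (mul_div_cancel₀ _ h4).symm⟩
    have hE : y ^ 2 + (φ 1 * x + φ 2) * y = φ 4 * x ^ 3 + φ 5 * x ^ 2 + φ 6 * x + φ 7 := by
      refine mul_left_cancel₀ (pow_ne_zero 2 h4) ?_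
      linear_combination e0
    have hx : φ 1 * y = 3 * φ 4 * x ^ 2 + 2 * φ 5 * x + φ 6 := by
      refine mul_left_cancel₀ h4 ?_
      linear_combination e1
    have hy : 2 * y + (φ 1 * x + φ 2) = 0 := by
      refine (mul_eq_zero.mp (?_ : φ 4 * _ = 0)).resolve_left h4
      linear_combination e2
    refine ⟨x, 1, y, by simp, ?_, ?_, ?_, ?_⟩
    · simp only [h0, h3]
      linear_combination hE
    · simp only [h0, h3]
      linear_combination hx
    -- The derivative in z comes from Euler's relation with weights 1, 1, 2: 4F = xF_x + zF_z +
    -- 2yF_y.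
    · linear_combination 4 * hE - x * hx - 2 * y * hy
    · simp only [h0]
      linear_combination hy

/-- The hypothesis says that Y² + φ₀Y - φ₃ has a double root, in any characteristic. Shifting y by
this root times x² kills both φ₀ and φ₃. -/
theorem exists_singAt2_of_branch {k : Type*} [Field k] [IsAlgClosed k] {φ : Idx2 → k}
    (hφ : (jac2 φ).Δ = 0) (h : φ 0 ^ 2 + 4 * φ 3 = 0) :
    ∃ x z y, (x ≠ 0 ∨ z ≠ 0) ∧ SingAt2 φ x z y := by
  obtain ⟨r, hr⟩ := exists_quadratic_root (one_ne_zero (α := k)) (φ 0) (-φ 3)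
  have hr2 : φ 0 + 2 * r = 0 := by
    refine pow_eq_zero_iff two_ne_zero |>.mp ?_
    linear_combination h + 4 * hr
  obtain ⟨x, z, y, hxz, hs⟩ := exists_singAt2_of_monic (φ := shift2 r 0 0 φ)
    (by rwa [jac2_shift2_Δ]) (by simpa [shift2] using hr2)
    (by simp only [shift2, Matrix.cons_val]; linear_combination -hr)
  exact ⟨x, z, _, hxz, singAt2_shift2.mp hs⟩

theorem exists_singAt2 {k : Type*} [Field k] [IsAlgClosed k] {φ : Idx2 → k}
    (hφ : (jac2 φ).Δ = 0) : ∃ x z y, (x ≠ 0 ∨ z ≠ 0) ∧ SingAt2 φ x z y := by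
  by_cases h : φ 0 ^ 2 + 4 * φ 3 = 0
  · exact exists_singAt2_of_branch hφ h
  -- A root of p² + 4q at z = 1. The shear followed by the exchange moves this branch point to (1 :
  -- 0).
  · obtain ⟨s, hs⟩ := exists_quartic_root h (2 * φ 0 * φ 1 + 4 * φ 4)
      (φ 1 ^ 2 + 2 * φ 0 * φ 2 + 4 * φ 5) (2 * φ 1 * φ 2 + 4 * φ 6) (φ 2 ^ 2 + 4 * φ 7)
    obtain ⟨x, z, y, hxz, hs⟩ := exists_singAt2_of_branch (φ := swap2 (shear2 s φ))
      (by rwa [jac2_swap2_Δ, jac2_shear2_Δ])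
      (by simp only [swap2, shear2, Matrix.cons_val]; linear_combination hs)
    rw [singAt2_swap2, singAt2_shear2] at hs
    refine ⟨_, _, _, ?_, hs⟩
    by_contra! h0
    rcases hxz with h1 | h1
    · exact h1 h0.2
    · have := h0.1
      rw [h0.2] at this
      exact h1 (by simpa using this)

/-- The discriminant of models of degree 2. -/
noncomputable def disc2 : MvPolynomial Idx2 ℤ := (jac2 X).Δ

theorem aeval_disc2 [Algebra ℤ R] (φ : Idx2 → R) : aeval φ disc2 = (jac2 φ).Δ := by
  have h := (jac2 (X : Idx2 → MvPolynomial Idx2 ℤ)).map_Δ (aeval φ : _ →ₐ[ℤ] R).toRingHom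
  rw [jac2_map] at h
  simpa [disc2] using h.symm

/-- A pencil of models of degree 2. -/
noncomputable def pencil2 : Idx2 → Polynomial ℤ := ![0, 1, 0, 0, 1, 0, 0, Polynomial.X]

/-- At z = 1 the pencil is y² + xy = x³ + T, which acquires a node at T = 0. -/
theorem aeval_pencil2 : aeval pencil2 disc2 = Polynomial.X * (-1 - 432 * Polynomial.X) := by
  rw [aeval_disc2]
  simp [jac2, pencil2, WeierstrassCurve.Δ, WeierstrassCurve.b₂, WeierstrassCurve.b₄,
    WeierstrassCurve.b₆, WeierstrassCurve.b₈]
  ring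

theorem isDiscriminant_disc2 : IsDiscriminant.{u} Sing2 disc2 := by
  refine isDiscriminant_of_generic disc2 (singular2 (X : Fin 8 → MvPolynomial (Fin 8) ℤ))
    ((aeval_disc2 _).trans (jac2_singular2_Δ _)) ?_ ?_ pencil2 _ aeval_pencil2 (by simp)
  · intro k _ _ φ h
    obtain ⟨x, z, y, hxz, h⟩ := (sing2_iff φ).mp h
    obtain ⟨u, rfl⟩ := exists_eq_singular2 hxz h
    refine ⟨eval₂Hom (Int.castRingHom k) u, fun s => ?_⟩
    rw [congrFun (singular2_map _ _) s]
    simp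
  · intro k _ _ φ h
    rw [aeval_disc2] at h
    exact (sing2_iff φ).mpr (exists_singAt2 h)

end DegreeTwo

/-! ### Comparison of c₄, c₆ and Δ over a field -/

section Comparison

variable {K : Type*} [Field K] {σ : Type}

theorem C_mul_ofNat_eq_one (n : ℕ) (hn : (n : K) ≠ 0) :
    (C (1 / (n : K)) : MvPolynomial σ K) * n = 1 := by
  rw [← map_natCast (C : K →+* MvPolynomial σ K), ← C_mul, one_div_mul_cancel hn, C_1]

/-- The pull-back of `Δ_W` is determined by the pull-backs of `c₄` and `c₆`. -/
theorem pullbackDiscW_eq (h2 : (2 : K) ≠ 0) (h3 : (3 : K) ≠ 0) (T : Fin 2 → MvPolynomial σ K)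
    (W : WeierstrassCurve (MvPolynomial σ K)) (l : K) (h4 : 2 ^ 6 * 3 * T 0 = C (l ^ 4) * W.c₄)
    (h6 : 2 ^ 9 * 3 ^ 3 * T 1 = C (l ^ 6) * W.c₆) :
    pullbackDiscW K T = C (l ^ 12) * W.Δ := by
  have h : ((1728 : ℕ) : K) ≠ 0 := by
    have : ((1728 : ℕ) : K) = 2 ^ 6 * 3 ^ 3 := by norm_num
    rw [this]
    exact mul_ne_zero (pow_ne_zero _ h2) (pow_ne_zero _ h3)
  have e := C_mul_ofNat_eq_one (σ := σ) 1728 h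
  have h7 : pullbackDiscW K T =
      C (1 / ((1728 : ℕ) : K)) * ((2 ^ 6 * 3 * T 0) ^ 3 - (2 ^ 9 * 3 ^ 3 * T 1) ^ 2) := by
    simp [pullbackDiscW, discW, c4W, c6W, map_ofNat (bind₁ T)]
  rw [h7, h4, h6]
  have hc := W.c_relation
  push_cast at e
  simp only [C_pow]
  linear_combination (-C l ^ 12 * C (1 / ((1728 : ℕ) : K))) * hc + C l ^ 12 * W.Δ * e

theorem map_jac2 (σ' : Idx2 → MvPolynomial σ ℤ) :
    map (Int.castRingHom K) (jac2 σ').Δ = (jac2 fun s => map (Int.castRingHom K) (σ' s)).Δ := by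
  rw [← jac2_map, WeierstrassCurve.map_Δ]

end Comparison

section Comparison

variable {A : Type*} [CommRing A]

theorem quartic_coeff (a b c d e : A) (h : Polynomial A)
    (hh : h = Polynomial.C a * Polynomial.X ^ 4 + Polynomial.C b * Polynomial.X ^ 3
      + Polynomial.C c * Polynomial.X ^ 2 + Polynomial.C d * Polynomial.X + Polynomial.C e) :
    h.coeff 4 = a ∧ h.coeff 3 = b ∧ h.coeff 2 = c ∧ h.coeff 1 = d ∧ h.coeff 0 = e := by
  subst hh
  simp [Polynomial.coeff_X, Polynomial.coeff_C]

variable {K : Type*} [Field K] [Algebra K A]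

/-- The invariants c₄ and c₆ of `jac2` depend only on the quartic p² + 4q, as forms of degree 2 and
3 in its coefficients. The hypotheses say that this quartic is 4l²h; l will be 1 in degree 2 and 2
in degree 4. -/
theorem jac2_c₄_c₆ (φ : Idx2 → A) (h2 : (2 : K) ≠ 0) (h3 : (3 : K) ≠ 0) (h : Polynomial A) (l : A)
    (e4 : 4 * l ^ 2 * h.coeff 4 = 4 * φ 3 + φ 0 ^ 2)
    (e3 : 4 * l ^ 2 * h.coeff 3 = 4 * φ 4 + 2 * φ 0 * φ 1)
    (e2 : 4 * l ^ 2 * h.coeff 2 = 4 * φ 5 + φ 1 ^ 2 + 2 * φ 0 * φ 2)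
    (e1 : 4 * l ^ 2 * h.coeff 1 = 4 * φ 6 + 2 * φ 1 * φ 2)
    (e0 : 4 * l ^ 2 * h.coeff 0 = 4 * φ 7 + φ 2 ^ 2) :
    l ^ 4 * (2 ^ 6 * 3 * quarticI K h) = (jac2 φ).c₄ ∧
      l ^ 6 * (2 ^ 9 * 3 ^ 3 * quarticJ K h) = (jac2 φ).c₆ := by
  have h12 : (algebraMap K A (1 / 12)) * 12 = 1 := by
    rw [← map_ofNat (algebraMap K A) 12, ← map_mul, one_div_mul_cancel, map_one]
    rw [show (12 : K) = 2 ^ 2 * 3 by norm_num]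
    exact mul_ne_zero (pow_ne_zero _ h2) h3
  have h432 : (algebraMap K A (1 / 432)) * 432 = 1 := by
    rw [← map_ofNat (algebraMap K A) 432, ← map_mul, one_div_mul_cancel, map_one]
    rw [show (432 : K) = 2 ^ 4 * 3 ^ 3 by norm_num]
    exact mul_ne_zero (pow_ne_zero _ h2) (pow_ne_zero _ h3)
  have hI : 2 ^ 6 * 3 * quarticI K h =
      16 * (12 * h.coeff 4 * h.coeff 0 - 3 * h.coeff 3 * h.coeff 1 + h.coeff 2 ^ 2) := by
    rw [quarticI, Algebra.smul_def]
    linear_combination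
      16 * (12 * h.coeff 4 * h.coeff 0 - 3 * h.coeff 3 * h.coeff 1 + h.coeff 2 ^ 2) * h12
  have hJ : 2 ^ 9 * 3 ^ 3 * quarticJ K h =
      32 * (72 * h.coeff 4 * h.coeff 2 * h.coeff 0 - 27 * h.coeff 4 * h.coeff 1 ^ 2
        - 27 * h.coeff 3 ^ 2 * h.coeff 0 + 9 * h.coeff 3 * h.coeff 2 * h.coeff 1
        - 2 * h.coeff 2 ^ 3) := by
    rw [quarticJ, Algebra.smul_def]
    linear_combination 32 * (72 * h.coeff 4 * h.coeff 2 * h.coeff 0 - 27 * h.coeff 4 * h.coeff 1 ^ 2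
        - 27 * h.coeff 3 ^ 2 * h.coeff 0 + 9 * h.coeff 3 * h.coeff 2 * h.coeff 1
        - 2 * h.coeff 2 ^ 3) * h432
  rw [hI, hJ]
  constructor
  · calc _ = 12 * (4 * l ^ 2 * h.coeff 4) * (4 * l ^ 2 * h.coeff 0)
          - 3 * (4 * l ^ 2 * h.coeff 3) * (4 * l ^ 2 * h.coeff 1)
          + (4 * l ^ 2 * h.coeff 2) ^ 2 := by
          ring
      _ = _ := by
        rw [e0, e1, e2, e3, e4]
        simp only [jac2, WeierstrassCurve.c₄, WeierstrassCurve.b₂, WeierstrassCurve.b₄]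
        ring
  · have h2A : (algebraMap K A (1 / 2)) * 2 = 1 := by
      rw [← map_ofNat (algebraMap K A) 2, ← map_mul, one_div_mul_cancel h2, map_one]
    -- The factor 2 supplies 64l⁶ = (4l²)³, so that everything is expressed through the coefficients
    -- of 4l²h; it is cancelled afterwards.
    have key : 2 * (l ^ 6 * (32 * (72 * h.coeff 4 * h.coeff 2 * h.coeff 0
        - 27 * h.coeff 4 * h.coeff 1 ^ 2 - 27 * h.coeff 3 ^ 2 * h.coeff 0
        + 9 * h.coeff 3 * h.coeff 2 * h.coeff 1 - 2 * h.coeff 2 ^ 3))) = 2 * (jac2 φ).c₆ := by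
      calc _ = 72 * (4 * l ^ 2 * h.coeff 4) * (4 * l ^ 2 * h.coeff 2) * (4 * l ^ 2 * h.coeff 0)
            - 27 * (4 * l ^ 2 * h.coeff 4) * (4 * l ^ 2 * h.coeff 1) ^ 2
            - 27 * (4 * l ^ 2 * h.coeff 3) ^ 2 * (4 * l ^ 2 * h.coeff 0)
            + 9 * (4 * l ^ 2 * h.coeff 3) * (4 * l ^ 2 * h.coeff 2) * (4 * l ^ 2 * h.coeff 1)
            - 2 * (4 * l ^ 2 * h.coeff 2) ^ 3 := by
            ring
        _ = _ := by
          rw [e0, e1, e2, e3, e4]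
          simp only [jac2, WeierstrassCurve.c₆, WeierstrassCurve.b₂, WeierstrassCurve.b₄,
            WeierstrassCurve.b₆]
          ring
    linear_combination algebraMap K A (1 / 2) * key - (l ^ 6 *
      (32 * (72 * h.coeff 4 * h.coeff 2 * h.coeff 0
        - 27 * h.coeff 4 * h.coeff 1 ^ 2 - 27 * h.coeff 3 ^ 2 * h.coeff 0
        + 9 * h.coeff 3 * h.coeff 2 * h.coeff 1 - 2 * h.coeff 2 ^ 3)) - (jac2 φ).c₆) * h2A

end Comparison

section DegreeTwo

variable {K : Type*} [Field K]

theorem map_disc2 (h2 : (2 : K) ≠ 0) (h3 : (3 : K) ≠ 0) :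
    map (Int.castRingHom K) disc2 = C (2 ^ (0 : ℤ)) * pullbackDiscW K (toW2 K) := by
  have h4 : (C (1 / 4 : K) : MvPolynomial Idx2 K) * 4 = 1 := by
    refine C_mul_ofNat_eq_one 4 ?_
    rw [show ((4 : ℕ) : K) = 2 ^ 2 by norm_num]
    exact pow_ne_zero _ h2
  have hq : genericQuartic2 K = Polynomial.C (X 3 + C (1 / 4) * X 0 ^ 2) * Polynomial.X ^ 4
      + Polynomial.C (X 4 + C (1 / 4) * (2 * X 0 * X 1)) * Polynomial.X ^ 3
      + Polynomial.C (X 5 + C (1 / 4) * (X 1 ^ 2 + 2 * X 0 * X 2)) * Polynomial.X ^ 2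
      + Polynomial.C (X 6 + C (1 / 4) * (2 * X 1 * X 2)) * Polynomial.X
      + Polynomial.C (X 7 + C (1 / 4) * X 2 ^ 2) := by
    have : ∀ P : Polynomial (MvPolynomial Idx2 K),
        (1 / 4 : K) • P = Polynomial.C (C (1 / 4)) * P := by
      intro P
      rw [← Polynomial.smul_eq_C_mul, ← algebraMap_eq, algebraMap_smul]
    simp only [genericQuartic2, this, Polynomial.C_add, Polynomial.C_mul, Polynomial.C_pow]
    rw [show (Polynomial.C 2 : Polynomial (MvPolynomial Idx2 K)) = 2 from map_ofNat _ 2]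
    ring
  obtain ⟨e4, e3, e2, e1, e0⟩ := quartic_coeff _ _ _ _ _ _ hq
  have hc := jac2_c₄_c₆ (A := MvPolynomial Idx2 K) (K := K) X h2 h3 (genericQuartic2 K) 1
    (by rw [e4]; linear_combination X 0 ^ 2 * h4)
    (by rw [e3]; linear_combination 2 * X 0 * X 1 * h4)
    (by rw [e2]; linear_combination (X 1 ^ 2 + 2 * X 0 * X 2) * h4)
    (by rw [e1]; linear_combination 2 * X 1 * X 2 * h4)
    (by rw [e0]; linear_combination X 2 ^ 2 * h4)
  rw [pullbackDiscW_eq h2 h3 (toW2 K) (jac2 X) 1 (by simpa [toW2] using hc.1)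
    (by simpa [toW2] using hc.2), disc2, map_jac2]
  simp

end DegreeTwo

/-! ### Ternary cubics -/

section Cubic

variable {R : Type*} [CommRing R]

/-- The Jacobian of a ternary cubic (Artin, Rodriguez-Villegas, Tate). -/
def jac3 (φ : Idx3 → R) : WeierstrassCurve R where
  a₁ := φ 9
  a₂ := -φ 3 * φ 8 - φ 4 * φ 6 - φ 5 * φ 7
  a₃ := 9 * φ 0 * φ 1 * φ 2 - φ 0 * φ 6 * φ 8 - φ 3 * φ 5 * φ 2 - φ 3 * φ 6 * φ 7
    - φ 4 * φ 1 * φ 7 - φ 4 * φ 5 * φ 8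
  a₄ := -3 * φ 0 * φ 1 * φ 7 * φ 8 - 3 * φ 0 * φ 5 * φ 6 * φ 2 + φ 0 * φ 5 * φ 8 ^ 2
    + φ 0 * φ 6 ^ 2 * φ 7 - 3 * φ 3 * φ 4 * φ 1 * φ 2 + φ 3 * φ 4 * φ 6 * φ 8
    + φ 3 * φ 1 * φ 7 ^ 2 + φ 3 * φ 5 * φ 7 * φ 8 + φ 3 ^ 2 * φ 6 * φ 2 + φ 4 * φ 5 * φ 6 * φ 7
    + φ 4 * φ 5 ^ 2 * φ 2 + φ 4 ^ 2 * φ 1 * φ 8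
  a₆ := 9 * φ 0 * φ 3 * φ 1 * φ 5 * φ 2 ^ 2 + 3 * φ 0 * φ 3 * φ 1 * φ 6 * φ 2 * φ 7
    - 3 * φ 0 * φ 3 * φ 1 * φ 2 * φ 8 * φ 9 + 2 * φ 0 * φ 3 * φ 1 * φ 7 * φ 8 ^ 2
    - φ 0 * φ 3 * φ 5 * φ 6 * φ 2 * φ 8 + φ 0 * φ 3 * φ 6 ^ 2 * φ 2 * φ 9
    - φ 0 * φ 3 * φ 6 ^ 2 * φ 7 * φ 8 + 3 * φ 0 * φ 4 * φ 1 * φ 5 * φ 2 * φ 8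
    - 3 * φ 0 * φ 4 * φ 1 * φ 6 * φ 2 * φ 9 - φ 0 * φ 4 * φ 1 * φ 6 * φ 7 * φ 8
    + φ 0 * φ 4 * φ 1 * φ 8 ^ 2 * φ 9 + 9 * φ 0 * φ 4 * φ 1 ^ 2 * φ 2 * φ 7
    - φ 0 * φ 4 * φ 5 * φ 6 * φ 8 ^ 2 + 2 * φ 0 * φ 4 * φ 5 * φ 6 ^ 2 * φ 2
    - 3 * φ 0 * φ 1 * φ 5 * φ 2 * φ 7 * φ 9 + 2 * φ 0 * φ 1 * φ 5 * φ 7 ^ 2 * φ 8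
    + φ 0 * φ 1 * φ 6 * φ 7 ^ 2 * φ 9 + φ 0 * φ 1 * φ 2 * φ 9 ^ 3
    - φ 0 * φ 1 * φ 7 * φ 8 * φ 9 ^ 2 - φ 0 * φ 1 ^ 2 * φ 7 ^ 3 - φ 0 * φ 5 * φ 6 * φ 2 * φ 9 ^ 2
    + φ 0 * φ 5 * φ 6 * φ 7 * φ 8 * φ 9 - φ 0 * φ 5 * φ 6 ^ 2 * φ 7 ^ 2
    + 2 * φ 0 * φ 5 ^ 2 * φ 6 * φ 2 * φ 7 + φ 0 * φ 5 ^ 2 * φ 2 * φ 8 * φ 9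
    - φ 0 * φ 5 ^ 2 * φ 7 * φ 8 ^ 2 - φ 0 * φ 5 ^ 3 * φ 2 ^ 2
    + 9 * φ 0 ^ 2 * φ 1 * φ 6 * φ 2 * φ 8 - φ 0 ^ 2 * φ 1 * φ 8 ^ 3
    - 27 * φ 0 ^ 2 * φ 1 ^ 2 * φ 2 ^ 2 - φ 0 ^ 2 * φ 6 ^ 3 * φ 2
    - φ 3 * φ 4 * φ 1 * φ 5 * φ 2 * φ 7 - φ 3 * φ 4 * φ 1 * φ 6 * φ 7 ^ 2
    - φ 3 * φ 4 * φ 1 * φ 2 * φ 9 ^ 2 + φ 3 * φ 4 * φ 1 * φ 7 * φ 8 * φ 9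
    + φ 3 * φ 4 * φ 5 * φ 6 * φ 2 * φ 9 - φ 3 * φ 4 * φ 5 * φ 6 * φ 7 * φ 8
    - φ 3 * φ 4 * φ 5 ^ 2 * φ 2 * φ 8 + 2 * φ 3 * φ 4 ^ 2 * φ 1 * φ 6 * φ 2
    - φ 3 * φ 4 ^ 2 * φ 1 * φ 8 ^ 2 + 2 * φ 3 ^ 2 * φ 4 * φ 1 * φ 2 * φ 8
    - φ 3 ^ 2 * φ 4 * φ 6 ^ 2 * φ 2 + φ 3 ^ 2 * φ 1 * φ 2 * φ 7 * φ 9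
    - φ 3 ^ 2 * φ 1 * φ 7 ^ 2 * φ 8 - φ 3 ^ 2 * φ 5 * φ 6 * φ 2 * φ 7 - φ 3 ^ 3 * φ 1 * φ 2 ^ 2
    + φ 4 ^ 2 * φ 1 * φ 5 * φ 2 * φ 9 - φ 4 ^ 2 * φ 1 * φ 5 * φ 7 * φ 8
    - φ 4 ^ 2 * φ 5 ^ 2 * φ 6 * φ 2 - φ 4 ^ 3 * φ 1 ^ 2 * φ 2

theorem jac3_map {S : Type*} [CommRing S] (f : R →+* S) (φ : Idx3 → R) :
    (jac3 φ).map f = jac3 fun s => f (φ s) := by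
  simp [jac3, WeierstrassCurve.map, map_ofNat f]

/-- The exchange of `x` and `y`. -/
def swap3xy (φ : Idx3 → R) : Idx3 → R := ![φ 1, φ 0, φ 2, φ 5, φ 6, φ 3, φ 4, φ 8, φ 7, φ 9]

/-- The exchange of `x` and `z`. -/
def swap3xz (φ : Idx3 → R) : Idx3 → R := ![φ 2, φ 1, φ 0, φ 8, φ 7, φ 6, φ 5, φ 4, φ 3, φ 9]

/-- The substitution `x ↦ x + t z`. -/
def shear3 (t : R) (φ : Idx3 → R) : Idx3 → R :=
  ![φ 0, φ 1, φ 2 + t * φ 7 + t ^ 2 * φ 4 + t ^ 3 * φ 0, φ 3, φ 4 + 3 * t * φ 0, φ 5,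
    φ 6 + t * φ 5, φ 7 + 2 * t * φ 4 + 3 * t ^ 2 * φ 0, φ 8 + t * φ 9 + t ^ 2 * φ 3,
    φ 9 + 2 * t * φ 3]

theorem jac3_swap3xy_Δ (φ : Idx3 → R) : (jac3 (swap3xy φ)).Δ = (jac3 φ).Δ := by
  congr 1
  ext <;> simp only [jac3, swap3xy, Matrix.cons_val] <;> ring

theorem jac3_swap3xz_Δ (φ : Idx3 → R) : (jac3 (swap3xz φ)).Δ = (jac3 φ).Δ := by
  congr 1
  ext <;> simp only [jac3, swap3xz, Matrix.cons_val] <;> ring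

/-- As in degree 2, the Weierstrass equation changes by a substitution without scaling. -/
theorem jac3_shear3_Δ (t : R) (φ : Idx3 → R) : (jac3 (shear3 t φ)).Δ = (jac3 φ).Δ := by
  refine weierstrass_Δ_eq_of_variableChange
    (-2 * φ 0 * φ 5 * t ^ 2 - φ 0 * φ 6 * t - φ 4 * φ 5 * t) (φ 3 * t)
    (-4 * φ 0 * φ 3 * φ 5 * t ^ 3 - 2 * φ 0 * φ 3 * φ 6 * t ^ 2 - φ 0 * φ 5 * φ 9 * t ^ 2
      - 2 * φ 3 * φ 4 * φ 5 * t ^ 2 + 3 * φ 0 * φ 1 * φ 7 * t - 2 * φ 0 * φ 5 * φ 8 * t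
      - φ 3 * φ 4 * φ 6 * t - φ 3 * φ 5 * φ 7 * t - φ 4 ^ 2 * φ 1 * t) ?_
  ext <;> simp [jac3, shear3, WeierstrassCurve.variableChange_def] <;> ring

theorem swap3xy_map {S : Type*} [CommRing S] (f : R →+* S) (φ : Idx3 → R) :
    (fun s => f (swap3xy φ s)) = swap3xy fun s => f (φ s) := by
  funext s
  fin_cases s <;> simp [swap3xy]

theorem swap3xz_map {S : Type*} [CommRing S] (f : R →+* S) (φ : Idx3 → R) :
    (fun s => f (swap3xz φ s)) = swap3xz fun s => f (φ s) := by
  funext s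
  fin_cases s <;> simp [swap3xz]

theorem shear3_map {S : Type*} [CommRing S] (f : R →+* S) (t : R) (φ : Idx3 → R) :
    (fun s => f (shear3 t φ s)) = shear3 (f t) fun s => f (φ s) := by
  funext s
  fin_cases s <;> simp [shear3, map_ofNat f]

theorem swap3xy_swap3xy {α : Type*} (φ : Idx3 → α) : swap3xy (swap3xy φ) = φ := by
  funext s
  fin_cases s <;> simp [swap3xy]

theorem swap3xz_swap3xz {α : Type*} (φ : Idx3 → α) : swap3xz (swap3xz φ) = φ := by
  funext s
  fin_cases s <;> simp [swap3xz]

theorem shear3_neg (t : R) (φ : Idx3 → R) : shear3 t (shear3 (-t) φ) = φ := by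
  funext s
  fin_cases s <;> simp [shear3] <;> ring

/-- The cubic and all its partial derivatives vanish at `(x : y : z)`. -/
def SingAt3 (φ : Idx3 → R) (x y z : R) : Prop :=
  φ 0 * x ^ 3 + φ 1 * y ^ 3 + φ 2 * z ^ 3 + φ 3 * x ^ 2 * y + φ 4 * x ^ 2 * z + φ 5 * x * y ^ 2
      + φ 6 * y ^ 2 * z + φ 7 * x * z ^ 2 + φ 8 * y * z ^ 2 + φ 9 * x * y * z = 0 ∧
    3 * φ 0 * x ^ 2 + 2 * φ 3 * x * y + 2 * φ 4 * x * z + φ 5 * y ^ 2 + φ 7 * z ^ 2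
      + φ 9 * y * z = 0 ∧
    3 * φ 1 * y ^ 2 + φ 3 * x ^ 2 + 2 * φ 5 * x * y + 2 * φ 6 * y * z + φ 8 * z ^ 2
      + φ 9 * x * z = 0 ∧
    3 * φ 2 * z ^ 2 + φ 4 * x ^ 2 + φ 6 * y ^ 2 + 2 * φ 7 * x * z + 2 * φ 8 * y * z
      + φ 9 * x * y = 0

theorem sing3_iff {k : Type u} [Field k] (φ : Idx3 → k) :
    Sing3 k φ ↔ ∃ x y z, (x ≠ 0 ∨ y ≠ 0 ∨ z ≠ 0) ∧ SingAt3 φ x y z := by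
  have key : ∀ P : Fin 3 → k, (eval P (eqn3 φ) = 0 ∧ ∀ i, eval P (pderiv i (eqn3 φ)) = 0) ↔
      SingAt3 φ (P 0) (P 1) (P 2) := by
    intro P
    simp only [Fin.forall_fin_succ, Fin.forall_fin_zero, SingAt3, and_true]
    refine and_congr (Eq.congr_left ?_) (and_congr (Eq.congr_left ?_)
      (and_congr (Eq.congr_left ?_) (Eq.congr_left ?_)))
    · simp [eqn3]
    · simp [eqn3, pderiv_X]
      ring
    · simp [eqn3, pderiv_X]
      ring
    · simp [eqn3, pderiv_X]
      ring
  constructor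
  · rintro ⟨P, hP, h⟩
    refine ⟨P 0, P 1, P 2, ?_, (key P).mp h⟩
    by_contra! h0
    refine hP (funext fun i => ?_)
    fin_cases i <;> simp [h0]
  · rintro ⟨x, y, z, hP, h⟩
    refine ⟨![x, y, z], ?_, (key _).mpr (by simpa using h)⟩
    intro h0
    have h1 := congrFun h0 0
    have h2 := congrFun h0 1
    have h3 := congrFun h0 2
    simp at h1 h2 h3
    simp [h1, h2, h3] at hP

theorem SingAt3.smul {φ : Idx3 → R} {x y z : R} (h : SingAt3 φ x y z) (c : R) :
    SingAt3 φ (c * x) (c * y) (c * z) := by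
  obtain ⟨h0, h1, h2, h3⟩ := h
  refine ⟨?_, ?_, ?_, ?_⟩
  · linear_combination c ^ 3 * h0
  · linear_combination c ^ 2 * h1
  · linear_combination c ^ 2 * h2
  · linear_combination c ^ 2 * h3

theorem singAt3_swap3xy {φ : Idx3 → R} {x y z : R} :
    SingAt3 (swap3xy φ) x y z ↔ SingAt3 φ y x z := by
  simp only [SingAt3, swap3xy, Matrix.cons_val]
  constructor <;> rintro ⟨h0, h1, h2, h3⟩ <;> refine ⟨?_, ?_, ?_, ?_⟩
  · linear_combination h0
  · linear_combination h2
  · linear_combination h1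
  · linear_combination h3
  · linear_combination h0
  · linear_combination h2
  · linear_combination h1
  · linear_combination h3

theorem singAt3_swap3xz {φ : Idx3 → R} {x y z : R} :
    SingAt3 (swap3xz φ) x y z ↔ SingAt3 φ z y x := by
  simp only [SingAt3, swap3xz, Matrix.cons_val]
  constructor <;> rintro ⟨h0, h1, h2, h3⟩ <;> refine ⟨?_, ?_, ?_, ?_⟩
  · linear_combination h0
  · linear_combination h3
  · linear_combination h2
  · linear_combination h1
  · linear_combination h0
  · linear_combination h3
  · linear_combination h2
  · linear_combination h1

theorem singAt3_shear3 {φ : Idx3 → R} {t x y z : R} :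
    SingAt3 (shear3 t φ) x y z ↔ SingAt3 φ (x + t * z) y z := by
  simp only [SingAt3, shear3, Matrix.cons_val]
  constructor <;> rintro ⟨h0, h1, h2, h3⟩ <;> refine ⟨?_, ?_, ?_, ?_⟩
  · linear_combination h0
  · linear_combination h1
  · linear_combination h2
  · linear_combination h3 - t * h1
  · linear_combination h0
  · linear_combination h1
  · linear_combination h2
  · linear_combination h3 + t * h1

/-- The substitution `z ↦ z + t x`. -/
def shear3zx (t : R) (φ : Idx3 → R) : Idx3 → R := swap3xz (shear3 t (swap3xz φ))

/-- The substitution `y ↦ y + t z`. -/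
def shear3yz (t : R) (φ : Idx3 → R) : Idx3 → R := swap3xy (shear3 t (swap3xy φ))

/-- The substitution `z ↦ z + t y`. -/
def shear3zy (t : R) (φ : Idx3 → R) : Idx3 → R := swap3xy (shear3zx t (swap3xy φ))

theorem shear3zx_neg (t : R) (φ : Idx3 → R) : shear3zx t (shear3zx (-t) φ) = φ := by
  rw [shear3zx, shear3zx, swap3xz_swap3xz, shear3_neg, swap3xz_swap3xz]

theorem shear3yz_neg (t : R) (φ : Idx3 → R) : shear3yz t (shear3yz (-t) φ) = φ := by
  rw [shear3yz, shear3yz, swap3xy_swap3xy, shear3_neg, swap3xy_swap3xy]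

theorem shear3zy_neg (t : R) (φ : Idx3 → R) : shear3zy t (shear3zy (-t) φ) = φ := by
  rw [shear3zy, shear3zy, swap3xy_swap3xy, shear3zx_neg, swap3xy_swap3xy]

/-- The cubics which are singular at `(0 : 0 : 1)`. -/
def nodal3 (u : Fin 11 → R) : Idx3 → R := ![u 0, u 1, 0, u 2, u 3, u 4, u 5, 0, 0, u 6]

/-- The generic singular cubic, as a function of its parameters. -/
def singular3 (u : Fin 11 → R) : Idx3 → R :=
  shear3zx (u 7) (shear3zy (u 8) (shear3 (u 9) (shear3yz (u 10) (nodal3 u))))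

theorem singular3_map {S : Type*} [CommRing S] (f : R →+* S) (u : Fin 11 → R) :
    (fun s => f (singular3 u s)) = singular3 fun i => f (u i) := by
  have h : (fun s => f (nodal3 u s)) = nodal3 fun i => f (u i) := by
    funext s
    fin_cases s <;> simp [nodal3]
  simp only [singular3, shear3zx, shear3zy, shear3yz, swap3xy_map, swap3xz_map, shear3_map, h]

/-- Every term of a₃, a₄, a₆ contains the coefficient of z³, xz² or yz², and all three vanish for a
cubic singular at (0 : 0 : 1). -/
theorem jac3_singular3_Δ (u : Fin 11 → R) : (jac3 (singular3 u)).Δ = 0 := by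
  simp only [singular3, shear3zx, shear3zy, shear3yz, jac3_swap3xy_Δ, jac3_swap3xz_Δ,
    jac3_shear3_Δ]
  simp [jac3, nodal3, WeierstrassCurve.Δ, WeierstrassCurve.b₂, WeierstrassCurve.b₄,
    WeierstrassCurve.b₆, WeierstrassCurve.b₈]

/-- Four shears suffice to move (0 : 0 : 1) to any point of the plane. -/
theorem exists_shears3_of_ne_zero {k : Type*} [Field k] {x y z : k}
    (h : x ≠ 0 ∨ y ≠ 0 ∨ z ≠ 0) :
    ∃ s s' t t' c : k, s = c * x ∧ s' = c * y ∧ 1 + t' * s' + t * s = c * z := by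
  by_cases hy : y = 0
  · obtain ⟨s, t, c, h1, h2⟩ := exists_shears_of_ne_zero (x := x) (z := z)
      (h.imp_right fun h => h.resolve_left (absurd hy))
    exact ⟨s, 0, t, 0, c, h1, by simp [hy], by simpa using h2⟩
  · refine ⟨x, y, 0, (z - 1) / y, 1, by simp, by simp, ?_⟩
    field_simp
    ring

theorem eq_nodal3 {φ : Idx3 → R} (h : SingAt3 φ 0 0 1) (t t' s s' : R) :
    φ = nodal3 ![φ 0, φ 1, φ 3, φ 4, φ 5, φ 6, φ 9, t, t', s, s'] := by
  obtain ⟨e0, e1, e2, -⟩ := h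
  simp at e0 e1 e2
  funext i
  fin_cases i <;> simp [nodal3, e0, e1, e2]

theorem exists_eq_singular3 {k : Type*} [Field k] {φ : Idx3 → k} {x y z : k}
    (hP : x ≠ 0 ∨ y ≠ 0 ∨ z ≠ 0) (h : SingAt3 φ x y z) : ∃ u, φ = singular3 u := by
  obtain ⟨s, s', t, t', c, hs, hs', ht⟩ := exists_shears3_of_ne_zero hP
  obtain ⟨ψ, hψ⟩ : ∃ ψ, ψ = shear3yz s' (shear3 s (shear3zy t' (shear3zx t φ))) := ⟨_, rfl⟩
  have hφ : φ = shear3zx (-t) (shear3zy (-t') (shear3 (-s) (shear3yz (-s') ψ))) := by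
    have h1 := shear3yz_neg (-s') (shear3 s (shear3zy t' (shear3zx t φ)))
    have h2 := shear3_neg (-s) (shear3zy t' (shear3zx t φ))
    have h3 := shear3zy_neg (-t') (shear3zx t φ)
    have h4 := shear3zx_neg (-t) φ
    rw [neg_neg] at h1 h2 h3 h4
    rw [hψ, h1, h2, h3, h4]
  have hψ0 : SingAt3 ψ 0 0 1 := by
    rw [hψ]
    simp only [shear3yz, shear3zy, shear3zx, singAt3_swap3xy, singAt3_swap3xz, singAt3_shear3]
    convert h.smul c using 1
    · rw [← hs]; ring
    · rw [← hs']; ring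
    · rw [← ht]; ring
  refine ⟨![ψ 0, ψ 1, ψ 3, ψ 4, ψ 5, ψ 6, ψ 9, -t, -t', -s, -s'], ?_⟩
  rw [singular3, ← eq_nodal3 hψ0 (-t) (-t') (-s) (-s')]
  exact hφ

/-- The double cover of the line given by projection of a cubic through `(0 : 0 : 1)` from that
point. -/
def project3 (φ : Idx3 → R) : Idx2 → R :=
  ![φ 4, φ 9, φ 6, -(φ 7 * φ 0), -(φ 7 * φ 3 + φ 8 * φ 0), -(φ 7 * φ 5 + φ 8 * φ 3),
    -(φ 7 * φ 1 + φ 8 * φ 5), -(φ 8 * φ 1)]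

/-- Write the cubic as Lz² + Qz + C with forms L, Q, C in x, y. Multiplying by L and putting w = Lz
gives w² + Qw = -LC, which is `project3`; its Jacobian has the very coefficients of `jac3`. -/
theorem jac2_project3 {φ : Idx3 → R} (h : φ 2 = 0) : jac2 (project3 φ) = jac3 φ := by
  ext <;> simp only [jac2, jac3, project3, Matrix.cons_val, h] <;> ring

theorem exists_singAt3_of_mem {k : Type*} [Field k] [IsAlgClosed k] {φ : Idx3 → k}
    (hφ : (jac3 φ).Δ = 0) (h2 : φ 2 = 0) :
    ∃ x y z, (x ≠ 0 ∨ y ≠ 0 ∨ z ≠ 0) ∧ SingAt3 φ x y z := by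
  by_cases h78 : φ 7 = 0 ∧ φ 8 = 0
  · exact ⟨0, 0, 1, by simp, by simp [SingAt3, h2, h78]⟩
  rw [← jac2_project3 h2] at hφ
  obtain ⟨x, y, w, hxy, h⟩ := exists_singAt2 hφ
  simp only [SingAt2, project3, Matrix.cons_val] at h
  obtain ⟨e0, e1, e2, e3⟩ := h
  -- Where L = 0 at the singular point of the cover, w = Q = 0, and the derivatives of LC force C =
  -- 0. So the line joining (0 : 0 : 1) to (x : y : 0) lies on the cubic, and a singular point is
  -- sought on it. Where L ≠ 0, the point lifts by z = w/L.
  by_cases hL : φ 7 * x + φ 8 * y = 0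
  · have hw : w = 0 := by
      refine pow_eq_zero_iff two_ne_zero |>.mp ?_
      linear_combination
        -e0 + w * e3 + (φ 0 * x ^ 3 + φ 3 * x ^ 2 * y + φ 5 * x * y ^ 2 + φ 1 * y ^ 3) * hL
    subst hw
    have hC : φ 0 * x ^ 3 + φ 3 * x ^ 2 * y + φ 5 * x * y ^ 2 + φ 1 * y ^ 3 = 0 := by
      by_cases h7 : φ 7 = 0
      · refine (mul_eq_zero.mp (?_ : φ 8 * _ = 0)).resolve_left fun h8 => h78 ⟨h7, h8⟩
        linear_combination e2 - (φ 3 * x ^ 2 + 2 * φ 5 * x * y + 3 * φ 1 * y ^ 2) * hL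
      · refine (mul_eq_zero.mp (?_ : φ 7 * _ = 0)).resolve_left h7
        linear_combination e1 - (3 * φ 0 * x ^ 2 + 2 * φ 3 * x * y + φ 5 * y ^ 2) * hL
    by_cases hx : x = 0
    · subst hx
      have hy : y ≠ 0 := hxy.resolve_left (absurd rfl)
      have h8 : φ 8 = 0 := by simpa [hy] using hL
      have h7 : φ 7 ≠ 0 := fun h7 => h78 ⟨h7, h8⟩
      have h1 : φ 1 = 0 := by simpa [hy] using hC
      have h6 : φ 6 = 0 := by simpa [hy] using e3
      obtain ⟨z, hz⟩ := exists_quadratic_root h7 (φ 9 * y) (φ 5 * y ^ 2)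
      refine ⟨0, y, z, by simp [hy], ?_, ?_, ?_, ?_⟩
      · linear_combination y ^ 3 * h1 + z ^ 3 * h2 + y ^ 2 * z * h6 + y * z ^ 2 * h8
      · linear_combination hz
      · linear_combination 3 * y ^ 2 * h1 + 2 * y * z * h6 + z ^ 2 * h8
      · linear_combination 3 * z ^ 2 * h2 + y ^ 2 * h6 + 2 * y * z * h8
    · have h8 : φ 8 ≠ 0 := by
        intro h8
        exact h78 ⟨by simpa [hx, h8] using hL, h8⟩
      obtain ⟨z, hz⟩ := exists_quadratic_root h8 (φ 9 * x + 2 * φ 6 * y)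
        (φ 3 * x ^ 2 + 2 * φ 5 * x * y + 3 * φ 1 * y ^ 2)
      refine ⟨x, y, z, by simp [hx], ?_, ?_, ?_, ?_⟩
      · linear_combination hC + z * e3 + z ^ 2 * hL + z ^ 3 * h2
      · refine (mul_eq_zero.mp (?_ : x * _ = 0)).resolve_left hx
        linear_combination 3 * hC + 2 * z * e3 + z ^ 2 * hL - y * hz
      · linear_combination hz
      · linear_combination e3 + 2 * z * hL + 3 * z ^ 2 * h2
  · obtain ⟨z, rfl⟩ : ∃ z, w = (φ 7 * x + φ 8 * y) * z := ⟨w / _, (mul_div_cancel₀ _ hL).symm⟩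
    have hf : (φ 7 * x + φ 8 * y) * z ^ 2 + (φ 4 * x ^ 2 + φ 9 * x * y + φ 6 * y ^ 2) * z
        + (φ 0 * x ^ 3 + φ 3 * x ^ 2 * y + φ 5 * x * y ^ 2 + φ 1 * y ^ 3) = 0 := by
      refine mul_left_cancel₀ hL ?_
      linear_combination e0
    refine ⟨x, y, z, hxy.imp_right Or.inl, ?_, ?_, ?_, ?_⟩
    · linear_combination hf + z ^ 3 * h2
    · refine mul_left_cancel₀ hL ?_
      linear_combination e1 - φ 7 * hf + φ 7 * z * e3
    · refine mul_left_cancel₀ hL ?_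
      linear_combination e2 - φ 8 * hf + φ 8 * z * e3
    · linear_combination e3 + 3 * z ^ 2 * h2

theorem exists_singAt3 {k : Type*} [Field k] [IsAlgClosed k] {φ : Idx3 → k}
    (hφ : (jac3 φ).Δ = 0) : ∃ x y z, (x ≠ 0 ∨ y ≠ 0 ∨ z ≠ 0) ∧ SingAt3 φ x y z := by
  by_cases h2 : φ 2 = 0
  · exact exists_singAt3_of_mem hφ h2
  -- A point (1 : 0 : s) of the cubic, which the exchange and the shear bring to (0 : 0 : 1).
  · obtain ⟨s, hs⟩ := exists_cubic_root h2 (φ 7) (φ 4) (φ 0)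
    obtain ⟨x, y, z, hP, h⟩ := exists_singAt3_of_mem (φ := shear3 s (swap3xz φ))
      (by rwa [jac3_shear3_Δ, jac3_swap3xz_Δ])
      (by simp only [swap3xz, shear3, Matrix.cons_val]; linear_combination hs)
    rw [singAt3_shear3, singAt3_swap3xz] at h
    refine ⟨_, _, _, ?_, h⟩
    by_contra! h0
    obtain ⟨h1, h2, h3⟩ := h0
    rw [h1] at h3
    simp [h1, h2, show x = 0 by simpa using h3] at hP

/-- The discriminant of ternary cubics. -/
noncomputable def disc3 : MvPolynomial Idx3 ℤ := (jac3 X).Δ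

theorem aeval_disc3 [Algebra ℤ R] (φ : Idx3 → R) : aeval φ disc3 = (jac3 φ).Δ := by
  have h := (jac3 (X : Idx3 → MvPolynomial Idx3 ℤ)).map_Δ (aeval φ : _ →ₐ[ℤ] R).toRingHom
  rw [jac3_map] at h
  simpa [disc3] using h.symm

/-- A pencil of ternary cubics. -/
noncomputable def pencil3 : Idx3 → Polynomial ℤ := ![-1, 0, -Polynomial.X, 0, 0, 0, 1, 0, 0, 1]

/-- The pencil is y²z + xyz = x³ + Tz³, the same family as in degree 2. -/
theorem aeval_pencil3 : aeval pencil3 disc3 = Polynomial.X * (-1 - 432 * Polynomial.X) := by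
  rw [aeval_disc3]
  simp [jac3, pencil3, WeierstrassCurve.Δ, WeierstrassCurve.b₂, WeierstrassCurve.b₄,
    WeierstrassCurve.b₆, WeierstrassCurve.b₈]
  ring

theorem isDiscriminant_disc3 : IsDiscriminant.{u} Sing3 disc3 := by
  refine isDiscriminant_of_generic disc3 (singular3 (X : Fin 11 → MvPolynomial (Fin 11) ℤ))
    ((aeval_disc3 _).trans (jac3_singular3_Δ _)) ?_ ?_ pencil3 _ aeval_pencil3 (by simp)
  · intro k _ _ φ h
    obtain ⟨x, y, z, hP, h⟩ := (sing3_iff φ).mp h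
    obtain ⟨u, rfl⟩ := exists_eq_singular3 hP h
    refine ⟨eval₂Hom (Int.castRingHom k) u, fun s => ?_⟩
    rw [congrFun (singular3_map _ _) s]
    simp
  · intro k _ _ φ h
    rw [aeval_disc3] at h
    exact (sing3_iff φ).mpr (exists_singAt3 h)

theorem jac3_c₄ (a b c a2 a3 b1 b3 c1 c2 m : R) :
    (jac3 ![a, b, c, 3 * a2, 3 * a3, 3 * b1, 3 * b3, 3 * c1, 3 * c2, 6 * m]).c₄ =
      -1296 * aronholdS a b c a2 a3 b1 b3 c1 c2 m := by
  simp only [jac3, WeierstrassCurve.c₄, WeierstrassCurve.b₂, WeierstrassCurve.b₄, Matrix.cons_val,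
    aronholdS]
  ring

theorem jac3_c₆ (a b c a2 a3 b1 b3 c1 c2 m : R) :
    (jac3 ![a, b, c, 3 * a2, 3 * a3, 3 * b1, 3 * b3, 3 * c1, 3 * c2, 6 * m]).c₆ =
      5832 * aronholdT a b c a2 a3 b1 b3 c1 c2 m := by
  simp only [jac3, WeierstrassCurve.c₆, WeierstrassCurve.b₂, WeierstrassCurve.b₄,
    WeierstrassCurve.b₆, Matrix.cons_val, aronholdT]
  ring

end Cubic

section Cubic

variable {K : Type*} [Field K]

theorem map_jac3_X : map (Int.castRingHom K) (jac3 (X : Idx3 → MvPolynomial Idx3 ℤ)).Δ =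
    (jac3 (X : Idx3 → MvPolynomial Idx3 K)).Δ := by
  rw [← WeierstrassCurve.map_Δ, jac3_map]
  simp

theorem map_disc3 (h2 : (2 : K) ≠ 0) (h3 : (3 : K) ≠ 0) :
    map (Int.castRingHom K) disc3 = C (2 ^ (-12 : ℤ)) * pullbackDiscW K (toW3 K) := by
  have e3 : (C (1 / 3) : MvPolynomial Idx3 K) * 3 = 1 :=
    C_mul_ofNat_eq_one 3 (by exact_mod_cast h3)
  have e6 : (C (1 / 6) : MvPolynomial Idx3 K) * 6 = 1 := by
    refine C_mul_ofNat_eq_one 6 ?_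
    rw [show ((6 : ℕ) : K) = 2 * 3 by norm_num]
    exact mul_ne_zero h2 h3
  have t3 : ∀ P : MvPolynomial Idx3 K, 3 * ((1 / 3 : K) • P) = P := fun P => by
    rw [smul_eq_C_mul]
    linear_combination P * e3
  have t6 : ∀ P : MvPolynomial Idx3 K, 6 * ((1 / 6 : K) • P) = P := fun P => by
    rw [smul_eq_C_mul]
    linear_combination P * e6
  let t : Idx3 → MvPolynomial Idx3 K := fun s => (1 / 3 : K) • X s
  have hX : (X : Idx3 → MvPolynomial Idx3 K) = ![X 0, X 1, X 2, 3 * t 3, 3 * t 4, 3 * t 5, 3 * t 6,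
      3 * t 7, 3 * t 8, 6 * ((1 / 6 : K) • X 9)] := by
    funext s
    fin_cases s <;> simp [t, t3, t6, -one_div]
  have c4 : (jac3 (X : Idx3 → MvPolynomial Idx3 K)).c₄ = -1296 * genericS K := by
    rw [hX, jac3_c₄]
    rfl
  have c6 : (jac3 (X : Idx3 → MvPolynomial Idx3 K)).c₆ = 5832 * genericT K := by
    rw [hX, jac3_c₆]
    rfl
  -- Here λ = 2: 2⁶·3·(-108) = 2⁴·(-1296) and 2⁹·3³·27 = 2⁶·5832.
  rw [pullbackDiscW_eq h2 h3 (toW3 K) (jac3 X) 2, disc3, map_jac3_X, ← mul_assoc, ← C_mul,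
    zpow_neg]
  · rw [show (2 : K) ^ (12 : ℤ) = 2 ^ 12 from zpow_natCast 2 12,
      inv_mul_cancel₀ (pow_ne_zero _ h2), C_1, one_mul]
  · rw [c4, C_pow, map_ofNat C 2]
    simp only [toW3, Matrix.cons_val]
    ring
  · rw [c6, C_pow, map_ofNat C 2]
    simp only [toW3, Matrix.cons_val]
    ring

end Cubic

/-! ### Pairs of quaternary quadrics -/

section QuadricPairs

variable {R : Type*} [CommRing R]

/-- The coefficient of `x⁴` in `(D - P²) / 4`, where `D` and `P` are the determinant and the
Pfaffian (with all signs positive) of the polar form of `x q + z r`. -/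
def pencilCoeff₄ (q : Fin 10 → R) : R :=
  4 * q 0 * q 4 * q 7 * q 9 - q 0 * q 4 * q 8 ^ 2 + q 0 * q 5 * q 6 * q 8 - q 0 * q 5 ^ 2 * q 9
    - q 0 * q 6 ^ 2 * q 7 + q 1 * q 2 * q 5 * q 9 - q 1 * q 2 * q 6 * q 8 - q 1 * q 3 * q 5 * q 8
    + q 1 * q 3 * q 6 * q 7 - q 1 ^ 2 * q 7 * q 9 + q 2 * q 3 * q 4 * q 8 - q 2 * q 3 * q 5 * q 6
    - q 2 ^ 2 * q 4 * q 9 - q 3 ^ 2 * q 4 * q 7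

/-- The coefficient of `x³ z` in the same quartic. -/
def pencilCoeff₃ (q r : Fin 10 → R) : R :=
  4 * q 0 * q 4 * q 7 * r 9 - 2 * q 0 * q 4 * q 8 * r 8 + 4 * q 0 * q 4 * q 9 * r 7
    + q 0 * q 5 * q 6 * r 8 + q 0 * q 5 * q 8 * r 6 - 2 * q 0 * q 5 * q 9 * r 5
    - q 0 * q 5 ^ 2 * r 9 - 2 * q 0 * q 6 * q 7 * r 6 + q 0 * q 6 * q 8 * r 5
    - q 0 * q 6 ^ 2 * r 7 + 4 * q 0 * q 7 * q 9 * r 4 - q 0 * q 8 ^ 2 * r 4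
    + q 1 * q 2 * q 5 * r 9 - q 1 * q 2 * q 6 * r 8 - q 1 * q 2 * q 8 * r 6
    + q 1 * q 2 * q 9 * r 5 - q 1 * q 3 * q 5 * r 8 + q 1 * q 3 * q 6 * r 7
    + q 1 * q 3 * q 7 * r 6 - q 1 * q 3 * q 8 * r 5 - q 1 * q 5 * q 8 * r 3
    + q 1 * q 5 * q 9 * r 2 + q 1 * q 6 * q 7 * r 3 - q 1 * q 6 * q 8 * r 2
    - 2 * q 1 * q 7 * q 9 * r 1 - q 1 ^ 2 * q 7 * r 9 - q 1 ^ 2 * q 9 * r 7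
    + q 2 * q 3 * q 4 * r 8 - q 2 * q 3 * q 5 * r 6 - q 2 * q 3 * q 6 * r 5
    + q 2 * q 3 * q 8 * r 4 + q 2 * q 4 * q 8 * r 3 - 2 * q 2 * q 4 * q 9 * r 2
    - q 2 * q 5 * q 6 * r 3 + q 2 * q 5 * q 9 * r 1 - q 2 * q 6 * q 8 * r 1 - q 2 ^ 2 * q 4 * r 9
    - q 2 ^ 2 * q 9 * r 4 - 2 * q 3 * q 4 * q 7 * r 3 + q 3 * q 4 * q 8 * r 2
    - q 3 * q 5 * q 6 * r 2 - q 3 * q 5 * q 8 * r 1 + q 3 * q 6 * q 7 * r 1 - q 3 ^ 2 * q 4 * r 7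
    - q 3 ^ 2 * q 7 * r 4 + 4 * q 4 * q 7 * q 9 * r 0 - q 4 * q 8 ^ 2 * r 0
    + q 5 * q 6 * q 8 * r 0 - q 5 ^ 2 * q 9 * r 0 - q 6 ^ 2 * q 7 * r 0

/-- The coefficient of `x² z²` in the same quartic. -/
def pencilCoeff₂ (q r : Fin 10 → R) : R :=
  4 * q 0 * q 4 * r 7 * r 9 - q 0 * q 4 * r 8 ^ 2 - 2 * q 0 * q 5 * r 5 * r 9
    + q 0 * q 5 * r 6 * r 8 + q 0 * q 6 * r 5 * r 8 - 2 * q 0 * q 6 * r 6 * r 7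
    + 4 * q 0 * q 7 * r 4 * r 9 - q 0 * q 7 * r 6 ^ 2 - 2 * q 0 * q 8 * r 4 * r 8
    + q 0 * q 8 * r 5 * r 6 + 4 * q 0 * q 9 * r 4 * r 7 - q 0 * q 9 * r 5 ^ 2
    + q 1 * q 2 * r 5 * r 9 - q 1 * q 2 * r 6 * r 8 - q 1 * q 3 * r 5 * r 8
    + q 1 * q 3 * r 6 * r 7 + q 1 * q 5 * r 2 * r 9 - q 1 * q 5 * r 3 * r 8
    - q 1 * q 6 * r 2 * r 8 + q 1 * q 6 * r 3 * r 7 - 2 * q 1 * q 7 * r 1 * r 9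
    + q 1 * q 7 * r 3 * r 6 - q 1 * q 8 * r 2 * r 6 - q 1 * q 8 * r 3 * r 5
    - 2 * q 1 * q 9 * r 1 * r 7 + q 1 * q 9 * r 2 * r 5 - q 1 ^ 2 * r 7 * r 9
    + q 2 * q 3 * r 4 * r 8 - q 2 * q 3 * r 5 * r 6 - 2 * q 2 * q 4 * r 2 * r 9
    + q 2 * q 4 * r 3 * r 8 + q 2 * q 5 * r 1 * r 9 - q 2 * q 5 * r 3 * r 6
    - q 2 * q 6 * r 1 * r 8 - q 2 * q 6 * r 3 * r 5 - q 2 * q 8 * r 1 * r 6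
    + q 2 * q 8 * r 3 * r 4 + q 2 * q 9 * r 1 * r 5 - 2 * q 2 * q 9 * r 2 * r 4
    - q 2 ^ 2 * r 4 * r 9 + q 3 * q 4 * r 2 * r 8 - 2 * q 3 * q 4 * r 3 * r 7
    - q 3 * q 5 * r 1 * r 8 - q 3 * q 5 * r 2 * r 6 + q 3 * q 6 * r 1 * r 7
    - q 3 * q 6 * r 2 * r 5 + q 3 * q 7 * r 1 * r 6 - 2 * q 3 * q 7 * r 3 * r 4
    - q 3 * q 8 * r 1 * r 5 + q 3 * q 8 * r 2 * r 4 - q 3 ^ 2 * r 4 * r 7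
    + 4 * q 4 * q 7 * r 0 * r 9 - q 4 * q 7 * r 3 ^ 2 - 2 * q 4 * q 8 * r 0 * r 8
    + q 4 * q 8 * r 2 * r 3 + 4 * q 4 * q 9 * r 0 * r 7 - q 4 * q 9 * r 2 ^ 2
    + q 5 * q 6 * r 0 * r 8 - q 5 * q 6 * r 2 * r 3 + q 5 * q 8 * r 0 * r 6
    - q 5 * q 8 * r 1 * r 3 - 2 * q 5 * q 9 * r 0 * r 5 + q 5 * q 9 * r 1 * r 2
    - q 5 ^ 2 * r 0 * r 9 - 2 * q 6 * q 7 * r 0 * r 6 + q 6 * q 7 * r 1 * r 3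
    + q 6 * q 8 * r 0 * r 5 - q 6 * q 8 * r 1 * r 2 - q 6 ^ 2 * r 0 * r 7
    + 4 * q 7 * q 9 * r 0 * r 4 - q 7 * q 9 * r 1 ^ 2 - q 8 ^ 2 * r 0 * r 4

/-- The double cover `y² + p y = q` of the line which parametrises the rulings of the quadrics in a
pencil; here `p² + 4 q` is the determinant of the polar form. -/
def rulings4 (φ : Idx4 → R) : Idx2 → R :=
  let q : Fin 10 → R := fun i => φ (0, i)
  let r : Fin 10 → R := fun i => φ (1, i)
  ![q 1 * q 8 + q 2 * q 6 + q 3 * q 5,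
    q 1 * r 8 + q 2 * r 6 + q 3 * r 5 + q 5 * r 3 + q 6 * r 2 + q 8 * r 1,
    r 1 * r 8 + r 2 * r 6 + r 3 * r 5,
    pencilCoeff₄ q, pencilCoeff₃ q r, pencilCoeff₂ q r, pencilCoeff₃ r q, pencilCoeff₄ r]

theorem pencilCoeff₄_map {S : Type*} [CommRing S] (f : R →+* S) (q : Fin 10 → R) :
    f (pencilCoeff₄ q) = pencilCoeff₄ fun i => f (q i) := by
  simp only [pencilCoeff₄, map_add, map_sub, map_mul, map_pow, map_ofNat f]

theorem pencilCoeff₃_map {S : Type*} [CommRing S] (f : R →+* S) (q r : Fin 10 → R) :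
    f (pencilCoeff₃ q r) = pencilCoeff₃ (fun i => f (q i)) fun i => f (r i) := by
  simp only [pencilCoeff₃, map_add, map_sub, map_mul, map_pow, map_ofNat f]

theorem pencilCoeff₂_map {S : Type*} [CommRing S] (f : R →+* S) (q r : Fin 10 → R) :
    f (pencilCoeff₂ q r) = pencilCoeff₂ (fun i => f (q i)) fun i => f (r i) := by
  simp only [pencilCoeff₂, map_add, map_sub, map_mul, map_pow, map_ofNat f]

theorem rulings4_map {S : Type*} [CommRing S] (f : R →+* S) (φ : Idx4 → R) :
    (fun s => f (rulings4 φ s)) = rulings4 fun s => f (φ s) := by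
  funext s
  fin_cases s <;> simp [rulings4, pencilCoeff₄_map, pencilCoeff₃_map, pencilCoeff₂_map]

/-- The exchange of `x₀` and `x₁` in a quadratic form. -/
def quadricSwapA (q : Fin 10 → R) : Fin 10 → R :=
  ![q 4, q 1, q 5, q 6, q 0, q 2, q 3, q 7, q 8, q 9]

/-- The exchange of `x₁` and `x₂` in a quadratic form. -/
def quadricSwapB (q : Fin 10 → R) : Fin 10 → R :=
  ![q 0, q 2, q 1, q 3, q 7, q 5, q 8, q 4, q 6, q 9]

/-- The exchange of `x₂` and `x₃` in a quadratic form. -/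
def quadricSwapC (q : Fin 10 → R) : Fin 10 → R :=
  ![q 0, q 1, q 3, q 2, q 4, q 6, q 5, q 9, q 8, q 7]

/-- The substitution `x₀ ↦ x₀ + t x₁` in a quadratic form. -/
def quadricShear (t : R) (q : Fin 10 → R) : Fin 10 → R :=
  ![q 0, q 1 + 2 * t * q 0, q 2, q 3, q 4 + t * q 1 + t ^ 2 * q 0, q 5 + t * q 2, q 6 + t * q 3,
    q 7, q 8, q 9]

/-- The application of an operation to both quadratic forms. -/
def onBoth (f : (Fin 10 → R) → Fin 10 → R) (φ : Idx4 → R) : Idx4 → R :=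
  fun s => f (fun i => φ (s.1, i)) s.2

/-- The exchange of the two quadrics. -/
def pencilSwap (φ : Idx4 → R) : Idx4 → R := fun s => ![φ (1, s.2), φ (0, s.2)] s.1

/-- The addition of `t` times the first quadric to the second one. -/
def pencilShear (t : R) (φ : Idx4 → R) : Idx4 → R := fun s =>
  ![φ (0, s.2), φ (1, s.2) + t * φ (0, s.2)] s.1


theorem pencilCoeff₄_swapA (q : Fin 10 → R) :
    pencilCoeff₄ (quadricSwapA q) = pencilCoeff₄ q := by
  simp only [pencilCoeff₄, quadricSwapA, Matrix.cons_val]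
  ring

theorem pencilCoeff₃_swapA (q r : Fin 10 → R) :
    pencilCoeff₃ (quadricSwapA q) (quadricSwapA r) = pencilCoeff₃ q r := by
  simp only [pencilCoeff₃, quadricSwapA, Matrix.cons_val]
  ring

theorem pencilCoeff₂_swapA (q r : Fin 10 → R) :
    pencilCoeff₂ (quadricSwapA q) (quadricSwapA r) = pencilCoeff₂ q r := by
  simp only [pencilCoeff₂, quadricSwapA, Matrix.cons_val]
  ring

/-- Taking all signs of the Pfaffian positive makes it invariant under permutations of the four
variables, so p and q do not change at all. -/
theorem rulings4_swapA (φ : Idx4 → R) : rulings4 (onBoth quadricSwapA φ) = rulings4 φ := by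
  simp only [rulings4, onBoth, pencilCoeff₄_swapA, pencilCoeff₃_swapA, pencilCoeff₂_swapA]
  simp only [quadricSwapA, Matrix.cons_val]
  congr 1
  · ring
  congr 1
  · ring
  congr 1
  ring

theorem pencilCoeff₄_swapB (q : Fin 10 → R) :
    pencilCoeff₄ (quadricSwapB q) = pencilCoeff₄ q := by
  simp only [pencilCoeff₄, quadricSwapB, Matrix.cons_val]
  ring

theorem pencilCoeff₃_swapB (q r : Fin 10 → R) :
    pencilCoeff₃ (quadricSwapB q) (quadricSwapB r) = pencilCoeff₃ q r := by
  simp only [pencilCoeff₃, quadricSwapB, Matrix.cons_val]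
  ring

theorem pencilCoeff₂_swapB (q r : Fin 10 → R) :
    pencilCoeff₂ (quadricSwapB q) (quadricSwapB r) = pencilCoeff₂ q r := by
  simp only [pencilCoeff₂, quadricSwapB, Matrix.cons_val]
  ring

theorem rulings4_swapB (φ : Idx4 → R) : rulings4 (onBoth quadricSwapB φ) = rulings4 φ := by
  simp only [rulings4, onBoth, pencilCoeff₄_swapB, pencilCoeff₃_swapB, pencilCoeff₂_swapB]
  simp only [quadricSwapB, Matrix.cons_val]
  congr 1
  · ring
  congr 1
  · ring
  congr 1
  ring

theorem pencilCoeff₄_swapC (q : Fin 10 → R) :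
    pencilCoeff₄ (quadricSwapC q) = pencilCoeff₄ q := by
  simp only [pencilCoeff₄, quadricSwapC, Matrix.cons_val]
  ring

theorem pencilCoeff₃_swapC (q r : Fin 10 → R) :
    pencilCoeff₃ (quadricSwapC q) (quadricSwapC r) = pencilCoeff₃ q r := by
  simp only [pencilCoeff₃, quadricSwapC, Matrix.cons_val]
  ring

theorem pencilCoeff₂_swapC (q r : Fin 10 → R) :
    pencilCoeff₂ (quadricSwapC q) (quadricSwapC r) = pencilCoeff₂ q r := by
  simp only [pencilCoeff₂, quadricSwapC, Matrix.cons_val]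
  ring

theorem rulings4_swapC (φ : Idx4 → R) : rulings4 (onBoth quadricSwapC φ) = rulings4 φ := by
  simp only [rulings4, onBoth, pencilCoeff₄_swapC, pencilCoeff₃_swapC, pencilCoeff₂_swapC]
  simp only [quadricSwapC, Matrix.cons_val]
  congr 1
  · ring
  congr 1
  · ring
  congr 1
  ring

theorem pencilCoeff₄_shear (t : R) (q : Fin 10 → R) :
    pencilCoeff₄ (quadricShear t q) = pencilCoeff₄ q
      - t * (q 0 * q 8 + q 2 * q 3) * (q 1 * q 8 + q 2 * q 6 + q 3 * q 5)
      - (t * (q 0 * q 8 + q 2 * q 3)) ^ 2 := by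
  simp only [pencilCoeff₄, quadricShear, Matrix.cons_val]
  ring

theorem pencilCoeff₃_shear (t : R) (q r : Fin 10 → R) :
    pencilCoeff₃ (quadricShear t q) (quadricShear t r) = pencilCoeff₃ q r
      - t * (q 0 * q 8 + q 2 * q 3)
        * (q 1 * r 8 + q 2 * r 6 + q 3 * r 5 + q 5 * r 3 + q 6 * r 2 + q 8 * r 1)
      - t * (q 0 * r 8 + r 0 * q 8 + q 2 * r 3 + r 2 * q 3) * (q 1 * q 8 + q 2 * q 6 + q 3 * q 5)
      - 2 * (t * (q 0 * q 8 + q 2 * q 3))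
        * (t * (q 0 * r 8 + r 0 * q 8 + q 2 * r 3 + r 2 * q 3)) := by
  simp only [pencilCoeff₃, quadricShear, Matrix.cons_val]
  ring

theorem pencilCoeff₂_shear (t : R) (q r : Fin 10 → R) :
    pencilCoeff₂ (quadricShear t q) (quadricShear t r) = pencilCoeff₂ q r
      - t * (q 0 * q 8 + q 2 * q 3) * (r 1 * r 8 + r 2 * r 6 + r 3 * r 5)
      - t * (q 0 * r 8 + r 0 * q 8 + q 2 * r 3 + r 2 * q 3)
        * (q 1 * r 8 + q 2 * r 6 + q 3 * r 5 + q 5 * r 3 + q 6 * r 2 + q 8 * r 1)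
      - t * (r 0 * r 8 + r 2 * r 3) * (q 1 * q 8 + q 2 * q 6 + q 3 * q 5)
      - (t * (q 0 * r 8 + r 0 * q 8 + q 2 * r 3 + r 2 * q 3)) ^ 2
      - 2 * (t * (q 0 * q 8 + q 2 * q 3)) * (t * (r 0 * r 8 + r 2 * r 3)) := by
  simp only [pencilCoeff₂, quadricShear, Matrix.cons_val]
  ring

/-- The determinant p² + 4q is invariant, but the all-positive Pfaffian p grows by twice a form.
This is exactly the effect of a shift of y by that form. -/
theorem rulings4_shear (t : R) (φ : Idx4 → R) :
    rulings4 (onBoth (quadricShear t) φ) =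
      shift2 (t * (φ (0, 0) * φ (0, 8) + φ (0, 2) * φ (0, 3)))
        (t * (φ (0, 0) * φ (1, 8) + φ (1, 0) * φ (0, 8) + φ (0, 2) * φ (1, 3)
          + φ (1, 2) * φ (0, 3)))
        (t * (φ (1, 0) * φ (1, 8) + φ (1, 2) * φ (1, 3))) (rulings4 φ) := by
  simp only [rulings4, onBoth, pencilCoeff₄_shear, pencilCoeff₃_shear, pencilCoeff₂_shear]
  simp only [shift2, quadricShear, Matrix.cons_val]
  funext s
  fin_cases s <;> simp only [Fin.reduceFinMk, Fin.zero_eta, Fin.mk_one, Matrix.cons_val] <;> ring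

theorem rulings4_pencilSwap (φ : Idx4 → R) : rulings4 (pencilSwap φ) = swap2 (rulings4 φ) := by
  have h : ∀ q r : Fin 10 → R, pencilCoeff₂ q r = pencilCoeff₂ r q := by
    intro q r
    simp only [pencilCoeff₂]
    ring
  simp only [rulings4, pencilSwap, swap2, Matrix.cons_val, h (fun i => φ (1, i))]
  congr 2
  ring_nf

theorem pencilCoeff₄_add (t : R) (q r : Fin 10 → R) :
    pencilCoeff₄ (fun i => r i + t * q i) = pencilCoeff₄ r + t * pencilCoeff₃ r q
      + t ^ 2 * pencilCoeff₂ q r + t ^ 3 * pencilCoeff₃ q r + t ^ 4 * pencilCoeff₄ q := by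
  simp only [pencilCoeff₄, pencilCoeff₃, pencilCoeff₂]
  ring

theorem pencilCoeff₃_add_right (t : R) (q r : Fin 10 → R) :
    pencilCoeff₃ q (fun i => r i + t * q i) = pencilCoeff₃ q r + 4 * t * pencilCoeff₄ q := by
  simp only [pencilCoeff₄, pencilCoeff₃]
  ring

theorem pencilCoeff₃_add_left (t : R) (q r : Fin 10 → R) :
    pencilCoeff₃ (fun i => r i + t * q i) q = pencilCoeff₃ r q + 2 * t * pencilCoeff₂ q r
      + 3 * t ^ 2 * pencilCoeff₃ q r + 4 * t ^ 3 * pencilCoeff₄ q := by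
  simp only [pencilCoeff₄, pencilCoeff₃, pencilCoeff₂]
  ring

theorem pencilCoeff₂_add (t : R) (q r : Fin 10 → R) :
    pencilCoeff₂ q (fun i => r i + t * q i) = pencilCoeff₂ q r + 3 * t * pencilCoeff₃ q r
      + 6 * t ^ 2 * pencilCoeff₄ q := by
  simp only [pencilCoeff₄, pencilCoeff₃, pencilCoeff₂]
  ring

theorem rulings4_pencilShear (t : R) (φ : Idx4 → R) :
    rulings4 (pencilShear t φ) = shear2 t (rulings4 φ) := by
  simp only [rulings4, pencilShear, shear2, Matrix.cons_val, pencilCoeff₄_add,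
    pencilCoeff₃_add_left, pencilCoeff₃_add_right, pencilCoeff₂_add]
  funext s
  fin_cases s <;> simp only [Fin.reduceFinMk, Fin.zero_eta, Fin.mk_one, Matrix.cons_val] <;> ring

end QuadricPairs

/-! ### Singular points of pairs of quadrics and the generic singular pair -/

section QuadricPairs

/-- The value of a quadratic form. -/
def quadricValue {R : Type*} [CommRing R] (q : Fin 10 → R) (x₀ x₁ x₂ x₃ : R) : R :=
  q 0 * x₀ ^ 2 + q 1 * x₀ * x₁ + q 2 * x₀ * x₂ + q 3 * x₀ * x₃ + q 4 * x₁ ^ 2 + q 5 * x₁ * x₂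
    + q 6 * x₁ * x₃ + q 7 * x₂ ^ 2 + q 8 * x₂ * x₃ + q 9 * x₃ ^ 2

/-- The gradient of a quadratic form. -/
def quadricGrad {R : Type*} [CommRing R] (q : Fin 10 → R) (x₀ x₁ x₂ x₃ : R) : Fin 4 → R :=
  ![2 * q 0 * x₀ + q 1 * x₁ + q 2 * x₂ + q 3 * x₃, q 1 * x₀ + 2 * q 4 * x₁ + q 5 * x₂ + q 6 * x₃,
    q 2 * x₀ + q 5 * x₁ + 2 * q 7 * x₂ + q 8 * x₃, q 3 * x₀ + q 6 * x₁ + q 8 * x₂ + 2 * q 9 * x₃]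

variable {R : Type*} [CommRing R]

/-- Both quadrics pass through the given point, where their gradients satisfy the linear relation
with coefficients `c` and `c'`. -/
def SingAt4 (φ : Idx4 → R) (c c' x₀ x₁ x₂ x₃ : R) : Prop :=
  quadricValue (fun i => φ (0, i)) x₀ x₁ x₂ x₃ = 0 ∧
    quadricValue (fun i => φ (1, i)) x₀ x₁ x₂ x₃ = 0 ∧
    ∀ j, c * quadricGrad (fun i => φ (0, i)) x₀ x₁ x₂ x₃ j
      + c' * quadricGrad (fun i => φ (1, i)) x₀ x₁ x₂ x₃ j = 0

theorem sing4_iff {k : Type u} [Field k] (φ : Idx4 → k) :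
    Sing4 k φ ↔ ∃ c c' x₀ x₁ x₂ x₃, (c ≠ 0 ∨ c' ≠ 0) ∧ (x₀ ≠ 0 ∨ x₁ ≠ 0 ∨ x₂ ≠ 0 ∨ x₃ ≠ 0) ∧
      SingAt4 φ c c' x₀ x₁ x₂ x₃ := by
  have hv : ∀ (P : Fin 4 → k) r, eval P (eqn4 φ r) =
      quadricValue (fun i => φ (r, i)) (P 0) (P 1) (P 2) (P 3) := by
    intro P r
    simp [eqn4, quadric, quadricValue]
  have hg : ∀ (P : Fin 4 → k) r i, eval P (pderiv i (eqn4 φ r)) =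
      quadricGrad (fun i => φ (r, i)) (P 0) (P 1) (P 2) (P 3) i := by
    intro P r i
    fin_cases i <;> simp [eqn4, quadric, quadricGrad, pderiv_X] <;> ring
  have key : ∀ P : Fin 4 → k, ((∀ r, eval P (eqn4 φ r) = 0) ∧
      ¬ LinearIndependent k fun (r : Fin 2) (i : Fin 4) => eval P (pderiv i (eqn4 φ r))) ↔
      ∃ c c', (c ≠ 0 ∨ c' ≠ 0) ∧ SingAt4 φ c c' (P 0) (P 1) (P 2) (P 3) := by
    intro P
    rw [Fintype.not_linearIndependent_iff]
    simp only [hv, hg, Fin.forall_fin_two, Fin.sum_univ_two, Fin.exists_fin_two, SingAt4]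
    constructor
    · rintro ⟨⟨h0, h1⟩, g, hgr, hg0⟩
      exact ⟨g 0, g 1, hg0, h0, h1, fun j => by simpa using congrFun hgr j⟩
    · rintro ⟨c, c', hc, h0, h1, h⟩
      exact ⟨⟨h0, h1⟩, ![c, c'], funext fun j => by simpa using h j, by simpa using hc⟩
  constructor
  · rintro ⟨P, hP, h⟩
    obtain ⟨c, c', hc, hs⟩ := (key P).mp h
    refine ⟨c, c', P 0, P 1, P 2, P 3, hc, ?_, hs⟩
    by_contra! h0
    refine hP (funext fun i => ?_)
    fin_cases i <;> simp [h0]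
  · rintro ⟨c, c', x₀, x₁, x₂, x₃, hc, hP, hs⟩
    refine ⟨![x₀, x₁, x₂, x₃], ?_, (key _).mpr ⟨c, c', hc, by simpa using hs⟩⟩
    intro h0
    have h1 := congrFun h0 0
    have h2 := congrFun h0 1
    have h3 := congrFun h0 2
    have h4 := congrFun h0 3
    simp at h1 h2 h3 h4
    simp [h1, h2, h3, h4] at hP

theorem SingAt4.smul {φ : Idx4 → R} {c c' x₀ x₁ x₂ x₃ : R} (h : SingAt4 φ c c' x₀ x₁ x₂ x₃)
    (l m : R) : SingAt4 φ (l * c) (l * c') (m * x₀) (m * x₁) (m * x₂) (m * x₃) := by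
  obtain ⟨h0, h1, h2⟩ := h
  have hv : ∀ q : Fin 10 → R, quadricValue q (m * x₀) (m * x₁) (m * x₂) (m * x₃) =
      m ^ 2 * quadricValue q x₀ x₁ x₂ x₃ := by
    intro q
    simp only [quadricValue]
    ring
  have hg : ∀ (q : Fin 10 → R) j, quadricGrad q (m * x₀) (m * x₁) (m * x₂) (m * x₃) j =
      m * quadricGrad q x₀ x₁ x₂ x₃ j := by
    intro q j
    fin_cases j <;> simp [quadricGrad] <;> ring
  refine ⟨by rw [hv, h0, mul_zero], by rw [hv, h1, mul_zero], fun j => ?_⟩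
  rw [hg, hg]
  linear_combination l * m * h2 j

theorem onBoth_swapA_map {S : Type*} [CommRing S] (f : R →+* S) (φ : Idx4 → R) :
    (fun s => f (onBoth quadricSwapA φ s)) = onBoth quadricSwapA fun s => f (φ s) := by
  funext ⟨r, s⟩
  fin_cases s <;> simp [onBoth, quadricSwapA]

theorem onBoth_swapA_swapA {α : Type*} (φ : Idx4 → α) :
    onBoth quadricSwapA (onBoth quadricSwapA φ) = φ := by
  funext ⟨r, s⟩
  fin_cases s <;> simp [onBoth, quadricSwapA]

theorem quadricValue_swapA (q : Fin 10 → R) (x₀ x₁ x₂ x₃ : R) :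
    quadricValue (quadricSwapA q) x₀ x₁ x₂ x₃ = quadricValue q x₁ x₀ x₂ x₃ := by
  simp only [quadricValue, quadricSwapA, Matrix.cons_val]
  ring

theorem quadricGrad_swapA (q : Fin 10 → R) (x₀ x₁ x₂ x₃ : R) :
    quadricGrad (quadricSwapA q) x₀ x₁ x₂ x₃ =
      quadricGrad q x₁ x₀ x₂ x₃ ∘ ![1, 0, 2, 3] := by
  funext j
  fin_cases j <;> simp [quadricGrad, quadricSwapA] <;> ring

theorem singAt4_swapA {φ : Idx4 → R} {c c' x₀ x₁ x₂ x₃ : R} :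
    SingAt4 (onBoth quadricSwapA φ) c c' x₀ x₁ x₂ x₃ ↔ SingAt4 φ c c' x₁ x₀ x₂ x₃ := by
  simp only [SingAt4, onBoth, quadricValue_swapA, quadricGrad_swapA]
  refine and_congr_right fun _ => and_congr_right fun _ => ?_
  simp only [Fin.forall_fin_succ, Function.comp_apply]
  simp
  tauto

theorem onBoth_swapB_map {S : Type*} [CommRing S] (f : R →+* S) (φ : Idx4 → R) :
    (fun s => f (onBoth quadricSwapB φ s)) = onBoth quadricSwapB fun s => f (φ s) := by
  funext ⟨r, s⟩
  fin_cases s <;> simp [onBoth, quadricSwapB]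

theorem onBoth_swapB_swapB {α : Type*} (φ : Idx4 → α) :
    onBoth quadricSwapB (onBoth quadricSwapB φ) = φ := by
  funext ⟨r, s⟩
  fin_cases s <;> simp [onBoth, quadricSwapB]

theorem quadricValue_swapB (q : Fin 10 → R) (x₀ x₁ x₂ x₃ : R) :
    quadricValue (quadricSwapB q) x₀ x₁ x₂ x₃ = quadricValue q x₀ x₂ x₁ x₃ := by
  simp only [quadricValue, quadricSwapB, Matrix.cons_val]
  ring

theorem quadricGrad_swapB (q : Fin 10 → R) (x₀ x₁ x₂ x₃ : R) :
    quadricGrad (quadricSwapB q) x₀ x₁ x₂ x₃ =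
      quadricGrad q x₀ x₂ x₁ x₃ ∘ ![0, 2, 1, 3] := by
  funext j
  fin_cases j <;> simp [quadricGrad, quadricSwapB] <;> ring

theorem singAt4_swapB {φ : Idx4 → R} {c c' x₀ x₁ x₂ x₃ : R} :
    SingAt4 (onBoth quadricSwapB φ) c c' x₀ x₁ x₂ x₃ ↔ SingAt4 φ c c' x₀ x₂ x₁ x₃ := by
  simp only [SingAt4, onBoth, quadricValue_swapB, quadricGrad_swapB]
  refine and_congr_right fun _ => and_congr_right fun _ => ?_
  simp only [Fin.forall_fin_succ, Function.comp_apply]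
  simp
  tauto

theorem onBoth_swapC_map {S : Type*} [CommRing S] (f : R →+* S) (φ : Idx4 → R) :
    (fun s => f (onBoth quadricSwapC φ s)) = onBoth quadricSwapC fun s => f (φ s) := by
  funext ⟨r, s⟩
  fin_cases s <;> simp [onBoth, quadricSwapC]

theorem onBoth_swapC_swapC {α : Type*} (φ : Idx4 → α) :
    onBoth quadricSwapC (onBoth quadricSwapC φ) = φ := by
  funext ⟨r, s⟩
  fin_cases s <;> simp [onBoth, quadricSwapC]

theorem quadricValue_swapC (q : Fin 10 → R) (x₀ x₁ x₂ x₃ : R) :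
    quadricValue (quadricSwapC q) x₀ x₁ x₂ x₃ = quadricValue q x₀ x₁ x₃ x₂ := by
  simp only [quadricValue, quadricSwapC, Matrix.cons_val]
  ring

theorem quadricGrad_swapC (q : Fin 10 → R) (x₀ x₁ x₂ x₃ : R) :
    quadricGrad (quadricSwapC q) x₀ x₁ x₂ x₃ =
      quadricGrad q x₀ x₁ x₃ x₂ ∘ ![0, 1, 3, 2] := by
  funext j
  fin_cases j <;> simp [quadricGrad, quadricSwapC] <;> ring

theorem singAt4_swapC {φ : Idx4 → R} {c c' x₀ x₁ x₂ x₃ : R} :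
    SingAt4 (onBoth quadricSwapC φ) c c' x₀ x₁ x₂ x₃ ↔ SingAt4 φ c c' x₀ x₁ x₃ x₂ := by
  simp only [SingAt4, onBoth, quadricValue_swapC, quadricGrad_swapC]
  refine and_congr_right fun _ => and_congr_right fun _ => ?_
  simp only [Fin.forall_fin_succ, Function.comp_apply]
  simp
  tauto

theorem onBoth_shear_map {S : Type*} [CommRing S] (f : R →+* S) (t : R) (φ : Idx4 → R) :
    (fun s => f (onBoth (quadricShear t) φ s)) =
      onBoth (quadricShear (f t)) fun s => f (φ s) := by
  funext ⟨r, s⟩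
  fin_cases s <;> simp [onBoth, quadricShear, map_ofNat f]

theorem onBoth_shear_neg (t : R) (φ : Idx4 → R) :
    onBoth (quadricShear t) (onBoth (quadricShear (-t)) φ) = φ := by
  funext ⟨r, s⟩
  fin_cases s <;> simp [onBoth, quadricShear]
  ring

theorem quadricValue_shear (t : R) (q : Fin 10 → R) (x₀ x₁ x₂ x₃ : R) :
    quadricValue (quadricShear t q) x₀ x₁ x₂ x₃ = quadricValue q (x₀ + t * x₁) x₁ x₂ x₃ := by
  simp only [quadricValue, quadricShear, Matrix.cons_val]
  ring

theorem singAt4_shear {φ : Idx4 → R} {t c c' x₀ x₁ x₂ x₃ : R} :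
    SingAt4 (onBoth (quadricShear t) φ) c c' x₀ x₁ x₂ x₃ ↔
      SingAt4 φ c c' (x₀ + t * x₁) x₁ x₂ x₃ := by
  simp only [SingAt4, onBoth, quadricValue_shear]
  refine and_congr_right fun _ => and_congr_right fun _ => ?_
  simp only [quadricGrad, quadricShear, Fin.forall_fin_succ, Fin.forall_fin_zero, Matrix.cons_val,
    and_true, Fin.succ_zero_eq_one, Fin.succ_one_eq_two, Fin.reduceSucc]
  constructor <;> rintro ⟨h0, h1, h2, h3⟩ <;> refine ⟨?_, ?_, ?_, ?_⟩
  · linear_combination h0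
  · linear_combination h1 - t * h0
  · linear_combination h2
  · linear_combination h3
  · linear_combination h0
  · linear_combination h1 + t * h0
  · linear_combination h2
  · linear_combination h3

theorem pencilSwap_map {S : Type*} [CommRing S] (f : R →+* S) (φ : Idx4 → R) :
    (fun s => f (pencilSwap φ s)) = pencilSwap fun s => f (φ s) := by
  funext ⟨r, s⟩
  fin_cases r <;> simp [pencilSwap]

theorem pencilSwap_pencilSwap {α : Type*} (φ : Idx4 → α) : pencilSwap (pencilSwap φ) = φ := by
  funext ⟨r, s⟩
  fin_cases r <;> simp [pencilSwap]

theorem singAt4_pencilSwap {φ : Idx4 → R} {c c' x₀ x₁ x₂ x₃ : R} :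
    SingAt4 (pencilSwap φ) c c' x₀ x₁ x₂ x₃ ↔ SingAt4 φ c' c x₀ x₁ x₂ x₃ := by
  simp only [SingAt4, pencilSwap, Matrix.cons_val_zero, Matrix.cons_val_one]
  rw [and_left_comm]
  simp only [add_comm]

theorem pencilShear_map {S : Type*} [CommRing S] (f : R →+* S) (t : R) (φ : Idx4 → R) :
    (fun s => f (pencilShear t φ s)) = pencilShear (f t) fun s => f (φ s) := by
  funext ⟨r, s⟩
  fin_cases r <;> simp [pencilShear]

theorem pencilShear_neg (t : R) (φ : Idx4 → R) : pencilShear t (pencilShear (-t) φ) = φ := by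
  funext ⟨r, s⟩
  fin_cases r <;> simp [pencilShear]

theorem singAt4_pencilShear {φ : Idx4 → R} {t c c' x₀ x₁ x₂ x₃ : R} :
    SingAt4 (pencilShear t φ) c c' x₀ x₁ x₂ x₃ ↔ SingAt4 φ (c + t * c') c' x₀ x₁ x₂ x₃ := by
  have hv : ∀ q r : Fin 10 → R, quadricValue (fun i => r i + t * q i) x₀ x₁ x₂ x₃ =
      quadricValue r x₀ x₁ x₂ x₃ + t * quadricValue q x₀ x₁ x₂ x₃ := by
    intro q r
    simp only [quadricValue]
    ring
  have hg : ∀ (q r : Fin 10 → R) j, quadricGrad (fun i => r i + t * q i) x₀ x₁ x₂ x₃ j =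
      quadricGrad r x₀ x₁ x₂ x₃ j + t * quadricGrad q x₀ x₁ x₂ x₃ j := by
    intro q r j
    fin_cases j <;> simp [quadricGrad] <;> ring
  simp only [SingAt4, pencilShear, Matrix.cons_val_zero, Matrix.cons_val_one, hv, hg]
  refine and_congr_right fun h => and_congr (by rw [h, mul_zero, add_zero]) ?_
  refine forall_congr' fun j => Eq.congr_left ?_
  ring

/-- The substitution `x₁ ↦ x₁ + t x₀`. -/
def shear10 (t : R) (φ : Idx4 → R) : Idx4 → R :=
  onBoth quadricSwapA (onBoth (quadricShear t) (onBoth quadricSwapA φ))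

/-- The substitution `x₀ ↦ x₀ + t x₂`. -/
def shear02 (t : R) (φ : Idx4 → R) : Idx4 → R :=
  onBoth quadricSwapB (onBoth (quadricShear t) (onBoth quadricSwapB φ))

/-- The substitution `x₂ ↦ x₂ + t x₀`. -/
def shear20 (t : R) (φ : Idx4 → R) : Idx4 → R :=
  onBoth quadricSwapB (shear10 t (onBoth quadricSwapB φ))

/-- The substitution `x₀ ↦ x₀ + t x₃`. -/
def shear03 (t : R) (φ : Idx4 → R) : Idx4 → R :=
  onBoth quadricSwapC (shear02 t (onBoth quadricSwapC φ))

/-- The substitution `x₃ ↦ x₃ + t x₀`. -/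
def shear30 (t : R) (φ : Idx4 → R) : Idx4 → R :=
  onBoth quadricSwapC (shear20 t (onBoth quadricSwapC φ))

/-- The addition of `t` times the second quadric to the first one. -/
def pencilShear' (t : R) (φ : Idx4 → R) : Idx4 → R := pencilSwap (pencilShear t (pencilSwap φ))

theorem shear10_neg (t : R) (φ : Idx4 → R) : shear10 t (shear10 (-t) φ) = φ := by
  rw [shear10, shear10, onBoth_swapA_swapA, onBoth_shear_neg, onBoth_swapA_swapA]

theorem shear02_neg (t : R) (φ : Idx4 → R) : shear02 t (shear02 (-t) φ) = φ := by
  rw [shear02, shear02, onBoth_swapB_swapB, onBoth_shear_neg, onBoth_swapB_swapB]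

theorem shear20_neg (t : R) (φ : Idx4 → R) : shear20 t (shear20 (-t) φ) = φ := by
  rw [shear20, shear20, onBoth_swapB_swapB, shear10_neg, onBoth_swapB_swapB]

theorem shear03_neg (t : R) (φ : Idx4 → R) : shear03 t (shear03 (-t) φ) = φ := by
  rw [shear03, shear03, onBoth_swapC_swapC, shear02_neg, onBoth_swapC_swapC]

theorem shear30_neg (t : R) (φ : Idx4 → R) : shear30 t (shear30 (-t) φ) = φ := by
  rw [shear30, shear30, onBoth_swapC_swapC, shear20_neg, onBoth_swapC_swapC]

theorem pencilShear'_neg (t : R) (φ : Idx4 → R) : pencilShear' t (pencilShear' (-t) φ) = φ := by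
  rw [pencilShear', pencilShear', pencilSwap_pencilSwap, pencilShear_neg, pencilSwap_pencilSwap]

/-- The pairs of quadrics which pass through `(1 : 0 : 0 : 0)`, where the first one is singular. -/
def nodal4 (u : Fin 15 → R) : Idx4 → R := fun s =>
  ![![0, 0, 0, 0, u 0, u 1, u 2, u 3, u 4, u 5] s.2,
    ![0, u 6, u 7, u 8, u 9, u 10, u 11, u 12, u 13, u 14] s.2] s.1

/-- The generic singular pair of quadrics, as a function of its parameters. -/
def singular4 (u : Fin 15 → R) (w : Fin 8 → R) : Idx4 → R :=
  onBoth (quadricShear (w 0)) (shear02 (w 1) (shear03 (w 2) (shear10 (w 3) (shear20 (w 4)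
    (shear30 (w 5) (pencilShear (w 6) (pencilShear' (w 7) (nodal4 u))))))))

theorem singular4_map {S : Type*} [CommRing S] (f : R →+* S) (u : Fin 15 → R) (w : Fin 8 → R) :
    (fun s => f (singular4 u w s)) = singular4 (fun i => f (u i)) fun i => f (w i) := by
  have h : (fun s => f (nodal4 u s)) = nodal4 fun i => f (u i) := by
    funext ⟨r, s⟩
    fin_cases r
    · fin_cases s <;> simp [nodal4]
    · fin_cases s <;> simp [nodal4]
  simp only [singular4, shear10, shear02, shear20, shear03, shear30, pencilShear', onBoth_swapA_map,
    onBoth_swapB_map, onBoth_swapC_map, onBoth_shear_map, pencilSwap_map, pencilShear_map, h]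

/-- The determinant of the pencil vanishes to order two at its first member: that quadric is a cone
whose vertex lies on the second quadric. -/
theorem rulings4_nodal4 (u : Fin 15 → R) : SingAt2 (rulings4 (nodal4 u)) 1 0 0 := by
  simp [SingAt2, rulings4, nodal4, pencilCoeff₄, pencilCoeff₃]

theorem jac2_Δ_of_singAt2 {φ : Idx2 → R} (h : SingAt2 φ 1 0 0) : (jac2 φ).Δ = 0 := by
  obtain ⟨h0, -, h2, h3⟩ := h
  simp at h0 h2 h3
  simp only [jac2, WeierstrassCurve.Δ, WeierstrassCurve.b₂, WeierstrassCurve.b₄,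
    WeierstrassCurve.b₆, WeierstrassCurve.b₈, ← h0, ← h2, h3]
  ring

theorem jac2_rulings4_singular4_Δ (u : Fin 15 → R) (w : Fin 8 → R) :
    (jac2 (rulings4 (singular4 u w))).Δ = 0 := by
  simp only [singular4, shear10, shear02, shear20, shear03, shear30, pencilShear', rulings4_swapA,
    rulings4_swapB, rulings4_swapC, rulings4_shear, rulings4_pencilSwap, rulings4_pencilShear,
    jac2_shift2_Δ, jac2_swap2_Δ, jac2_shear2_Δ]
  exact jac2_Δ_of_singAt2 (rulings4_nodal4 u)

theorem exists_shears4_of_ne_zero {k : Type*} [Field k] {x₀ x₁ x₂ x₃ : k}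
    (h : x₀ ≠ 0 ∨ x₁ ≠ 0 ∨ x₂ ≠ 0 ∨ x₃ ≠ 0) :
    ∃ s₁ s₂ s₃ t₁ t₂ t₃ c : k, s₁ = c * x₁ ∧ s₂ = c * x₂ ∧ s₃ = c * x₃ ∧
      1 + t₁ * s₁ + t₂ * s₂ + t₃ * s₃ = c * x₀ := by
  by_cases h1 : x₁ = 0
  · obtain ⟨s, s', t, t', c, e1, e2, e3⟩ := exists_shears3_of_ne_zero (x := x₂) (y := x₃) (z := x₀)
      (by tauto)
    exact ⟨0, s, s', 0, t, t', c, by simp [h1], e1, e2, by linear_combination e3⟩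
  · refine ⟨x₁, x₂, x₃, (x₀ - 1) / x₁, 0, 0, 1, by simp, by simp, by simp, ?_⟩
    field_simp
    ring

theorem exists_eq_nodal4 {φ : Idx4 → R} (h : SingAt4 φ 1 0 1 0 0 0) : ∃ u, φ = nodal4 u := by
  refine ⟨![φ (0, 4), φ (0, 5), φ (0, 6), φ (0, 7), φ (0, 8), φ (0, 9), φ (1, 1), φ (1, 2),
    φ (1, 3), φ (1, 4), φ (1, 5), φ (1, 6), φ (1, 7), φ (1, 8), φ (1, 9)], ?_⟩
  obtain ⟨h0, h1, h2⟩ := h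
  simp only [quadricGrad, Fin.forall_fin_succ, quadricValue] at h0 h1 h2
  simp at h0 h1 h2
  obtain ⟨-, h2, h3, h4⟩ := h2
  funext ⟨r, s⟩
  fin_cases r
  · fin_cases s <;> simp [nodal4, h0, h2, h3, h4]
  · fin_cases s <;> simp [nodal4, h1]

theorem exists_eq_singular4 {k : Type*} [Field k] {φ : Idx4 → k} {c c' x₀ x₁ x₂ x₃ : k}
    (hc : c ≠ 0 ∨ c' ≠ 0) (hP : x₀ ≠ 0 ∨ x₁ ≠ 0 ∨ x₂ ≠ 0 ∨ x₃ ≠ 0)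
    (h : SingAt4 φ c c' x₀ x₁ x₂ x₃) : ∃ u w, φ = singular4 u w := by
  obtain ⟨s₁, s₂, s₃, t₁, t₂, t₃, m, e1, e2, e3, e0⟩ := exists_shears4_of_ne_zero hP
  obtain ⟨s, t, l, es, et⟩ := exists_shears_of_ne_zero hc.symm
  -- Shears of the space move the point to (1 : 0 : 0 : 0), and shears of the pencil move to the
  -- first place the member that is singular there.
  obtain ⟨ψ, hψ⟩ : ∃ ψ, ψ = pencilShear' s (pencilShear t (shear30 s₃ (shear20 s₂ (shear10 s₁
    (shear03 t₃ (shear02 t₂ (onBoth (quadricShear t₁) φ))))))) := ⟨_, rfl⟩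
  have hφ : φ = onBoth (quadricShear (-t₁)) (shear02 (-t₂) (shear03 (-t₃) (shear10 (-s₁)
      (shear20 (-s₂) (shear30 (-s₃) (pencilShear (-t) (pencilShear' (-s) ψ))))))) := by
    have n1 := onBoth_shear_neg (-t₁) φ
    have n2 := shear02_neg (-t₂) (onBoth (quadricShear t₁) φ)
    have n3 := fun ψ : Idx4 → k => shear03_neg (-t₃) ψ
    have n4 := fun ψ : Idx4 → k => shear10_neg (-s₁) ψ
    have n5 := fun ψ : Idx4 → k => shear20_neg (-s₂) ψ
    have n6 := fun ψ : Idx4 → k => shear30_neg (-s₃) ψ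
    have n7 := fun ψ : Idx4 → k => pencilShear_neg (-t) ψ
    have n8 := fun ψ : Idx4 → k => pencilShear'_neg (-s) ψ
    simp only [neg_neg] at n1 n2 n3 n4 n5 n6 n7 n8
    rw [hψ, n8, n7, n6, n5, n4, n3, n2, n1]
  have hψ0 : SingAt4 ψ 1 0 1 0 0 0 := by
    rw [hψ]
    simp only [shear10, shear02, shear20, shear03, shear30, pencilShear', singAt4_swapA,
      singAt4_swapB, singAt4_swapC, singAt4_shear, singAt4_pencilSwap, singAt4_pencilShear]
    convert h.smul l m using 1
    · rw [← et]; ring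
    · rw [← es]; ring
    · rw [← e0]; ring
    · rw [← e1]; ring
    · rw [← e2]; ring
    · rw [← e3]; ring
  obtain ⟨u, rfl⟩ := exists_eq_nodal4 hψ0
  exact ⟨u, ![-t₁, -t₂, -t₃, -s₁, -s₂, -s₃, -t, -s], hφ⟩

end QuadricPairs

/-! ### Isotropic vectors in the kernel of a symmetric matrix -/

section Kernel

variable {k : Type*} [Field k]

open Matrix

/-- A quadratic form has a nontrivial zero on every plane over an algebraically closed field. -/
theorem exists_isotropic_in_plane [IsAlgClosed k] {V : Type*} [AddCommGroup V] [Module k V]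
    (u v : V) (huv : ∀ a b : k, a • u + b • v = 0 → a = 0 ∧ b = 0) (Q : V → k) (B : k)
    (hQ : ∀ a b : k, Q (a • u + b • v) = a ^ 2 * Q u + a * b * B + b ^ 2 * Q v) :
    ∃ a b : k, a • u + b • v ≠ 0 ∧ Q (a • u + b • v) = 0 := by
  by_cases hu : Q u = 0
  · refine ⟨1, 0, fun h => one_ne_zero (huv _ _ h).1, ?_⟩
    rw [hQ, hu]
    ring
  · obtain ⟨s, hs⟩ := exists_quadratic_root hu B (Q v)
    refine ⟨s, 1, fun h => one_ne_zero (huv _ _ h).2, ?_⟩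
    rw [hQ]
    linear_combination hs

/-- If `det (M + t N)` vanishes to order two at `t = 0`, then the kernel of the symmetric matrix
`M` contains an isotropic vector for `N`. -/
theorem exists_isotropic_mem_kernel [IsAlgClosed k] {n : ℕ}
    (M N : Matrix (Fin (n + 1)) (Fin (n + 1)) k)
    (hM : Mᵀ = M) (hdet : M.det = 0) (htr : (M.adjugate * N).trace = 0) :
    ∃ v, v ≠ 0 ∧ M *ᵥ v = 0 ∧ v ⬝ᵥ N *ᵥ v = 0 := by
  obtain ⟨v, hv0, hv⟩ := Matrix.exists_mulVec_eq_zero_iff.mpr hdet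
  obtain ⟨i, hi⟩ : ∃ i, v i ≠ 0 := Function.ne_iff.mp hv0
  set S := M.submatrix i.succAbove i.succAbove with hS
  have hsub : ∀ w : Fin (n + 1) → k, w i = 0 → ∀ j : Fin n,
      (M *ᵥ w) (i.succAbove j) = (S *ᵥ fun l => w (i.succAbove l)) j := by
    intro w hw j
    simp only [Matrix.mulVec, dotProduct]
    rw [Fin.sum_univ_succAbove _ i, hw, mul_zero, zero_add]
    rfl
  -- If the minor vanishes, the kernel of M contains a plane, on which N has an isotropic vector.
  -- Otherwise the kernel is the line of v, and the trace condition says that v itself is isotropic.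
  by_cases hdS : S.det = 0
  · obtain ⟨u', hu0, hu'⟩ := Matrix.exists_mulVec_eq_zero_iff.mpr hdS
    let u : Fin (n + 1) → k := i.insertNth 0 u'
    have hui : u i = 0 := by simp [u]
    have huj : ∀ j, u (i.succAbove j) = u' j := fun j => by simp [u]
    have hMj : ∀ j, (M *ᵥ u) (i.succAbove j) = 0 := by
      intro j
      rw [hsub u hui]
      simp only [huj]
      exact congrFun hu' j
    -- By construction Mu vanishes away from i. Symmetry gives vᵀMu = 0, and vᵢ ≠ 0 then kills the
    -- remaining entry.
    have hMu : M *ᵥ u = 0 := by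
      have h1 : v ⬝ᵥ M *ᵥ u = 0 := by
        rw [Matrix.dotProduct_mulVec, ← Matrix.mulVec_transpose, hM, hv, zero_dotProduct]
      rw [dotProduct, Fin.sum_univ_succAbove _ i] at h1
      simp only [hMj, mul_zero, Finset.sum_const_zero, add_zero] at h1
      funext j
      rcases Fin.eq_self_or_eq_succAbove i j with rfl | ⟨l, rfl⟩
      · exact (mul_eq_zero.mp h1).resolve_left hi
      · exact hMj l
    obtain ⟨a, b, hab, hQ⟩ := exists_isotropic_in_plane v u (fun a b h => by
        have ha : a = 0 := by
          have := congrFun h i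
          simpa [hui, hi] using this
        refine ⟨ha, ?_⟩
        obtain ⟨j, hj⟩ : ∃ j, u' j ≠ 0 := Function.ne_iff.mp hu0
        have := congrFun h (i.succAbove j)
        simpa [ha, huj, hj] using this)
      (fun w => w ⬝ᵥ N *ᵥ w) (v ⬝ᵥ N *ᵥ u + u ⬝ᵥ N *ᵥ v) (fun a b => by
        simp only [Matrix.mulVec_add, Matrix.mulVec_smul, add_dotProduct, dotProduct_add,
          smul_dotProduct, dotProduct_smul, smul_eq_mul]
        ring)
    exact ⟨_, hab, by simp [Matrix.mulVec_add, Matrix.mulVec_smul, hv, hMu], hQ⟩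
  · refine ⟨v, hv0, hv, ?_⟩
    have hker : ∀ w : Fin (n + 1) → k, M *ᵥ w = 0 → ∀ j, w j * v i = w i * v j := by
      intro w hw j
      have h0 : M *ᵥ (v i • w - w i • v) = 0 := by
        simp [Matrix.mulVec_sub, Matrix.mulVec_smul, hv, hw]
      have h1 : (v i • w - w i • v) i = 0 := by
        simp [mul_comm]
      have h2 : (fun l => (v i • w - w i • v) (i.succAbove l)) = 0 := by
        by_contra hne
        refine hdS (Matrix.exists_mulVec_eq_zero_iff.mp ⟨_, hne, funext fun l => ?_⟩)
        rw [← hsub _ h1, h0]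
        rfl
      rcases Fin.eq_self_or_eq_succAbove i j with rfl | ⟨l, rfl⟩
      · rfl
      · have := congrFun h2 l
        simp at this
        linear_combination this
    have hadj : ∀ l, M *ᵥ (fun j => M.adjugate j l) = 0 := by
      intro l
      funext j
      have := congrFun (congrFun (Matrix.mul_adjugate M) j) l
      rw [hdet, zero_smul] at this
      exact this
    have hsymm : ∀ j l, M.adjugate j l = M.adjugate l j := by
      intro j l
      have := Matrix.adjugate_transpose M
      rw [hM] at this
      exact congrFun (congrFun this l) j
    have hii : M.adjugate i i = S.det := by
      rw [Matrix.adjugate_fin_succ_eq_det_submatrix]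
      simp [hS, ← two_mul, pow_mul]
    -- The columns of the adjugate lie in the kernel, and the adjugate is symmetric, so it is a
    -- multiple of vvᵀ; the (i, i) entry fixes the factor. Its trace against N is thus proportional
    -- to vᵀNv.
    have hentry : ∀ j l, v i ^ 2 * M.adjugate j l = S.det * (v j * v l) := by
      intro j l
      have h1 : M.adjugate j l * v i = M.adjugate i l * v j := hker _ (hadj l) j
      have h2 : M.adjugate l i * v i = M.adjugate i i * v l := hker _ (hadj i) l
      rw [hsymm i l] at h1
      rw [hii] at h2
      linear_combination v i * h1 + v j * h2
    have htr' : S.det * (v ⬝ᵥ N *ᵥ v) = v i ^ 2 * (M.adjugate * N).trace := by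
      simp only [Matrix.trace, Matrix.diag, Matrix.mul_apply, dotProduct, Matrix.mulVec,
        Finset.mul_sum]
      rw [Finset.sum_comm]
      refine Finset.sum_congr rfl fun j _ => Finset.sum_congr rfl fun l _ => ?_
      rw [← mul_assoc (v i ^ 2), hentry]
      ring
    rw [htr, mul_zero] at htr'
    exact (mul_eq_zero.mp htr').resolve_left hdS

end Kernel

section QuadricPairs

open Matrix

/-- The matrix of the polar form of a quadratic form. -/
def polarMatrix {R : Type*} [CommRing R] (q : Fin 10 → R) : Matrix (Fin 4) (Fin 4) R :=
  !![2 * q 0, q 1, q 2, q 3;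
     q 1, 2 * q 4, q 5, q 6;
     q 2, q 5, 2 * q 7, q 8;
     q 3, q 6, q 8, 2 * q 9]

variable {R : Type*} [CommRing R]

theorem polarMatrix_mulVec (q : Fin 10 → R) (v : Fin 4 → R) :
    polarMatrix q *ᵥ v = quadricGrad q (v 0) (v 1) (v 2) (v 3) := by
  funext j
  fin_cases j <;> simp [polarMatrix, quadricGrad, Matrix.mulVec, dotProduct, Fin.sum_univ_succ] <;>
    ring

theorem dotProduct_polarMatrix_mulVec (q : Fin 10 → R) (v : Fin 4 → R) :
    v ⬝ᵥ polarMatrix q *ᵥ v = 2 * quadricValue q (v 0) (v 1) (v 2) (v 3) := by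
  rw [polarMatrix_mulVec]
  simp [quadricGrad, quadricValue, dotProduct, Fin.sum_univ_succ]
  ring

theorem polarMatrix_det (q : Fin 10 → R) :
    (polarMatrix q).det = (q 1 * q 8 + q 2 * q 6 + q 3 * q 5) ^ 2 + 4 * pencilCoeff₄ q := by
  simp [polarMatrix, Matrix.det_succ_row_zero, Fin.sum_univ_succ, pencilCoeff₄, Fin.succAbove]
  ring

/-- By Jacobi's formula this is the coefficient of x³z in the determinant of the pencil, namely in
p² + 4q. -/
theorem trace_adjugate_polarMatrix (q r : Fin 10 → R) :
    ((polarMatrix q).adjugate * polarMatrix r).trace =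
      2 * (q 1 * q 8 + q 2 * q 6 + q 3 * q 5)
        * (q 1 * r 8 + q 2 * r 6 + q 3 * r 5 + q 5 * r 3 + q 6 * r 2 + q 8 * r 1)
        + 4 * pencilCoeff₃ q r := by
  simp only [Matrix.trace, Matrix.diag, Matrix.mul_apply,
    Matrix.adjugate_fin_succ_eq_det_submatrix, Matrix.det_fin_three]
  simp [polarMatrix, Fin.sum_univ_succ, pencilCoeff₃, Fin.succAbove]
  ring

end QuadricPairs

/-! ### From a singular double cover to a singular pair of quadrics -/

section QuadricPairs

variable {k : Type*} [Field k]

open Matrix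

theorem ne_zero_coord {w : Fin 4 → k} (h : w ≠ 0) : w 0 ≠ 0 ∨ w 1 ≠ 0 ∨ w 2 ≠ 0 ∨ w 3 ≠ 0 := by
  by_contra! h0
  refine h (funext fun i => ?_)
  fin_cases i <;> simp [h0]

theorem exists_singAt4_of_two_ne_zero [IsAlgClosed k] (h2 : (2 : k) ≠ 0) {φ : Idx4 → k} {y : k}
    (h : SingAt2 (rulings4 φ) 1 0 y) :
    ∃ x₀ x₁ x₂ x₃, (x₀ ≠ 0 ∨ x₁ ≠ 0 ∨ x₂ ≠ 0 ∨ x₃ ≠ 0) ∧ SingAt4 φ 1 0 x₀ x₁ x₂ x₃ := by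
  obtain ⟨e0, -, e2, e3⟩ := h
  simp only [rulings4, Matrix.cons_val] at e0 e2 e3
  have hdet : (polarMatrix fun i => φ (0, i)).det = 0 := by
    rw [polarMatrix_det]
    linear_combination
      (2 * y + (φ (0, 1) * φ (0, 8) + φ (0, 2) * φ (0, 6) + φ (0, 3) * φ (0, 5))) * e3 - 4 * e0
  have htr : ((polarMatrix fun i => φ (0, i)).adjugate * polarMatrix fun i => φ (1, i)).trace
      = 0 := by
    rw [trace_adjugate_polarMatrix]
    linear_combination 2 * (φ (0, 1) * φ (1, 8) + φ (0, 2) * φ (1, 6) + φ (0, 3) * φ (1, 5)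
      + φ (0, 5) * φ (1, 3) + φ (0, 6) * φ (1, 2) + φ (0, 8) * φ (1, 1)) * e3 - 4 * e2
  -- The singular point of the cover is a double zero of the determinant at the first quadric. As 2
  -- is invertible, values of the polar forms on (v, v) determine the quadrics.
  obtain ⟨v, hv0, hv, hN⟩ := exists_isotropic_mem_kernel _ _
    (by ext i j; fin_cases i <;> fin_cases j <;> rfl) hdet htr
  refine ⟨v 0, v 1, v 2, v 3, ne_zero_coord hv0, ?_, ?_, fun j => ?_⟩
  · refine (mul_eq_zero.mp ?_).resolve_left h2
    rw [← dotProduct_polarMatrix_mulVec, hv, dotProduct_zero]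
  · refine (mul_eq_zero.mp ?_).resolve_left h2
    rw [← dotProduct_polarMatrix_mulVec, hN]
  · rw [← polarMatrix_mulVec, hv]
    simp

theorem quadricValue_smul_add_smul {R : Type*} [CommRing R] (q : Fin 10 → R) (u v : Fin 4 → R)
    (a b : R) : quadricValue q ((a • u + b • v) 0) ((a • u + b • v) 1) ((a • u + b • v) 2)
      ((a • u + b • v) 3) = a ^ 2 * quadricValue q (u 0) (u 1) (u 2) (u 3)
        + a * b * (u ⬝ᵥ polarMatrix q *ᵥ v) + b ^ 2 * quadricValue q (v 0) (v 1) (v 2) (v 3) := by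
  rw [polarMatrix_mulVec]
  simp [quadricValue, quadricGrad, dotProduct, Fin.sum_univ_succ]
  ring

theorem exists_quadricValue_eq_zero_in_plane [IsAlgClosed k] (q : Fin 10 → k) (u v : Fin 4 → k)
    (huv : ∀ a b : k, a • u + b • v = 0 → a = 0 ∧ b = 0) :
    ∃ a b : k, a • u + b • v ≠ 0 ∧ quadricValue q ((a • u + b • v) 0) ((a • u + b • v) 1)
      ((a • u + b • v) 2) ((a • u + b • v) 3) = 0 :=
  exists_isotropic_in_plane u v huv (fun w => quadricValue q (w 0) (w 1) (w 2) (w 3)) _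
    (quadricValue_smul_add_smul q u v)

theorem exists_independent_mem_hyperplane (e₀ e₁ e₂ : k) : ∃ u v : Fin 4 → k,
    (∀ a b : k, a • u + b • v = 0 → a = 0 ∧ b = 0) ∧ u 3 = 0 ∧ v 3 = 0 ∧
      e₀ * u 0 + e₁ * u 1 + e₂ * u 2 = 0 ∧ e₀ * v 0 + e₁ * v 1 + e₂ * v 2 = 0 := by
  by_cases h0 : e₀ = 0
  · by_cases h1 : e₁ = 0
    · refine ⟨![1, 0, 0, 0], ![0, 1, 0, 0], fun a b h => ?_, by simp [h0, h1]⟩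
      exact ⟨by simpa using congrFun h 0, by simpa using congrFun h 1⟩
    · refine ⟨![1, 0, 0, 0], ![0, -e₂, e₁, 0], fun a b h => ?_, by simp [h0]; ring⟩
      exact ⟨by simpa using congrFun h 0, by simpa [h1] using congrFun h 2⟩
  · refine ⟨![-e₁, e₀, 0, 0], ![-e₂, 0, e₀, 0], fun a b h => ?_, by simp; constructor <;> ring⟩
    exact ⟨by simpa [h0] using congrFun h 1, by simpa [h0] using congrFun h 2⟩

/-- In characteristic 2 a form with zero polar form is the square of a linear form, so it is
singular at all its zeros. It vanishes on a two-dimensional space of vectors with x₃ = 0, where the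
second quadric has a zero. -/
theorem exists_singAt4_of_polar_eq_zero [IsAlgClosed k] (h2 : (2 : k) = 0) {φ : Idx4 → k}
    (h1 : φ (0, 1) = 0) (h2' : φ (0, 2) = 0) (h3 : φ (0, 3) = 0) (h5 : φ (0, 5) = 0)
    (h6 : φ (0, 6) = 0) (h8 : φ (0, 8) = 0) :
    ∃ x₀ x₁ x₂ x₃, (x₀ ≠ 0 ∨ x₁ ≠ 0 ∨ x₂ ≠ 0 ∨ x₃ ≠ 0) ∧ SingAt4 φ 1 0 x₀ x₁ x₂ x₃ := by
  obtain ⟨e₀, he₀⟩ := exists_sq_eq (φ (0, 0))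
  obtain ⟨e₁, he₁⟩ := exists_sq_eq (φ (0, 4))
  obtain ⟨e₂, he₂⟩ := exists_sq_eq (φ (0, 7))
  obtain ⟨u, v, huv, hu3, hv3, hu, hv⟩ := exists_independent_mem_hyperplane e₀ e₁ e₂
  obtain ⟨a, b, hab, hQ⟩ := exists_quadricValue_eq_zero_in_plane (fun i => φ (1, i)) u v huv
  refine ⟨_, _, _, _, ne_zero_coord hab, ?_, hQ, fun j => ?_⟩
  · simp only [quadricValue, Pi.add_apply, Pi.smul_apply, smul_eq_mul, hu3, hv3, h1, h2', h3, h5,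
      h6, h8, ← he₀, ← he₁, ← he₂]
    linear_combination (a * (e₀ * u 0 + e₁ * u 1 + e₂ * u 2) + b * (e₀ * v 0 + e₁ * v 1 + e₂ * v 2))
      * (a * hu + b * hv) - (e₀ * (a * u 0 + b * v 0) * (e₁ * (a * u 1 + b * v 1))
        + e₀ * (a * u 0 + b * v 0) * (e₂ * (a * u 2 + b * v 2))
        + e₁ * (a * u 1 + b * v 1) * (e₂ * (a * u 2 + b * v 2))) * h2
  · fin_cases j <;> simp [quadricGrad, h1, h2', h3, h5, h6, h8, h2]

/-- In characteristic 2 the polar matrix is alternating with zero Pfaffian, so its kernel is the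
plane of (q₈, 0, q₃, q₂) and (0, q₈, q₆, q₅). On it q is the square of the linear form al₀ + bl₁,
which vanishes at (l₁, l₀). -/
theorem exists_singAt4_of_two_eq_zero_of_ne_zero [IsAlgClosed k] (h2 : (2 : k) = 0)
    {φ : Idx4 → k} {y : k}
    (h : SingAt2 (rulings4 φ) 1 0 y) (h8 : φ (0, 8) ≠ 0) :
    ∃ x₀ x₁ x₂ x₃, (x₀ ≠ 0 ∨ x₁ ≠ 0 ∨ x₂ ≠ 0 ∨ x₃ ≠ 0) ∧ SingAt4 φ 1 0 x₀ x₁ x₂ x₃ := by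
  obtain ⟨e0, -, e2, e3⟩ := h
  simp only [rulings4, Matrix.cons_val] at e0 e2 e3
  set q : Fin 10 → k := fun i => φ (0, i)
  set r : Fin 10 → k := fun i => φ (1, i)
  have hq8 : q 8 ≠ 0 := h8
  have hpf : q 1 * q 8 + q 2 * q 6 + q 3 * q 5 = 0 := by
    linear_combination e3 - y * h2
  have ha : y ^ 2 = pencilCoeff₄ q := by
    linear_combination e0 - y * hpf
  have hb : (q 1 * r 8 + q 2 * r 6 + q 3 * r 5 + q 5 * r 3 + q 6 * r 2 + q 8 * r 1) * y =
      pencilCoeff₃ q r := by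
    linear_combination e2
  have hgrad : ∀ a b : k, ∀ j, quadricGrad q (a * q 8) (b * q 8) (a * q 3 + b * q 6)
      (a * q 2 + b * q 5) j = 0 := by
    intro a b j
    fin_cases j <;> simp [quadricGrad] <;> grind
  obtain ⟨l₀, hl₀⟩ := exists_sq_eq (quadricValue q (q 8) 0 (q 3) (q 2))
  obtain ⟨l₁, hl₁⟩ := exists_sq_eq (quadricValue q 0 (q 8) (q 6) (q 5))
  have hqv : ∀ a b : k, quadricValue q (a * q 8) (b * q 8) (a * q 3 + b * q 6)
      (a * q 2 + b * q 5) = (a * l₀ + b * l₁) ^ 2 := by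
    intro a b
    simp only [quadricValue] at hl₀ hl₁ ⊢
    grind
  set s := q 2 * q 5 * q 9 + q 2 * q 6 * q 8 + q 3 * q 5 * q 8 + q 3 * q 6 * q 7
  -- The product of the two values of q is s² + q₈² times the leading coefficient of the cover,
  -- which is y². Square roots are unique in characteristic 2.
  have hll : l₀ * l₁ = s + q 8 * y := by
    have hsq : (l₀ * l₁ - (s + q 8 * y)) ^ 2 = 0 := by
      simp only [quadricValue] at hl₀ hl₁
      simp only [pencilCoeff₄] at ha
      grind
    exact sub_eq_zero.mp (pow_eq_zero_iff two_ne_zero |>.mp hsq)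
  -- Expanding r at this point, the mixed term carries l₀l₁ times the polar form of r on the two
  -- kernel vectors, which is q₈ times the middle coefficient of p. The derivative condition `hb` at
  -- the singular point makes the sum vanish.
  have hr : quadricValue r (l₁ * q 8) (l₀ * q 8) (l₁ * q 3 + l₀ * q 6)
      (l₁ * q 2 + l₀ * q 5) = 0 := by
    simp only [quadricValue] at hl₀ hl₁ ⊢
    simp only [pencilCoeff₃] at hb
    grind
  by_cases hl : l₀ = 0 ∧ l₁ = 0
  · obtain ⟨a, b, hab, hQ⟩ := exists_quadricValue_eq_zero_in_plane r ![q 8, 0, q 3, q 2]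
      ![0, q 8, q 6, q 5] fun a b h =>
        ⟨by simpa [hq8] using congrFun h 0, by simpa [hq8] using congrFun h 1⟩
    refine ⟨_, _, _, _, ne_zero_coord hab, ?_, hQ, fun j => ?_⟩
    · simpa [hl] using hqv a b
    · simpa using hgrad a b j
  · refine ⟨l₁ * q 8, l₀ * q 8, l₁ * q 3 + l₀ * q 6, l₁ * q 2 + l₀ * q 5, ?_, ?_, hr, fun j => ?_⟩
    · by_contra! h0
      exact hl ⟨by simpa [hq8] using h0.2.1, by simpa [hq8] using h0.1⟩
    · rw [hqv]
      linear_combination 2 * (l₀ * l₁) ^ 2 * h2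
    · simpa using hgrad l₁ l₀ j

end QuadricPairs

section QuadricPairs

variable {k : Type*} [Field k] [IsAlgClosed k]

/-- Exchanges of variables bring any nonzero off-diagonal coefficient to the position x₂x₃, and they
do not change `rulings4`. -/
theorem exists_singAt4_of_two_eq_zero (h2 : (2 : k) = 0) {φ : Idx4 → k} {y : k}
    (h : SingAt2 (rulings4 φ) 1 0 y) :
    ∃ x₀ x₁ x₂ x₃, (x₀ ≠ 0 ∨ x₁ ≠ 0 ∨ x₂ ≠ 0 ∨ x₃ ≠ 0) ∧ SingAt4 φ 1 0 x₀ x₁ x₂ x₃ := by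
  have h23 : ∀ {φ : Idx4 → k} {y : k}, SingAt2 (rulings4 φ) 1 0 y → φ (0, 8) ≠ 0 →
      ∃ x₀ x₁ x₂ x₃, (x₀ ≠ 0 ∨ x₁ ≠ 0 ∨ x₂ ≠ 0 ∨ x₃ ≠ 0) ∧ SingAt4 φ 1 0 x₀ x₁ x₂ x₃ :=
    fun h h8 => exists_singAt4_of_two_eq_zero_of_ne_zero h2 h h8
  have h13 : ∀ {φ : Idx4 → k} {y : k}, SingAt2 (rulings4 φ) 1 0 y → φ (0, 6) ≠ 0 →
      ∃ x₀ x₁ x₂ x₃, (x₀ ≠ 0 ∨ x₁ ≠ 0 ∨ x₂ ≠ 0 ∨ x₃ ≠ 0) ∧ SingAt4 φ 1 0 x₀ x₁ x₂ x₃ := by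
    intro φ y h h6
    rw [← rulings4_swapB] at h
    obtain ⟨x₀, x₁, x₂, x₃, hx, hs⟩ := h23 h h6
    exact ⟨_, _, _, _, by tauto, singAt4_swapB.mp hs⟩
  have h03 : ∀ {φ : Idx4 → k} {y : k}, SingAt2 (rulings4 φ) 1 0 y → φ (0, 3) ≠ 0 →
      ∃ x₀ x₁ x₂ x₃, (x₀ ≠ 0 ∨ x₁ ≠ 0 ∨ x₂ ≠ 0 ∨ x₃ ≠ 0) ∧ SingAt4 φ 1 0 x₀ x₁ x₂ x₃ := by
    intro φ y h h6
    rw [← rulings4_swapA] at h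
    obtain ⟨x₀, x₁, x₂, x₃, hx, hs⟩ := h13 h h6
    exact ⟨_, _, _, _, by tauto, singAt4_swapA.mp hs⟩
  have h12 : ∀ {φ : Idx4 → k} {y : k}, SingAt2 (rulings4 φ) 1 0 y → φ (0, 5) ≠ 0 →
      ∃ x₀ x₁ x₂ x₃, (x₀ ≠ 0 ∨ x₁ ≠ 0 ∨ x₂ ≠ 0 ∨ x₃ ≠ 0) ∧ SingAt4 φ 1 0 x₀ x₁ x₂ x₃ := by
    intro φ y h h6
    rw [← rulings4_swapC] at h
    obtain ⟨x₀, x₁, x₂, x₃, hx, hs⟩ := h13 h h6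
    exact ⟨_, _, _, _, by tauto, singAt4_swapC.mp hs⟩
  have h02 : ∀ {φ : Idx4 → k} {y : k}, SingAt2 (rulings4 φ) 1 0 y → φ (0, 2) ≠ 0 →
      ∃ x₀ x₁ x₂ x₃, (x₀ ≠ 0 ∨ x₁ ≠ 0 ∨ x₂ ≠ 0 ∨ x₃ ≠ 0) ∧ SingAt4 φ 1 0 x₀ x₁ x₂ x₃ := by
    intro φ y h h6
    rw [← rulings4_swapC] at h
    obtain ⟨x₀, x₁, x₂, x₃, hx, hs⟩ := h03 h h6
    exact ⟨_, _, _, _, by tauto, singAt4_swapC.mp hs⟩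
  have h01 : ∀ {φ : Idx4 → k} {y : k}, SingAt2 (rulings4 φ) 1 0 y → φ (0, 1) ≠ 0 →
      ∃ x₀ x₁ x₂ x₃, (x₀ ≠ 0 ∨ x₁ ≠ 0 ∨ x₂ ≠ 0 ∨ x₃ ≠ 0) ∧ SingAt4 φ 1 0 x₀ x₁ x₂ x₃ := by
    intro φ y h h6
    rw [← rulings4_swapB] at h
    obtain ⟨x₀, x₁, x₂, x₃, hx, hs⟩ := h02 h h6
    exact ⟨_, _, _, _, by tauto, singAt4_swapB.mp hs⟩
  by_cases e8 : φ (0, 8) = 0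
  · by_cases e6 : φ (0, 6) = 0
    · by_cases e3 : φ (0, 3) = 0
      · by_cases e5 : φ (0, 5) = 0
        · by_cases e2 : φ (0, 2) = 0
          · by_cases e1 : φ (0, 1) = 0
            · exact exists_singAt4_of_polar_eq_zero h2 e1 e2 e3 e5 e6 e8
            · exact h01 h e1
          · exact h02 h e2
        · exact h12 h e5
      · exact h03 h e3
    · exact h13 h e6
  · exact h23 h e8

theorem exists_singAt4_of_singAt2_rulings4 {φ : Idx4 → k} {y : k}
    (h : SingAt2 (rulings4 φ) 1 0 y) :
    ∃ x₀ x₁ x₂ x₃, (x₀ ≠ 0 ∨ x₁ ≠ 0 ∨ x₂ ≠ 0 ∨ x₃ ≠ 0) ∧ SingAt4 φ 1 0 x₀ x₁ x₂ x₃ := by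
  by_cases h2 : (2 : k) = 0
  · exact exists_singAt4_of_two_eq_zero h2 h
  · exact exists_singAt4_of_two_ne_zero h2 h

theorem exists_singAt4 {φ : Idx4 → k} (hφ : (jac2 (rulings4 φ)).Δ = 0) :
    ∃ c c' x₀ x₁ x₂ x₃, (c ≠ 0 ∨ c' ≠ 0) ∧ (x₀ ≠ 0 ∨ x₁ ≠ 0 ∨ x₂ ≠ 0 ∨ x₃ ≠ 0) ∧
      SingAt4 φ c c' x₀ x₁ x₂ x₃ := by
  obtain ⟨x, z, y, hxz, h⟩ := exists_singAt2 hφ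
  by_cases hx : x = 0
  · have hz : z ≠ 0 := hxz.resolve_left (not_not.mpr hx)
    have h' : SingAt2 (rulings4 (pencilSwap φ)) 1 0 (z⁻¹ ^ 2 * y) := by
      rw [rulings4_pencilSwap, singAt2_swap2]
      simpa [hx, hz] using h.smul z⁻¹
    obtain ⟨x₀, x₁, x₂, x₃, hP, hs⟩ := exists_singAt4_of_singAt2_rulings4 h'
    exact ⟨_, _, _, _, _, _, by simp, hP, singAt4_pencilSwap.mp hs⟩
  -- A change of basis of the pencil puts the member over the singular point of the cover in the
  -- first place.
  · have h' : SingAt2 (rulings4 (pencilSwap (pencilShear (x⁻¹ * z) (pencilSwap φ)))) 1 0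
        (x⁻¹ ^ 2 * y) := by
      simp only [rulings4_pencilSwap, rulings4_pencilShear, singAt2_swap2, singAt2_shear2]
      simpa [hx] using h.smul x⁻¹
    obtain ⟨x₀, x₁, x₂, x₃, hP, hs⟩ := exists_singAt4_of_singAt2_rulings4 h'
    simp only [singAt4_pencilSwap, singAt4_pencilShear] at hs
    exact ⟨_, _, _, _, _, _, by simp, hP, hs⟩

end QuadricPairs

/-! ### The discriminant in degree 4 and its normalisation -/

section QuadricPairs

variable {R : Type*} [CommRing R]

/-- The discriminant of pairs of quaternary quadrics. -/
noncomputable def disc4 : MvPolynomial Idx4 ℤ := (jac2 (rulings4 X)).Δ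

theorem aeval_disc4 [Algebra ℤ R] (φ : Idx4 → R) : aeval φ disc4 = (jac2 (rulings4 φ)).Δ := by
  have h := (jac2 (rulings4 (X : Idx4 → MvPolynomial Idx4 ℤ))).map_Δ
    (aeval φ : _ →ₐ[ℤ] R).toRingHom
  rw [jac2_map, rulings4_map] at h
  simpa [disc4] using h.symm

/-- A pencil of pairs of quaternary quadrics. -/
noncomputable def pencil4 : Idx4 → Polynomial ℤ := fun s =>
  ![![0, 0, 0, 1, -1, 0, 0, 0, 0, 0], ![-Polynomial.X, 0, 0, 0, 0, 1, -1, 1, 0, 0]] s.1 s.2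

/-- The quadrics are x₀x₃ - x₁² and x₂² + x₁x₂ - x₁x₃ - Tx₀². With x₀ = 1, x₁ = x, x₂ = y, x₃ = x²
they give once more y² + xy = x³ + T. -/
theorem aeval_pencil4 : aeval pencil4 disc4 = Polynomial.X * (-1 - 432 * Polynomial.X) := by
  rw [aeval_disc4]
  simp [rulings4, pencilCoeff₄, pencilCoeff₃, pencilCoeff₂, jac2, pencil4, WeierstrassCurve.Δ,
    WeierstrassCurve.b₂, WeierstrassCurve.b₄, WeierstrassCurve.b₆, WeierstrassCurve.b₈]
  ring

theorem isDiscriminant_disc4 : IsDiscriminant.{u} Sing4 disc4 := by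
  refine isDiscriminant_of_generic disc4
    (singular4 (fun i => (X (Sum.inl i) : MvPolynomial (Fin 15 ⊕ Fin 8) ℤ))
      fun i => X (Sum.inr i))
    ((aeval_disc4 _).trans (jac2_rulings4_singular4_Δ _ _)) ?_ ?_ pencil4 _ aeval_pencil4 (by simp)
  · intro k _ _ φ h
    obtain ⟨c, c', x₀, x₁, x₂, x₃, hc, hP, h⟩ := (sing4_iff φ).mp h
    obtain ⟨u, w, rfl⟩ := exists_eq_singular4 hc hP h
    refine ⟨eval₂Hom (Int.castRingHom k) (Sum.elim u w), fun s => ?_⟩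
    rw [congrFun (singular4_map _ _ _) s]
    simp
  · intro k _ _ φ h
    rw [aeval_disc4] at h
    exact (sing4_iff φ).mpr (exists_singAt4 h)

end QuadricPairs

section QuadricPairs

variable {K : Type*} [Field K]

theorem two_smul_pencil_genericMatrix (h2 : (2 : K) ≠ 0) :
    (2 : Polynomial (MvPolynomial Idx4 K)) •
      ((Polynomial.X : Polynomial (MvPolynomial Idx4 K)) • (genericMatrix K 0).map Polynomial.C
        + (genericMatrix K 1).map Polynomial.C) =
      polarMatrix fun i => Polynomial.C (X (1, i)) + Polynomial.X * Polynomial.C (X (0, i)) := by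
  have h : (C (1 / 2) : MvPolynomial Idx4 K) * 2 = 1 :=
    C_mul_ofNat_eq_one 2 (by exact_mod_cast h2)
  have hC : ∀ P : MvPolynomial Idx4 K,
      2 * Polynomial.C ((1 / 2 : K) • P) = Polynomial.C P := by
    intro P
    rw [← map_ofNat Polynomial.C 2, ← Polynomial.C_mul, smul_eq_C_mul]
    congr 1
    linear_combination P * h
  ext1 i j
  fin_cases i <;> fin_cases j <;>
    simp only [genericMatrix, polarMatrix, Matrix.smul_apply, Matrix.add_apply, Matrix.map_apply,
      Matrix.of_apply, Fin.reduceFinMk, Fin.zero_eta, Fin.mk_one, Matrix.cons_val, smul_eq_mul] <;>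
    first
      | ring1
      | linear_combination Polynomial.X * hC (X (0, _)) + hC (X (1, _))

/-- The polar matrix is twice the symmetric matrix, so its determinant p² + 4q is 2⁴ det(xA + zB).
This is the case l = 2 of `jac2_c₄_c₆`, hence λ = 1/2. -/
theorem genericQuartic4_eq (h2 : (2 : K) ≠ 0) :
    16 * genericQuartic4 K =
      Polynomial.C (rulings4 X 0 ^ 2 + 4 * rulings4 X 3) * Polynomial.X ^ 4
      + Polynomial.C (2 * rulings4 X 0 * rulings4 X 1 + 4 * rulings4 X 4) * Polynomial.X ^ 3
      + Polynomial.C (rulings4 X 1 ^ 2 + 2 * rulings4 X 0 * rulings4 X 2 + 4 * rulings4 X 5)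
        * Polynomial.X ^ 2
      + Polynomial.C (2 * rulings4 X 1 * rulings4 X 2 + 4 * rulings4 X 6) * Polynomial.X
      + Polynomial.C (rulings4 X 2 ^ 2 + 4 * rulings4 X 7) := by
  have h := congrArg Matrix.det (two_smul_pencil_genericMatrix h2)
  rw [Matrix.det_smul, polarMatrix_det, pencilCoeff₄_add, Fintype.card_fin] at h
  have hh : 16 * genericQuartic4 K = 2 ^ 4 * genericQuartic4 K := by norm_num
  rw [hh]
  refine h.trans ?_
  simp only [← pencilCoeff₄_map, ← pencilCoeff₃_map, ← pencilCoeff₂_map, rulings4, Matrix.cons_val,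
    Polynomial.C_add, Polynomial.C_mul, Polynomial.C_pow]
  rw [show (Polynomial.C 2 : Polynomial (MvPolynomial Idx4 K)) = 2 from map_ofNat _ 2,
    show (Polynomial.C 4 : Polynomial (MvPolynomial Idx4 K)) = 4 from map_ofNat _ 4]
  ring

theorem map_disc4 (h2 : (2 : K) ≠ 0) (h3 : (3 : K) ≠ 0) :
    map (Int.castRingHom K) disc4 = C (2 ^ (12 : ℤ)) * pullbackDiscW K (toW4 K) := by
  obtain ⟨e4, e3, e2, e1, e0⟩ := quartic_coeff _ _ _ _ _ _ (genericQuartic4_eq h2)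
  have h16 : ∀ n, (16 * genericQuartic4 K).coeff n = 16 * (genericQuartic4 K).coeff n := by
    intro n
    rw [← map_ofNat Polynomial.C 16, Polynomial.coeff_C_mul]
  rw [h16] at e4 e3 e2 e1 e0
  have hc := jac2_c₄_c₆ (A := MvPolynomial Idx4 K) (K := K) (rulings4 X) h2 h3 (genericQuartic4 K) 2
    (by linear_combination e4) (by linear_combination e3) (by linear_combination e2)
    (by linear_combination e1) (by linear_combination e0)
  have h : (C (1 / 2) : MvPolynomial Idx4 K) * 2 = 1 :=
    C_mul_ofNat_eq_one 2 (by exact_mod_cast h2)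
  rw [pullbackDiscW_eq h2 h3 (toW4 K) (jac2 (rulings4 X)) (1 / 2), disc4, map_jac2, rulings4_map,
    ← mul_assoc, ← C_mul, show (2 : K) ^ (12 : ℤ) = 2 ^ 12 from zpow_natCast 2 12, ← mul_pow,
    mul_one_div_cancel h2]
  · simp
  · rw [← hc.1, C_pow, ← mul_assoc, ← mul_pow, h, one_pow, one_mul]
    rfl
  · rw [← hc.2, C_pow, ← mul_assoc, ← mul_pow, h, one_pow, one_mul]
    rfl

end QuadricPairs

end GenusOne

theorem mainTheorem5 :
    ((∃ D : MvPolynomial GenusOne.Idx2 ℤ, GenusOne.IsDiscriminant.{u} GenusOne.Sing2 D) ∧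
      ∀ D : MvPolynomial GenusOne.Idx2 ℤ, GenusOne.IsDiscriminant.{u} GenusOne.Sing2 D →
        ∃ ε : ℤ, (ε = 1 ∨ ε = -1) ∧
          ∀ (K : Type v) [Field K], (2 : K) ≠ 0 → (3 : K) ≠ 0 → ∀ c : K,
            (MvPolynomial.map (Int.castRingHom K) D =
                MvPolynomial.C c * GenusOne.pullbackDiscW K (GenusOne.toW2 K)) ↔
              c = (ε : K) * 2 ^ (0 : ℤ)) ∧
    ((∃ D : MvPolynomial GenusOne.Idx3 ℤ, GenusOne.IsDiscriminant.{u} GenusOne.Sing3 D) ∧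
      ∀ D : MvPolynomial GenusOne.Idx3 ℤ, GenusOne.IsDiscriminant.{u} GenusOne.Sing3 D →
        ∃ ε : ℤ, (ε = 1 ∨ ε = -1) ∧
          ∀ (K : Type v) [Field K], (2 : K) ≠ 0 → (3 : K) ≠ 0 → ∀ c : K,
            (MvPolynomial.map (Int.castRingHom K) D =
                MvPolynomial.C c * GenusOne.pullbackDiscW K (GenusOne.toW3 K)) ↔
              c = (ε : K) * 2 ^ (-12 : ℤ)) ∧
    ((∃ D : MvPolynomial GenusOne.Idx4 ℤ, GenusOne.IsDiscriminant.{u} GenusOne.Sing4 D) ∧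
      ∀ D : MvPolynomial GenusOne.Idx4 ℤ, GenusOne.IsDiscriminant.{u} GenusOne.Sing4 D →
        ∃ ε : ℤ, (ε = 1 ∨ ε = -1) ∧
          ∀ (K : Type v) [Field K], (2 : K) ≠ 0 → (3 : K) ≠ 0 → ∀ c : K,
            (MvPolynomial.map (Int.castRingHom K) D =
                MvPolynomial.C c * GenusOne.pullbackDiscW K (GenusOne.toW4 K)) ↔
              c = (ε : K) * 2 ^ (12 : ℤ)) :=
  ⟨GenusOne.discriminant_comparison GenusOne.isDiscriminant_disc2
      (fun K _ => GenusOne.pullbackDiscW K (GenusOne.toW2 K)) 0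
      (fun _ _ h2 h3 => GenusOne.map_disc2 h2 h3) GenusOne.pencil2 _ GenusOne.aeval_pencil2
      (by simp),
    GenusOne.discriminant_comparison GenusOne.isDiscriminant_disc3
      (fun K _ => GenusOne.pullbackDiscW K (GenusOne.toW3 K)) (-12)
      (fun _ _ h2 h3 => GenusOne.map_disc3 h2 h3) GenusOne.pencil3 _ GenusOne.aeval_pencil3
      (by simp),
    GenusOne.discriminant_comparison GenusOne.isDiscriminant_disc4
      (fun K _ => GenusOne.pullbackDiscW K (GenusOne.toW4 K)) 12
      (fun _ _ h2 h3 => GenusOne.map_disc4 h2 h3) GenusOne.pencil4 _ GenusOne.aeval_pencil4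
      (by simp)⟩
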